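/- Let $d\ge 1$ be an integer and $p\ge 0$ a real number. Let $\sigma_d$ be the normalized surface measure on the unit sphere $\mathbb S^d\subset\mathbb R^{d+1}$, let $X_1,\dots,X_N$ be independent $\sigma_d$-distributed random points, and let $K_N$ be their convex hull, with $f_d$ facets ($d$-dimensional faces) $F_1,\dots,F_{f_d}$. The hyperplane spanned by $F_k$ cuts $\mathbb S^d$ into an open spherical cap containing none of the points and a closed cap containing all of them; the Euclidean hole radius $\rho_k$ is the Euclidean distance in $\mathbb R^{d+1}$ from the boundary of this open cap to its centre on $\mathbb S^d$ (so $\rho_k=2\sin(\alpha_k/2)$, where $\alpha_k\in[0,\pi]$ is the geodesic radius of the cap). Put $\omega_m=2\pi^{(m+1)/2}/\Gamma((m+1)/2)$ and, for $m\ge1$, $$\kappa_m=\frac1m\,\frac{\omega_{m-1}}{\omega_m},\qquad B_d=\frac{2}{d+1}\,\frac{\kappa_{d^2}}{(\kappa_d)^d},\qquad c_{d,p}=B_d\,\frac{\Gamma(d+p/d)}{\Gamma(d)}\,(\kappa_d)^{-p/d}.$$ Then the following hold as $N\to\infty$, with $\mathcal O$-terms depending only on $d$ and $p$ (and on $L$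 in (iv)). For $N\ge d+2$ the random variables below are integrable. (i) For all $d\ge1$, $$\mathbb E\Big[\sum_{k=1}^{f_d}\rho_k^p\Big]=B_d\,(\kappa_d)^{-p/d}\,\frac{\Gamma(d+p/d)\,\Gamma(N+1)}{\Gamma(d)\,\Gamma(N+p/d)}\,\big\{1+\mathcal O(N^{-2/d})\big\}.$$ (ii) If $d\ge2$, then $$\mathbb E\Big[\sum_{k=1}^{f_d}\rho_k^p\Big]=c_{d,p}\,N^{1-p/d}\,\big\{1+\mathcal O(N^{-2/d})\big\};$$ if $d=1$, the same holds with $\mathcal O(N^{-1})$ in place of $\mathcal O(N^{-2/d})$. (iii) For all $d\ge1$, $\mathbb E[f_d]=B_d\,N\,\{1+\mathcal O(N^{-2/d})\}$. (iv) If $d=2$, then for every integer $L\ge1$ $$\mathbb E\Big[\sum_{k=1}^{f_2}\rho_k^p\Big]=(2N-4)\,2^p\,\Gamma\!\left(2+\tfrac p2\right)N^{-p/2}\Big\{1+\sum_{\ell=1}^{L-1}\binom{-p/2}{\ell}\frac{B_\ell^{(1-p/2)}(1)}{N^\ell}+\mathcal O(N^{-L})\Big\},$$ where the generalized Bernoulli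 polynomials $B_\ell^{(a)}(x)$ are defined by $\big(\tfrac{t}{e^t-1}\big)^a e^{xt}=\sum_{\ell\ge0}B_\ell^{(a)}(x)\,\tfrac{t^\ell}{\ell!}$. -/

import Mathlib

open MeasureTheory ProbabilityTheory Filter Asymptotics

universe u

noncomputable section

namespace HoleRadii

/-- The ambient Euclidean space `ℝ^(d+1)`. -/
abbrev Space (d : ℕ) : Type := EuclideanSpace ℝ (Fin (d + 1))

/-- The unit sphere `S^d` in `ℝ^(d+1)`. -/
abbrev Sph (d : ℕ) : Type := Metric.sphere (0 : Space d) 1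

/-- The surface area measure of `S^d`, normalized to a probability measure. -/
def sigma (d : ℕ) : Measure (Sph d) :=
  ((volume : Measure (Space d)).toSphere Set.univ)⁻¹ • (volume : Measure (Space d)).toSphere

/-- The convex hull of a configuration of `N` points on `S^d`. -/
def hull {d N : ℕ} (x : Fin N → Sph d) : Set (Space d) :=
  convexHull ℝ (Set.range fun i => (x i : Space d))

/-- The facets of the convex hull: its `d`-dimensional (exposed) faces. A facet is recorded as the
subset of `ℝ^(d+1)` that it is. -/
def facets {d N : ℕ} (x : Fin N → Sph d) : Set (Set (Space d)) :=
  {F | IsExposed ℝ (hull x) F ∧ Module.finrank ℝ (vectorSpan ℝ F) = d}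

/-- A configuration has finitely many facets, so the sum and the count below are finite ones. -/
theorem facets_finite {d N : ℕ} (x : Fin N → Sph d) : (facets x).Finite := by
  let V : Set (Space d) := Set.range fun i => (x i : Space d)
  have hV : V.Finite := Set.finite_range _
  refine Set.Finite.subset ((hV.finite_subsets).image (fun s => convexHull ℝ s)) ?_
  rintro F ⟨hF, -⟩
  refine ⟨F ∩ V, Set.inter_subset_right, ?_⟩
  have hc : IsCompact (hull x) := hV.isCompact_convexHull ℝ
  have hFc : IsCompact F := hF.isCompact hc
  have hFconv : Convex ℝ F := hF.convex (convex_convexHull ℝ _)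
  apply Set.Subset.antisymm
  · exact convexHull_min Set.inter_subset_left hFconv
  · have he : F.extremePoints ℝ ⊆ F ∩ V := fun y hy => ⟨hy.1,
      extremePoints_convexHull_subset (hF.isExtreme.extremePoints_subset_extremePoints hy)⟩
    have hcl : IsClosed (convexHull ℝ (F ∩ V)) :=
      ((hV.subset Set.inter_subset_right).isCompact_convexHull ℝ).isClosed
    have hsub : closure (convexHull ℝ (F.extremePoints ℝ)) ⊆ convexHull ℝ (F ∩ V) :=
      closure_minimal (convexHull_mono he) hcl
    rwa [closure_convexHull_extremePoints hFc hFconv] at hsub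

/-- `u` is an outer unit normal of the face `F` of the set `K`: the linear functional `⟪u, ·⟫`
attains its maximum over `K` exactly on `F`. -/
def IsOuterNormal {d : ℕ} (K F : Set (Space d)) (u : Space d) : Prop :=
  ‖u‖ = 1 ∧ F = {z ∈ K | ∀ y ∈ K, inner ℝ u y ≤ inner ℝ u z}

/-- The centre, on the sphere, of the hole above the facet `F`: the hyperplane spanned by `F` cuts
the sphere into an open cap without points of the configuration and a closed cap with all of them,
and the centre of the former is the outer unit normal of `F` (which is unique when the convex hull
is full-dimensional). -/
def holeCentre {d N : ℕ} (x : Fin N → Sph d) (F : Set (Space d)) : Space d :=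
  Classical.epsilon (IsOuterNormal (hull x) F)

/-- The boundary of the hole above `F`: the points of the sphere in the hyperplane spanned by `F`. -/
def holeBoundary {d : ℕ} (F : Set (Space d)) : Set (Space d) :=
  (affineSpan ℝ F : Set (Space d)) ∩ Metric.sphere 0 1

/-- The Euclidean hole radius of the facet `F`: the Euclidean distance between the centre of the
hole and the boundary of the hole (all of whose points are equidistant from the centre). -/
def holeRadius {d N : ℕ} (x : Fin N → Sph d) (F : Set (Space d)) : ℝ :=
  Metric.infDist (holeCentre x F) (holeBoundary F)

/-- The sum of the `p`-th powers of the hole radii, one for each of the finitely many facets. -/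
def holeRadiusSum {d N : ℕ} (p : ℝ) (x : Fin N → Sph d) : ℝ :=
  ∑ᶠ F ∈ facets x, holeRadius x F ^ p

/-- The number `f_d` of facets. -/
def facetCount {d N : ℕ} (x : Fin N → Sph d) : ℝ :=
  ((facets x).ncard : ℝ)

/-- For all independent `σ_d`-distributed random points `X_1, …, X_N` on `S^d`, on whatever
probability space, `g (X_1, …, X_N)` is integrable with expected value `m`. -/
def HasUniformMean {d N : ℕ} (g : (Fin N → Sph d) → ℝ) (m : ℝ) : Prop :=
  ∀ (Ω : Type u) [MeasurableSpace Ω] (P : Measure Ω) [IsProbabilityMeasure P]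
    (X : Fin N → Ω → Sph d),
    (∀ i, HasLaw (X i) (sigma d) P) → iIndepFun X P →
      Integrable (fun ω => g fun i => X i ω) P ∧ ∫ ω, g (fun i => X i ω) ∂P = m

/-- The surface area `ω_d = 2 π^((d+1)/2) / Γ((d+1)/2)` of `S^d`. -/
def omega (d : ℕ) : ℝ :=
  2 * Real.pi ^ (((d : ℝ) + 1) / 2) / Real.Gamma (((d : ℝ) + 1) / 2)

/-- `κ_d = (1/d) ω_(d-1) / ω_d`, for `d ≥ 1`. -/
def kappa (d : ℕ) : ℝ :=
  1 / (d : ℝ) * (omega (d - 1) / omega d)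

/-- `B_d = (2/(d+1)) κ_(d²) / κ_d^d`, for `d ≥ 1`. -/
def facetConst (d : ℕ) : ℝ :=
  2 / ((d : ℝ) + 1) * (kappa (d ^ 2) / kappa d ^ d)

/-- `c_(d,p) = B_d Γ(d + p/d) / Γ(d) κ_d^(-p/d)`. -/
def momentConst (d : ℕ) (p : ℝ) : ℝ :=
  facetConst d * (Real.Gamma (d + p / d) / Real.Gamma d * kappa d ^ (-(p / d)))

/-- The generalized Bernoulli polynomial `B_n^(a)(x)`, that is, `n!` times the coefficient of `t^n`
in the Taylor expansion at `0` of `(t / (e^t - 1))^a e^(x t)`, where `t / (e^t - 1)` is continued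
by `1` to `t = 0`. -/
def genBernoulli (n : ℕ) (a x : ℝ) : ℝ :=
  iteratedDeriv n
    (fun t : ℝ => (if t = 0 then 1 else t / (Real.exp t - 1)) ^ a * Real.exp (x * t)) 0

end HoleRadii

end

open HoleRadii

open HoleRadii
open scoped ENNReal NNReal Topology

noncomputable section

namespace HoleRadii

/-! ### Product measures with densities -/

/-! For points in general position the facets are the simplices on `d + 1` of the points whose
hyperplane has all other points on one side (`Generic.holeRadiusSum_eq`). If `t` is the signed
distance of that hyperplane from the origin along the outer normal, the hole has squared radius `2 -
2t`, and each other point lies on the required side with probability `W(t) = capMass d t`. Linearity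
and symmetry in the sign of `t` give the exact mean `meanRadius`, namely `2 * N.choose (d + 1)`
times the integral of `(2 - 2t)^(p/2) * W(t)^(N - d - 1)` against the law of `t`
(`hasUniformMean_holeRadiusSum`).

Two laws are needed: the height of one point, with density proportional to `(1 - s²)^(d/2 - 1)`
(`map_inner_sigma`), and the distance of a hyperplane through `d + 1` points, with density
proportional to `(1 - t²)^(d²/2 - 1)` (`map_planeDist_sigma`). No integral formula on the sphere is
used. The uniform law is the limit, as `ε → 0`, of laws on the ball with densities proportional to
`(1 - ‖x‖²)^(ε - 1)` (`tendsto_lintegral_ballDens`). For these, hyperplanes are parametrized as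
graphs of affine functions, the Jacobian is a determinant, and the dependence on `t` follows from
scaling a slice of the ball to the unit ball. All other factors are constants that cancel on
normalization (`map_pi_sigma_eq_map_sqLaw`).

For the asymptotics, the mean is rewritten as an integral against the law of one height, under which
`W` is uniform on `[0, 1]`. Near `t = 1` the cap of Euclidean radius `ρ` has mass `1 - W = κ ρ^d (1
+ O(ρ²))`, so the integrand differs from a multiple of `(1 - W)^a`, `a = d - 1 + p/d`, by `O((1 -
W)^(a + 2/d))` (`exists_abs_integrand_sub_le`). Both terms integrate to Beta values, and their
quotient is of order `N^(-2/d)`.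

The ratio `Γ(N + 1)/Γ(N + 1 + q)` is a Beta integral; with `u = e^(-t)` it becomes a Laplace
integral whose amplitude generates the generalized Bernoulli numbers at `x = 1`, and integrating its
Taylor polynomial termwise gives the full expansion (`exists_gamma_ratio_expansion`). For `d = 2`
the integrand is exactly a Beta integrand, so the mean has a closed form (`meanRadius_two`) and
inherits this expansion. -/

lemma lintegral_pi_prod {α : Type*} [MeasurableSpace α] (k : ℕ) (μ : Fin k → Measure α)
    [∀ i, SigmaFinite (μ i)] (f : Fin k → α → ℝ≥0∞) (hf : ∀ i, Measurable (f i)) :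
    ∫⁻ x, ∏ i, f i (x i) ∂Measure.pi μ = ∏ i, ∫⁻ a, f i a ∂μ i := by
  induction k with
  | zero => simp
  | succ k ih =>
    rw [← ((measurePreserving_piFinSuccAbove μ 0).symm).lintegral_comp (by fun_prop)]
    simp_rw [Fin.prod_univ_succ]
    simp only [MeasurableEquiv.piFinSuccAbove_symm_apply, Fin.insertNthEquiv, Equiv.coe_fn_mk,
      Fin.zero_succAbove, Fin.insertNth_zero, Fin.cons_zero, Fin.cons_succ]
    have hm : Measurable fun x : Fin k → α => ∏ i, f i.succ (x i) :=
      Finset.measurable_prod _ fun i _ => (hf _).comp (measurable_pi_apply i)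
    have h2 : Measurable fun a : α × (Fin k → α) => f 0 a.1 * ∏ i, f i.succ (a.2 i) :=
      ((hf 0).comp measurable_fst).mul (hm.comp measurable_snd)
    refine (lintegral_prod _ h2.aemeasurable).trans ?_
    rw [← ih (fun i => μ i.succ) (fun i => f i.succ) (fun i => hf _),
      ← lintegral_mul_const'' _ (hf 0).aemeasurable]
    exact lintegral_congr fun a =>
      lintegral_const_mul (μ := Measure.pi fun j => μ j.succ) (f 0 a) hm

lemma lintegral_withDensity_eq {α : Type*} [MeasurableSpace α] (μ : Measure α)
    {f g : α → ℝ≥0∞} (hf : Measurable f) (hg : Measurable g) :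
    ∫⁻ a, g a ∂μ.withDensity f = ∫⁻ a, f a * g a ∂μ :=
  lintegral_withDensity_eq_lintegral_mul _ hf hg

lemma pi_withDensity {α : Type*} [MeasurableSpace α] (k : ℕ) (μ : Measure α)
    [SigmaFinite μ] (f : α → ℝ≥0∞) (hf : Measurable f) (hf' : ∀ x, f x ≠ ∞) :
    Measure.pi (fun _ : Fin k => μ.withDensity f) =
      (Measure.pi fun _ : Fin k => μ).withDensity (fun x => ∏ i, f (x i)) := by
  have : SigmaFinite (μ.withDensity f) :=
    SigmaFinite.withDensity_of_ne_top (Eventually.of_forall hf')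
  refine Measure.pi_eq fun s hs => ?_
  rw [withDensity_apply _ (MeasurableSet.univ_pi hs), Measure.restrict_pi_pi,
    lintegral_pi_prod _ _ _ fun _ => hf]
  exact Finset.prod_congr rfl fun i _ => (withDensity_apply _ (hs i)).symm

/-! ### Polar coordinates and the uniform measure as a limit of densities on the ball -/

/-- The total surface area of `S^d`. -/
def area (d : ℕ) : ℝ≥0∞ := (volume : Measure (Space d)).toSphere Set.univ

lemma area_ne_zero (d : ℕ) : area d ≠ 0 := by
  simp [area]
  exact (Metric.measure_ball_pos _ _ one_pos).ne'

lemma area_ne_top (d : ℕ) : area d ≠ ∞ := measure_ne_top _ _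

instance isProbabilityMeasure_sigma (d : ℕ) : IsProbabilityMeasure (sigma d) where
  measure_univ := by
    rw [sigma, Measure.smul_apply, smul_eq_mul]
    exact ENNReal.inv_mul_cancel (area_ne_zero d) (area_ne_top d)

lemma toSphere_eq_smul_sigma (d : ℕ) :
    (volume : Measure (Space d)).toSphere = area d • sigma d := by
  rw [sigma, smul_smul]
  change _ = (area d * (area d)⁻¹) • _
  rw [ENNReal.mul_inv_cancel (area_ne_zero d) (area_ne_top d), one_smul]

/-- The origin is a null set, and the punctured space is the product of the sphere and the half-line
with weight `r ^ d`. -/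
lemma lintegral_polar {d : ℕ} (f : Space d → ℝ≥0∞) (hf : Measurable f) :
    ∫⁻ x, f x = area d * ∫⁻ θ, (∫⁻ r in Set.Ioi (0 : ℝ),
      ENNReal.ofReal (r ^ d) * f (r • (θ : Space d))) ∂sigma d := by
  have h1 : ∫⁻ x, f x = ∫⁻ x : ({0}ᶜ : Set (Space d)), f x ∂(volume.comap Subtype.val) := by
    rw [lintegral_subtype_comap (measurableSet_singleton _).compl, restrict_compl_singleton]
  have mp := (volume : Measure (Space d)).measurePreserving_homeomorphUnitSphereProd
  have hg : Measurable fun p : Sph d × Set.Ioi (0 : ℝ) => f (p.2.1 • (p.1 : Space d)) := by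
    fun_prop
  have h2 := mp.lintegral_comp hg
  rw [h1]
  have h3 : ∀ x : ({0}ᶜ : Set (Space d)),
      f (((homeomorphUnitSphereProd (Space d)) x).2.1 •
        (((homeomorphUnitSphereProd (Space d)) x).1 : Space d)) = f x := by
    intro x
    congr 1
    have := (homeomorphUnitSphereProd (Space d)).symm_apply_apply x
    conv_rhs => rw [← this]
    rfl
  simp_rw [h3] at h2
  rw [h2, lintegral_prod _ hg.aemeasurable, toSphere_eq_smul_sigma, lintegral_smul_measure,
    smul_eq_mul]
  congr 1
  refine lintegral_congr fun θ => ?_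
  rw [Measure.volumeIoiPow, lintegral_withDensity_eq_lintegral_mul _ (by fun_prop) (by fun_prop)]
  simp only [Pi.mul_apply, finrank_euclideanSpace, Fintype.card_fin, Nat.add_sub_cancel]
  rw [lintegral_subtype_comap measurableSet_Ioi
    (fun r : ℝ => ENNReal.ofReal (r ^ d) * f (r • (θ : Space d)))]

/-- The density `ε (1 - ‖x‖²)^(ε - 1)` on the unit ball. -/
def ballDens {E : Type*} [NormedAddCommGroup E] (ε : ℝ) (x : E) : ℝ≥0∞ :=
  ENNReal.ofReal (if ‖x‖ < 1 then ε * (1 - ‖x‖ ^ 2) ^ (ε - 1) else 0)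

lemma measurable_ballDens {E : Type*} [NormedAddCommGroup E] [MeasurableSpace E] [BorelSpace E]
    (ε : ℝ) : Measurable (ballDens (E := E) ε) := by
  unfold ballDens
  refine ENNReal.measurable_ofReal.comp (Measurable.ite ?_ (by fun_prop) (by fun_prop))
  exact measurableSet_lt measurable_norm measurable_const

/-- The radius with `(1 - r²)^ε = U`. -/
def radialQuantile (ε U : ℝ) : ℝ := √(1 - U ^ ε⁻¹)

lemma measurable_radialQuantile (ε : ℝ) : Measurable (radialQuantile ε) := by
  unfold radialQuantile; fun_prop

lemma radialQuantile_le_one {ε U : ℝ} (hU : 0 < U) : radialQuantile ε U ≤ 1 := by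
  unfold radialQuantile
  rw [Real.sqrt_le_one]
  have := Real.rpow_pos_of_pos hU ε⁻¹
  linarith

lemma tendsto_radialQuantile {U : ℝ} (hU : U ∈ Set.Ioo (0 : ℝ) 1) :
    Tendsto (fun ε => radialQuantile ε U) (𝓝[>] 0) (𝓝 1) := by
  have h := (tendsto_rpow_atTop_of_base_lt_one U (by linarith [hU.1]) hU.2).comp
    tendsto_inv_nhdsGT_zero
  have h2 := (tendsto_const_nhds (x := (1 : ℝ))).sub h
  simpa [radialQuantile, Function.comp_def] using h2.sqrt

/-- Substitution `U = (1 - r²)^ε`, which absorbs the whole singular density. For fixed `U` in `(0,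
1)` the radius tends to `1` as `ε → 0`; this is how the mass moves to the sphere. -/
lemma lintegral_radial {ε : ℝ} (hε : 0 < ε) (g : ℝ → ℝ≥0∞) :
    ∫⁻ r in Set.Ioo (0 : ℝ) 1, ENNReal.ofReal (2 * r * (ε * (1 - r ^ 2) ^ (ε - 1))) * g r =
      ∫⁻ U in Set.Ioo (0 : ℝ) 1, g (radialQuantile ε U) := by
  have him : (fun r : ℝ => (1 - r ^ 2) ^ ε) '' Set.Ioo 0 1 = Set.Ioo 0 1 := by
    ext U
    constructor
    · rintro ⟨r, ⟨h0, h1⟩, rfl⟩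
      have : 0 < 1 - r ^ 2 := by nlinarith
      exact ⟨Real.rpow_pos_of_pos this _, Real.rpow_lt_one this.le (by nlinarith) hε⟩
    · rintro ⟨h0, h1⟩
      have ha := Real.rpow_pos_of_pos h0 ε⁻¹
      have hb := Real.rpow_lt_one h0.le h1 (inv_pos.2 hε)
      refine ⟨√(1 - U ^ ε⁻¹), ⟨Real.sqrt_pos.2 (by linarith), ?_⟩, ?_⟩
      · rw [Real.sqrt_lt' one_pos]; linarith
      · simp only
        rw [Real.sq_sqrt (by linarith), sub_sub_cancel, ← Real.rpow_mul h0.le,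
          inv_mul_cancel₀ hε.ne', Real.rpow_one]
  have hinv : ∀ r ∈ Set.Ioo (0 : ℝ) 1, radialQuantile ε ((1 - r ^ 2) ^ ε) = r := by
    rintro r ⟨h0, h1⟩
    have : 0 < 1 - r ^ 2 := by nlinarith
    rw [radialQuantile, ← Real.rpow_mul this.le, mul_inv_cancel₀ hε.ne', Real.rpow_one,
      sub_sub_cancel, Real.sqrt_sq h0.le]
  conv_rhs => rw [← him]
  rw [lintegral_image_eq_lintegral_abs_deriv_mul measurableSet_Ioo
    (f' := fun r => -(2 * r) * ε * (1 - r ^ 2) ^ (ε - 1))]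
  · refine setLIntegral_congr_fun measurableSet_Ioo fun r hr => ?_
    have : 0 < 1 - r ^ 2 := by nlinarith [hr.1, hr.2]
    simp only [hinv r hr]
    congr 2
    rw [abs_of_nonpos]
    · ring
    · have := Real.rpow_pos_of_pos this (ε - 1)
      have h3 := mul_pos (mul_pos hr.1 hε) this
      nlinarith
  · rintro r ⟨h0, h1⟩
    have : 0 < 1 - r ^ 2 := by nlinarith
    refine HasDerivAt.hasDerivWithinAt ?_
    have := ((hasDerivAt_pow 2 r).const_sub 1).rpow_const (p := ε) (Or.inl this.ne')
    convert! this using 1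
    simp
  · intro r hr s hs h
    rw [← hinv r hr, ← hinv s hs]
    exact congrArg _ h

/-- The density on the ball is the image of a product measure under polar coordinates. -/
lemma withDensity_ballDens {d : ℕ} (hd : 1 ≤ d) {ε : ℝ} (hε : 0 < ε) :
    (volume : Measure (Space d)).withDensity (ballDens ε) =
      (((sigma d).prod (volume.restrict (Set.Ioo (0 : ℝ) 1))).withDensity
        (fun p => area d * ENNReal.ofReal (radialQuantile ε p.2 ^ (d - 1) / 2))).map
        (fun p => radialQuantile ε p.2 • (p.1 : Space d)) := by
  have hT : Measurable fun p : Sph d × ℝ => radialQuantile ε p.2 • (p.1 : Space d) :=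
    ((measurable_radialQuantile ε).comp measurable_snd).smul
      (measurable_subtype_coe.comp measurable_fst)
  have hq := measurable_radialQuantile ε
  refine Measure.ext_of_lintegral _ fun f hf => ?_
  rw [lintegral_map hf hT, lintegral_withDensity_eq _ (measurable_ballDens ε) hf,
    lintegral_polar (fun x => ballDens ε x * f x) ((measurable_ballDens ε).mul hf),
    lintegral_withDensity_eq (g := fun p : Sph d × ℝ => f (radialQuantile ε p.2 • (p.1 : Space d)))
      _ (by fun_prop) (hf.comp hT),
    lintegral_prod _ (by have := hf.comp hT; fun_prop)]
  rw [← lintegral_const_mul' _ _ (area_ne_top d)]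
  refine lintegral_congr fun θ => ?_
  simp only [mul_assoc]
  rw [lintegral_const_mul' _ _ (area_ne_top d),
    ← lintegral_radial hε (fun r => ENNReal.ofReal (r ^ (d - 1) / 2) * f (r • (θ : Space d)))]
  congr 1
  rw [← lintegral_indicator measurableSet_Ioi, ← lintegral_indicator measurableSet_Ioo]
  refine lintegral_congr fun r => ?_
  by_cases h0 : 0 < r
  · have hn : ‖r • (θ : Space d)‖ = r := by
      rw [norm_smul, Real.norm_of_nonneg h0.le, norm_eq_of_mem_sphere, mul_one]
    by_cases h1 : r < 1
    · rw [Set.indicator_of_mem (show r ∈ Set.Ioi 0 from h0), Set.indicator_of_mem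
        (show r ∈ Set.Ioo 0 1 from ⟨h0, h1⟩), ballDens, hn, if_pos h1, ← mul_assoc, ← mul_assoc,
        ← ENNReal.ofReal_mul (by positivity)]
      have h2 : 0 < 1 - r ^ 2 := by nlinarith
      rw [← ENNReal.ofReal_mul (by positivity)]
      congr 2
      -- Splitting `r ^ d` as `(r ^ (d - 1) / 2) * (2 * r)` needs `1 ≤ d`, since the subtraction is
      -- truncated.
      obtain ⟨e, rfl⟩ := Nat.exists_eq_add_of_le' hd
      simp only [Nat.add_sub_cancel]
      ring
    · rw [Set.indicator_of_mem (show r ∈ Set.Ioi 0 from h0), Set.indicator_of_notMem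
        (fun h => h1 h.2), ballDens, hn, if_neg h1]
      simp
  · rw [Set.indicator_of_notMem (s := Set.Ioi 0) (fun h => h0 h),
      Set.indicator_of_notMem (s := Set.Ioo 0 1) (fun h => h0 h.1)]

/-- The uniform distribution on the sphere is the limit of the distributions on the ball with
densities proportional to `(1 - ‖x‖²)^(ε - 1)`, as `ε → 0`. -/
theorem tendsto_lintegral_ballDens {d k : ℕ} (hd : 1 ≤ d) (φ : (Fin k → Space d) → ℝ≥0∞)
    (hφ : Measurable φ) (B : ℝ≥0) (hB : ∀ x, φ x ≤ B)
    (hc : ∀ᵐ θ ∂(Measure.pi fun _ : Fin k => sigma d),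
      ContinuousAt φ (fun i => (θ i : Space d))) :
    Tendsto (fun ε : ℝ => ∫⁻ x, (∏ i, ballDens ε (x i)) * φ x) (𝓝[>] 0)
      (𝓝 ((area d / 2) ^ k *
        ∫⁻ θ, φ (fun i => (θ i : Space d)) ∂(Measure.pi fun _ : Fin k => sigma d))) := by
  set ν := (sigma d).prod ((volume : Measure ℝ).restrict (Set.Ioo (0 : ℝ) 1)) with hν
  have hνp : IsProbabilityMeasure ((volume : Measure ℝ).restrict (Set.Ioo (0 : ℝ) 1)) := ⟨by simp⟩
  have hT : ∀ ε, Measurable fun p : Sph d × ℝ => radialQuantile ε p.2 • (p.1 : Space d) :=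
    fun ε => ((measurable_radialQuantile ε).comp measurable_snd).smul
      (measurable_subtype_coe.comp measurable_fst)
  have hq := measurable_radialQuantile
  have key : ∀ ε : ℝ, 0 < ε → ∫⁻ x, (∏ i, ballDens ε (x i)) * φ x =
      ∫⁻ p, (∏ i, area d * ENNReal.ofReal (radialQuantile ε (p i).2 ^ (d - 1) / 2)) *
        φ (fun i => radialQuantile ε (p i).2 • ((p i).1 : Space d))
          ∂Measure.pi fun _ : Fin k => ν := by
    intro ε hε
    have hb := measurable_ballDens (E := Space d) ε
    rw [← lintegral_withDensity_eq _ (by fun_prop) hφ, volume_pi,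
      ← pi_withDensity _ _ _ hb (fun _ => ENNReal.ofReal_ne_top), withDensity_ballDens hd hε]
    have hsf : SigmaFinite (ν.withDensity
        (fun p => area d * ENNReal.ofReal (radialQuantile ε p.2 ^ (d - 1) / 2))) :=
      SigmaFinite.withDensity_of_ne_top (Eventually.of_forall fun p =>
        ENNReal.mul_ne_top (area_ne_top d) ENNReal.ofReal_ne_top)
    have hsf2 : SigmaFinite ((ν.withDensity
        (fun p => area d * ENNReal.ofReal (radialQuantile ε p.2 ^ (d - 1) / 2))).map
        (fun p => radialQuantile ε p.2 • (p.1 : Space d))) := by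
      rw [hν, ← withDensity_ballDens hd hε]
      exact SigmaFinite.withDensity_of_ne_top (Eventually.of_forall fun p => ENNReal.ofReal_ne_top)
    rw [← Measure.pi_map_pi (fun _ => (hT ε).aemeasurable), lintegral_map hφ (by fun_prop),
      pi_withDensity _ _ _ (by fun_prop) (fun p =>
        ENNReal.mul_ne_top (area_ne_top d) ENNReal.ofReal_ne_top),
      lintegral_withDensity_eq _ (by fun_prop) (by fun_prop)]
  have hU : ∀ᵐ p ∂(Measure.pi fun _ : Fin k => ν), ∀ i, (p i).2 ∈ Set.Ioo (0 : ℝ) 1 := by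
    rw [ae_all_iff]
    intro i
    have h1 : ∀ᵐ q ∂ν, q.2 ∈ Set.Ioo (0 : ℝ) 1 :=
      Measure.quasiMeasurePreserving_snd.ae (ae_restrict_mem measurableSet_Ioo)
    exact (Measure.quasiMeasurePreserving_eval (fun _ : Fin k => ν) i).ae h1
  have hfst : MeasurePreserving (fun (p : Fin k → Sph d × ℝ) i => (p i).1)
      (Measure.pi fun _ => ν) (Measure.pi fun _ => sigma d) :=
    measurePreserving_pi _ _ fun _ => measurePreserving_fst
  have lim : Tendsto (fun ε : ℝ =>
      ∫⁻ p, (∏ i, area d * ENNReal.ofReal (radialQuantile ε (p i).2 ^ (d - 1) / 2)) *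
        φ (fun i => radialQuantile ε (p i).2 • ((p i).1 : Space d))
          ∂Measure.pi fun _ : Fin k => ν) (𝓝[>] 0)
      (𝓝 (∫⁻ p, (∏ _i : Fin k, area d * ENNReal.ofReal (1 / 2)) *
        φ (fun i => ((p i).1 : Space d)) ∂Measure.pi fun _ : Fin k => ν)) := by
    -- The radii are at most `1`, so each weight is at most `area d / 2` and `φ` is at most `B`; the
    -- measure is finite, so this constant dominates.
    refine tendsto_lintegral_filter_of_dominated_convergence
      (fun _ => (∏ _i : Fin k, area d * ENNReal.ofReal (1 / 2)) * B) ?_ ?_ ?_ ?_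
    · refine Eventually.of_forall fun ε => ?_
      have := hT ε
      refine Measurable.mul (by fun_prop) (hφ.comp ?_)
      exact measurable_pi_lambda _ fun i => (hT ε).comp (measurable_pi_apply i)
    · refine Eventually.of_forall fun ε => ?_
      filter_upwards [hU] with p hp
      gcongr with i
      · exact pow_le_one₀ (Real.sqrt_nonneg _) (radialQuantile_le_one (hp i).1)
      · exact hB _
    · rw [lintegral_const, measure_univ, mul_one]
      refine ENNReal.mul_ne_top (ENNReal.prod_ne_top fun i _ => ?_) ENNReal.coe_ne_top
      exact ENNReal.mul_ne_top (area_ne_top d) ENNReal.ofReal_ne_top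
    · filter_upwards [hU, hfst.quasiMeasurePreserving.ae hc] with p hp hcp
      have hr : ∀ i, Tendsto (fun ε => radialQuantile ε (p i).2) (𝓝[>] 0) (𝓝 1) :=
        fun i => tendsto_radialQuantile (hp i)
      refine ENNReal.Tendsto.mul ?_ ?_ ?_ ?_
      · refine ENNReal.tendsto_finsetProd_of_ne_top _ (fun i _ => ?_) (fun i _ => ?_)
        · refine ENNReal.Tendsto.const_mul ?_ (Or.inr (area_ne_top d))
          refine ENNReal.tendsto_ofReal ?_
          simpa using ((hr i).pow (d - 1)).div_const 2
        · exact ENNReal.mul_ne_top (area_ne_top d) ENNReal.ofReal_ne_top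
      · left
        refine Finset.prod_ne_zero_iff.2 fun i _ => mul_ne_zero (area_ne_zero d) ?_
        simp
      · refine hcp.tendsto.comp (tendsto_pi_nhds.2 fun i => ?_)
        simpa using (hr i).smul_const ((p i).1 : Space d)
      · right
        exact ENNReal.prod_ne_top fun i _ =>
          ENNReal.mul_ne_top (area_ne_top d) ENNReal.ofReal_ne_top
  have hlim : ∫⁻ p, (∏ _i : Fin k, area d * ENNReal.ofReal (1 / 2)) *
        φ (fun i => ((p i).1 : Space d)) ∂(Measure.pi fun _ : Fin k => ν) = (area d / 2) ^ k *
        ∫⁻ θ, φ (fun i => (θ i : Space d)) ∂(Measure.pi fun _ : Fin k => sigma d) := by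
    rw [lintegral_const_mul', ← hfst.lintegral_comp (f := fun θ => φ fun i => (θ i : Space d))]
    · simp [div_eq_mul_inv, ENNReal.ofReal_inv_of_pos]
    · exact hφ.comp (by fun_prop)
    · exact ENNReal.prod_ne_top fun i _ =>
          ENNReal.mul_ne_top (area_ne_top d) ENNReal.ofReal_ne_top
  rw [← hlim]
  refine lim.congr' ?_
  filter_upwards [self_mem_nhdsWithin] with ε hε using (key ε hε).symm

/-! ### The densities `(1 - s²)^q` on the interval `(-1, 1)` -/

/-- The measure with density `(1 - s²)^q` on `(-1, 1)`. -/
def sqMeas (q : ℝ) : Measure ℝ :=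
  (volume.restrict (Set.Ioo (-1 : ℝ) 1)).withDensity fun s => ENNReal.ofReal ((1 - s ^ 2) ^ q)

/-- The total mass of `sqMeas q`. -/
def sqMass (q : ℝ) : ℝ := 2 * (4 ^ q * beta (q + 1) (q + 1))

/-- The probability measure with density proportional to `(1 - s²)^q` on `(-1, 1)`. -/
def sqLaw (q : ℝ) : Measure ℝ := (ENNReal.ofReal (sqMass q))⁻¹ • sqMeas q

lemma lintegral_sqMeas (q : ℝ) (h : ℝ → ℝ≥0∞) (hh : Measurable h) :
    ∫⁻ s, h s ∂sqMeas q =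
      ∫⁻ s in Set.Ioo (-1 : ℝ) 1, ENNReal.ofReal ((1 - s ^ 2) ^ q) * h s :=
  lintegral_withDensity_eq _ (by fun_prop) hh

lemma sqMass_pos {q : ℝ} (hq : -1 < q) : 0 < sqMass q := by
  have := beta_pos (α := q + 1) (β := q + 1) (by linarith) (by linarith)
  unfold sqMass; positivity

/-- With `s = 2x - 1` one has `1 - s² = 4x(1 - x)`, which leaves a Beta integral and the factors `2`
and `4 ^ q`. -/
lemma sqMeas_univ {q : ℝ} (hq : -1 < q) : sqMeas q Set.univ = ENNReal.ofReal (sqMass q) := by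
  have hb := beta_pos (α := q + 1) (β := q + 1) (by linarith) (by linarith)
  have him : (fun x : ℝ => 2 * x - 1) '' Set.Ioo 0 1 = Set.Ioo (-1) 1 := by
    ext y
    constructor
    · rintro ⟨x, ⟨h0, h1⟩, rfl⟩
      constructor <;> simp only <;> linarith
    · rintro ⟨h0, h1⟩
      exact ⟨(y + 1) / 2, ⟨by linarith, by linarith⟩, by ring⟩
  rw [sqMeas, withDensity_apply _ MeasurableSet.univ, Measure.restrict_univ, ← him,
    lintegral_image_eq_lintegral_abs_deriv_mul measurableSet_Ioo (f' := fun _ => 2)]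
  · have h1 := lintegral_betaPDF_eq_one (α := q + 1) (β := q + 1) (by linarith) (by linarith)
    rw [lintegral_betaPDF] at h1
    calc _ = ∫⁻ x in Set.Ioo (0 : ℝ) 1, ENNReal.ofReal (sqMass q) * ENNReal.ofReal
          (1 / beta (q + 1) (q + 1) * x ^ (q + 1 - 1) * (1 - x) ^ (q + 1 - 1)) := by
          refine setLIntegral_congr_fun measurableSet_Ioo fun x hx => ?_
          rw [← ENNReal.ofReal_mul (abs_nonneg _), ← ENNReal.ofReal_mul (sqMass_pos hq).le]
          congr 1
          have h4 : 1 - (2 * x - 1) ^ 2 = 4 * (x * (1 - x)) := by ring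
          have hx1 : 0 < 1 - x := by linarith [hx.2]
          rw [h4, Real.mul_rpow (by norm_num) (mul_nonneg hx.1.le hx1.le),
            Real.mul_rpow hx.1.le hx1.le, sqMass]
          simp only [add_sub_cancel_right, abs_two]
          field_simp
      _ = _ := by rw [lintegral_const_mul' _ _ ENNReal.ofReal_ne_top, h1, mul_one]
  · intro x _
    refine HasDerivAt.hasDerivWithinAt ?_
    simpa using ((hasDerivAt_id x).const_mul 2).sub_const 1
  · intro x _ y _ h
    simp only at h
    linarith

lemma isProbabilityMeasure_sqLaw {q : ℝ} (hq : -1 < q) : IsProbabilityMeasure (sqLaw q) where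
  measure_univ := by
    rw [sqLaw, Measure.smul_apply, smul_eq_mul, sqMeas_univ hq]
    exact ENNReal.inv_mul_cancel (by simpa using sqMass_pos hq) ENNReal.ofReal_ne_top

/-- Since `1 - s² ≤ 1`, the weight with the limiting exponent dominates those with larger exponents,
and it is integrable because `-1 < q`. -/
lemma tendsto_lintegral_sqMeas {q c : ℝ} (hq : -1 < q) (hc : 0 ≤ c) (h : ℝ → ℝ≥0∞)
    (hh : Measurable h) (B : ℝ≥0) (hB : ∀ x, h x ≤ B) :
    Tendsto (fun ε : ℝ => ∫⁻ s, h s ∂sqMeas (q + c * ε)) (𝓝[>] 0)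
      (𝓝 (∫⁻ s, h s ∂sqMeas q)) := by
  simp_rw [fun q => lintegral_sqMeas q h hh]
  refine tendsto_lintegral_filter_of_dominated_convergence
    (fun s => ENNReal.ofReal ((1 - s ^ 2) ^ q) * B) ?_ ?_ ?_ ?_
  · exact Eventually.of_forall fun ε => by fun_prop
  · filter_upwards [self_mem_nhdsWithin] with ε hε
    filter_upwards [ae_restrict_mem measurableSet_Ioo] with s hs
    have h1 : 0 < 1 - s ^ 2 := by nlinarith [hs.1, hs.2]
    gcongr ?_ * ?_
    · refine ENNReal.ofReal_le_ofReal (Real.rpow_le_rpow_of_exponent_ge h1 (by nlinarith) ?_)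
      have : 0 < ε := hε
      nlinarith
    · exact hB s
  · rw [lintegral_mul_const' _ _ ENNReal.coe_ne_top]
    refine ENNReal.mul_ne_top ?_ ENNReal.coe_ne_top
    have := sqMeas_univ hq
    rw [sqMeas, withDensity_apply _ MeasurableSet.univ, Measure.restrict_univ] at this
    rw [this]
    exact ENNReal.ofReal_ne_top
  · filter_upwards [ae_restrict_mem measurableSet_Ioo] with s hs
    have h1 : 0 < 1 - s ^ 2 := by nlinarith [hs.1, hs.2]
    refine ENNReal.Tendsto.mul_const (ENNReal.tendsto_ofReal ?_) (Or.inr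
      (ne_top_of_le_ne_top ENNReal.coe_ne_top (hB s)))
    have h2 : Tendsto (fun ε : ℝ => q + c * ε) (𝓝[>] 0) (𝓝 q) := by
      have : Continuous fun ε : ℝ => q + c * ε := by fun_prop
      simpa using (this.tendsto 0).mono_left nhdsWithin_le_nhds
    exact (Real.continuousAt_const_rpow h1.ne').tendsto.comp h2

/-- A statistic of uniform points has the law that is the limit, as `ε → 0`, of its laws for
points with density proportional to `(1 - ‖x‖²)^(ε - 1)` on the ball. -/
theorem map_pi_sigma_eq_map_sqLaw {d k : ℕ} (hd : 1 ≤ d) (T : (Fin k → Space d) → ℝ)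
    (hT : Measurable T)
    (hTc : ∀ᵐ θ ∂(Measure.pi fun _ : Fin k => sigma d),
      ContinuousAt T (fun i => (θ i : Space d)))
    {q c : ℝ} (hq : -1 < q) (hc : 0 ≤ c) (τ : ℝ → ℝ) (hτ : Measurable τ) (K : ℝ → ℝ≥0∞)
    (hK : ∀ ε : ℝ, 0 < ε → ∀ h : ℝ → ℝ≥0∞, Measurable h →
      ∫⁻ s, h (τ s) ∂sqMeas (q + c * ε) ≠ ∞ →
      ∫⁻ x, (∏ i, ballDens ε (x i)) * h (T x) = K ε * ∫⁻ s, h (τ s) ∂sqMeas (q + c * ε)) :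
    (Measure.pi fun _ : Fin k => sigma d).map (fun θ => T fun i => (θ i : Space d)) =
      (sqLaw q).map τ := by
  have hTm : Measurable fun θ : Fin k → Sph d => T fun i => (θ i : Space d) :=
    hT.comp (by fun_prop)
  have hA := area_ne_zero d
  have hA' := area_ne_top d
  have := isProbabilityMeasure_sqLaw hq
  have h1 : IsProbabilityMeasure ((sqLaw q).map τ) :=
    Measure.isProbabilityMeasure_map hτ.aemeasurable
  have h2 : IsProbabilityMeasure ((Measure.pi fun _ : Fin k => sigma d).map
      (fun θ => T fun i => (θ i : Space d))) :=
    Measure.isProbabilityMeasure_map hTm.aemeasurable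
  have main : ∀ (h : ℝ → ℝ≥0∞), Continuous h → ∀ B : ℝ≥0, (∀ x, h x ≤ B) →
      Tendsto (fun ε : ℝ => K ε * ∫⁻ s, h (τ s) ∂sqMeas (q + c * ε)) (𝓝[>] 0)
        (𝓝 ((area d / 2) ^ k * ∫⁻ θ, h (T fun i => (θ i : Space d))
          ∂(Measure.pi fun _ : Fin k => sigma d))) := by
    intro h hh B hB
    refine (tendsto_lintegral_ballDens hd (fun x => h (T x)) (hh.measurable.comp hT) B
      (fun x => hB _) ?_).congr' ?_
    · filter_upwards [hTc] with θ hθ using hh.continuousAt.comp hθ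
    · filter_upwards [self_mem_nhdsWithin] with ε hε
      refine hK ε hε h hh.measurable (ne_top_of_le_ne_top ?_ (lintegral_mono fun s => hB (τ s)))
      have hε' : 0 < ε := hε
      rw [lintegral_const, sqMeas_univ (by nlinarith)]
      exact ENNReal.mul_ne_top ENNReal.coe_ne_top ENNReal.ofReal_ne_top
  refine ext_of_forall_lintegral_eq_of_IsFiniteMeasure fun h => ?_
  rw [lintegral_map (by fun_prop) hTm, lintegral_map (by fun_prop) hτ]
  set g : ℝ → ℝ≥0∞ := fun s => h s with hg
  have hgc : Continuous g := by fun_prop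
  obtain ⟨B, hB⟩ : ∃ B : ℝ≥0, ∀ x, g x ≤ B :=
    ⟨nndist h 0, fun x => ENNReal.coe_le_coe.2 (BoundedContinuousFunction.NNReal.upper_bound h x)⟩
  have m1 := main g hgc B hB
  -- The behaviour of `K ε` is unknown. Multiplying the limit for `g` by the mass and the limit for
  -- `1` by the integral of `g` gives two limits of the same function of `ε`, so `K` drops out.
  have m2 := main (fun _ => 1) continuous_const 1 (fun _ => by simp)
  have n1 := tendsto_lintegral_sqMeas hq hc (fun s => g (τ s)) (hgc.measurable.comp hτ) B
    (fun x => hB _)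
  have n2 := tendsto_lintegral_sqMeas hq hc (fun s => 1) measurable_const 1 (fun _ => by simp)
  have hmass : ∫⁻ _, 1 ∂sqMeas q = ENNReal.ofReal (sqMass q) := by simp [sqMeas_univ hq]
  have hmass0 : ENNReal.ofReal (sqMass q) ≠ 0 := by simpa using sqMass_pos hq
  have hc0 : (area d / 2) ^ k ≠ 0 := pow_ne_zero _ (ENNReal.div_ne_zero.2 ⟨hA, by simp⟩)
  have hcT : (area d / 2) ^ k ≠ ∞ := ENNReal.pow_ne_top (ENNReal.div_ne_top hA' (by simp))
  have bdd : ∀ (ν : Measure ℝ), ν Set.univ ≠ ∞ → ∫⁻ s, g (τ s) ∂ν ≠ ∞ := by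
    intro ν hν
    refine ne_top_of_le_ne_top ?_ (lintegral_mono fun s => hB (τ s))
    rw [lintegral_const]
    exact ENNReal.mul_ne_top ENNReal.coe_ne_top hν
  have bdd2 : ∫⁻ θ, g (T fun i => (θ i : Space d)) ∂(Measure.pi fun _ : Fin k => sigma d) ≠ ∞ := by
    refine ne_top_of_le_ne_top ?_ (lintegral_mono fun s => hB _)
    simp
  rw [hmass] at n2
  simp only [lintegral_const, one_mul, measure_univ, mul_one] at m2
  have e1 := ENNReal.Tendsto.mul m1 (Or.inr ENNReal.ofReal_ne_top) n2
    (Or.inr (ENNReal.mul_ne_top hcT bdd2))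
  have e2 := ENNReal.Tendsto.mul m2 (Or.inr (bdd (sqMeas q) (by
    rw [sqMeas_univ hq]; exact ENNReal.ofReal_ne_top))) n1 (Or.inr hcT)
  have e3 := tendsto_nhds_unique e1
    (e2.congr fun ε => by simp only [lintegral_const, one_mul]; ring)
  rw [mul_assoc, ENNReal.mul_right_inj hc0 hcT] at e3
  rw [sqLaw, lintegral_smul_measure, smul_eq_mul, ← e3, mul_comm, mul_assoc,
    ENNReal.mul_inv_cancel hmass0 ENNReal.ofReal_ne_top, mul_one]

/-! ### The law of a coordinate of a uniform point on the sphere -/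

/-- The density `ε (1 - r)^(ε - 1)` on `r < 1`, for `r` a squared norm. -/
def sqNormDens (ε r : ℝ) : ℝ≥0∞ :=
  ENNReal.ofReal (if r < 1 then ε * (1 - r) ^ (ε - 1) else 0)

lemma measurable_sqNormDens (ε : ℝ) : Measurable (sqNormDens ε) := by
  unfold sqNormDens
  exact ENNReal.measurable_ofReal.comp
    (Measurable.ite (measurableSet_lt measurable_id measurable_const) (by fun_prop) (by fun_prop))

lemma ballDens_eq {E : Type*} [NormedAddCommGroup E] (ε : ℝ) (x : E) :
    ballDens ε x = sqNormDens ε (‖x‖ ^ 2) := by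
  simp only [ballDens, sqNormDens, sq_lt_one_iff₀ (norm_nonneg x)]

lemma sqNormDens_of_one_le {ε r : ℝ} (hr : 1 ≤ r) : sqNormDens ε r = 0 := by
  simp [sqNormDens, not_lt.2 hr]

/-- The density on a slice of the ball is, up to scaling, the density on a smaller ball. -/
lemma sqNormDens_slice {ε s r : ℝ} (hs : s ^ 2 < 1) :
    sqNormDens ε (s ^ 2 + (1 - s ^ 2) * r) =
      ENNReal.ofReal ((1 - s ^ 2) ^ (ε - 1)) * sqNormDens ε r := by
  have h1 : 0 < 1 - s ^ 2 := by linarith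
  have h2 : s ^ 2 + (1 - s ^ 2) * r < 1 ↔ r < 1 := by
    constructor <;> intro h <;> nlinarith
  unfold sqNormDens
  rw [← ENNReal.ofReal_mul (by positivity)]
  by_cases hr : r < 1
  · have h3 : 1 - (s ^ 2 + (1 - s ^ 2) * r) = (1 - s ^ 2) * (1 - r) := by ring
    rw [if_pos (h2.2 hr), if_pos hr, h3, Real.mul_rpow h1.le (by linarith)]
    ring_nf
  · rw [if_neg (h2.not.2 hr), if_neg hr, mul_zero]

lemma lintegral_eq_lintegral_smul {E : Type*} [NormedAddCommGroup E] [NormedSpace ℝ E]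
    [MeasurableSpace E] [BorelSpace E] [FiniteDimensional ℝ E] (μ : Measure E)
    [μ.IsAddHaarMeasure] {c : ℝ} (hc : 0 < c) (F : E → ℝ≥0∞) (hF : Measurable F) :
    ∫⁻ y, F y ∂μ = ENNReal.ofReal (c ^ Module.finrank ℝ E) * ∫⁻ z, F (c • z) ∂μ := by
  have hp : 0 < c ^ Module.finrank ℝ E := by positivity
  rw [← lintegral_map hF (measurable_const_smul c), Measure.map_addHaar_smul μ hc.ne',
    lintegral_smul_measure, smul_eq_mul, ← mul_assoc, ← ENNReal.ofReal_mul hp.le,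
    abs_of_pos (inv_pos.2 hp), mul_inv_cancel₀ hp.ne', ENNReal.ofReal_one, one_mul]

/-- Cartesian coordinates, with the first coordinate separated from the others. -/
lemma lintegral_space {d : ℕ} (F : Space d → ℝ≥0∞) (hF : Measurable F) :
    ∫⁻ x, F x = ∫⁻ s : ℝ, ∫⁻ y : Fin d → ℝ, F (WithLp.toLp 2 (Fin.cons s y)) := by
  rw [← (PiLp.volume_preserving_toLp (Fin (d + 1))).lintegral_comp hF,
    ← ((volume_preserving_piFinSuccAbove (fun _ : Fin (d + 1) => ℝ) 0).symm).lintegral_comp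
      (by fun_prop)]
  have h : ∀ p : ℝ × (Fin d → ℝ),
      (MeasurableEquiv.piFinSuccAbove (fun _ : Fin (d + 1) => ℝ) 0).symm p =
        Fin.cons p.1 p.2 := by
    intro p
    simp [MeasurableEquiv.piFinSuccAbove_symm_apply, Fin.insertNthEquiv]
  have hm : Measurable fun p : ℝ × (Fin d → ℝ) => F (WithLp.toLp 2
      ((MeasurableEquiv.piFinSuccAbove (fun _ : Fin (d + 1) => ℝ) 0).symm p)) := by
    fun_prop
  refine (lintegral_prod _ hm.aemeasurable).trans ?_
  simp_rw [h]

lemma norm_sq_toLp_cons {d : ℕ} (s : ℝ) (y : Fin d → ℝ) :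
    ‖(WithLp.toLp 2 (Fin.cons s y) : Space d)‖ ^ 2 = s ^ 2 + ∑ i, y i ^ 2 := by
  rw [EuclideanSpace.norm_sq_eq, Fin.sum_univ_succ]
  simp

/-- In an orthonormal basis starting with `u`, the slice at height `s` is a `d`-dimensional ball of
radius `√(1 - s²)`. Scaling it to the unit ball gives `(1 - s²)^(d/2)` from the volume and `(1 -
s²)^(ε - 1)` from the density. -/
lemma lintegral_ballDens_inner {d : ℕ} (ε : ℝ) (h : ℝ → ℝ≥0∞) (hh : Measurable h)
    (u : Space d) (hu : ‖u‖ = 1) :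
    ∫⁻ x : Space d, ballDens ε x * h (inner ℝ u x) =
      (∫⁻ z : Fin d → ℝ, sqNormDens ε (∑ i, z i ^ 2)) *
        ∫⁻ s, h s ∂sqMeas ((d : ℝ) / 2 - 1 + 1 * ε) := by
  obtain ⟨b, hb⟩ := Orthonormal.exists_orthonormalBasis_extension_of_card_eq (𝕜 := ℝ)
    (E := Space d) (ι := Fin (d + 1)) (by simp) (v := fun _ => u) (s := {0})
    ⟨fun i => hu, fun i j hij => (hij (Subsingleton.elim _ _)).elim⟩
  have hb0 : b 0 = u := hb 0 rfl
  have hsn := measurable_sqNormDens ε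
  have e1 : ∀ x : Space d, ballDens ε x * h (inner ℝ u x) =
      (fun y : Space d => sqNormDens ε (‖y‖ ^ 2) * h (y 0)) (b.repr x) := by
    intro x
    simp only [ballDens_eq, LinearIsometryEquiv.norm_map, b.repr_apply_apply, hb0]
  have e2 : Measurable fun y : Space d => sqNormDens ε (‖y‖ ^ 2) * h (y 0) := by fun_prop
  simp_rw [e1]
  rw [b.measurePreserving_repr.lintegral_comp e2, lintegral_space _ e2,
    lintegral_sqMeas _ _ hh, ← lintegral_const_mul _ (by fun_prop),
    ← lintegral_indicator measurableSet_Ioo]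
  refine lintegral_congr fun s => ?_
  simp only [norm_sq_toLp_cons, Fin.cons_zero]
  by_cases hs : s ∈ Set.Ioo (-1 : ℝ) 1
  · have h1 : s ^ 2 < 1 := by nlinarith [hs.1, hs.2]
    have h2 : 0 < 1 - s ^ 2 := by linarith
    rw [Set.indicator_of_mem hs, lintegral_mul_const _ (by fun_prop),
      lintegral_eq_lintegral_smul volume (Real.sqrt_pos.2 h2) _ (by fun_prop)]
    simp only [Pi.smul_apply, smul_eq_mul, mul_pow, ← Finset.mul_sum, Real.sq_sqrt h2.le,
      sqNormDens_slice h1, Module.finrank_fin_fun]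
    rw [lintegral_const_mul _ (by fun_prop), ← mul_assoc (ENNReal.ofReal _),
      ← ENNReal.ofReal_mul (by positivity)]
    have h3 : √(1 - s ^ 2) ^ d * (1 - s ^ 2) ^ (ε - 1) =
        (1 - s ^ 2) ^ ((d : ℝ) / 2 - 1 + 1 * ε) := by
      rw [Real.sqrt_eq_rpow, ← Real.rpow_natCast, ← Real.rpow_mul h2.le, ← Real.rpow_add h2]
      ring_nf
    rw [h3]
    ring
  · rw [Set.indicator_of_notMem hs]
    have h1 : 1 ≤ s ^ 2 := by
      by_contra hlt
      exact hs (abs_lt.1 (by rw [← sq_lt_one_iff_abs_lt_one]; linarith))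
    have h2 : ∀ y : Fin d → ℝ, sqNormDens ε (s ^ 2 + ∑ i, y i ^ 2) = 0 := fun y =>
      sqNormDens_of_one_le (by
        have := Finset.sum_nonneg fun (i : Fin d) (_ : i ∈ Finset.univ) => sq_nonneg (y i)
        linarith)
    simp [h2]

/-- The law of the height of a uniform point on `S^d` in a fixed direction. -/
theorem map_inner_sigma {d : ℕ} (hd : 1 ≤ d) (u : Space d) (hu : ‖u‖ = 1) :
    (sigma d).map (fun θ : Sph d => inner ℝ u (θ : Space d)) = sqLaw ((d : ℝ) / 2 - 1) := by
  have hd' : (1 : ℝ) ≤ d := by exact_mod_cast hd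
  have key := map_pi_sigma_eq_map_sqLaw hd (k := 1) (fun x => inner ℝ u (x 0)) (by fun_prop)
    (Eventually.of_forall fun θ =>
      (show Continuous fun x : Fin 1 → Space d => inner ℝ u (x 0) by fun_prop).continuousAt)
      (q := (d : ℝ) / 2 - 1) (c := 1) (by linarith)
    zero_le_one id measurable_id (fun ε => ∫⁻ z : Fin d → ℝ, sqNormDens ε (∑ i, z i ^ 2))
    (fun ε hε h hh _ => by
      simp only [id]
      rw [← lintegral_ballDens_inner ε h hh u hu]
      have hm : Measurable fun x : Space d => ballDens ε x * h (inner ℝ u x) :=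
        (measurable_ballDens ε).mul (hh.comp (by fun_prop))
      rw [← (volume_preserving_funUnique (Fin 1) (Space d)).lintegral_comp hm]
      simp
      rfl)
  rw [Measure.map_id] at key
  rw [← key]
  conv_lhs => rw [← (measurePreserving_funUnique (sigma d) (Fin 1)).map_eq]
  rw [Measure.map_map (by fun_prop) (by fun_prop)]
  rfl

/-! ### Linear independence of random vectors -/

/-- Induction on `k`: the earlier vectors are too few to span the space, so the next one almost
surely avoids their span. -/
lemma ae_linearIndependent {α E : Type*} [MeasurableSpace α] [NormedAddCommGroup E]
    [NormedSpace ℝ E] [FiniteDimensional ℝ E] [MeasurableSpace E] [BorelSpace E]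
    (μ : Measure α) [SigmaFinite μ] (f : α → E) (hf : Measurable f)
    (h : ∀ S : Submodule ℝ E, S ≠ ⊤ → μ (f ⁻¹' S) = 0) (k : ℕ) (hk : k ≤ Module.finrank ℝ E) :
    ∀ᵐ y ∂(Measure.pi fun _ : Fin k => μ), LinearIndependent ℝ fun i => f (y i) := by
  induction k with
  | zero => exact Eventually.of_forall fun y => linearIndependent_empty_type
  | succ k ih =>
    have mp := measurePreserving_piFinSuccAbove (fun _ : Fin (k + 1) => μ) (Fin.last k)
    have main : ∀ᵐ p ∂(μ.prod (Measure.pi fun _ : Fin k => μ)),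
        LinearIndependent ℝ (Fin.snoc (fun i => f (p.2 i)) (f p.1) : Fin (k + 1) → E) := by
      have hswap : ∀ᵐ p ∂((Measure.pi fun _ : Fin k => μ).prod μ),
          LinearIndependent ℝ (Fin.snoc (fun i => f (p.1 i)) (f p.2) : Fin (k + 1) → E) := by
        rw [Measure.ae_prod_iff_ae_ae]
        · filter_upwards [ih (by omega)] with y hy
          have hS : Submodule.span ℝ (Set.range fun i => f (y i)) ≠ ⊤ := by
            intro htop
            have := finrank_range_le_card (R := ℝ) (fun i => f (y i))
            rw [Set.finrank, htop, finrank_top, Fintype.card_fin] at this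
            omega
          have := h _ hS
          rw [← compl_compl (f ⁻¹' _), ← mem_ae_iff] at this
          filter_upwards [this] with a ha
          exact linearIndependent_finSnoc.2 ⟨hy, ha⟩
        · have hg : Measurable fun p : (Fin k → α) × α =>
              (Fin.snoc (fun i => f (p.1 i)) (f p.2) : Fin (k + 1) → E) := by
            refine measurable_pi_lambda _ fun i => ?_
            refine Fin.lastCases ?_ (fun j => ?_) i
            · simp only [Fin.snoc_last]; fun_prop
            · simp only [Fin.snoc_castSucc]; fun_prop
          exact hg (isOpen_setOfPred_linearIndependent).measurableSet
      exact Measure.measurePreserving_swap.quasiMeasurePreserving.ae hswap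
    filter_upwards [mp.quasiMeasurePreserving.ae main] with y hy
    convert! hy using 1
    funext i
    refine Fin.lastCases ?_ (fun j => ?_) i
    · simp [MeasurableEquiv.piFinSuccAbove, Fin.insertNthEquiv]
    · simp [MeasurableEquiv.piFinSuccAbove, Fin.insertNthEquiv, Fin.init]

lemma sqLaw_singleton (q s : ℝ) : sqLaw q {s} = 0 := by
  have : (volume.restrict (Set.Ioo (-1 : ℝ) 1)) {s} = 0 := by simp
  have h := withDensity_absolutelyContinuous (volume.restrict (Set.Ioo (-1 : ℝ) 1))
    (fun s => ENNReal.ofReal ((1 - s ^ 2) ^ q)) this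
  rw [sqLaw, Measure.smul_apply, sqMeas, h, smul_zero]

/-- Affine hyperplanes meet the sphere in null sets. -/
lemma sigma_inner_eq {d : ℕ} (hd : 1 ≤ d) {v : Space d} (hv : v ≠ 0) (c : ℝ) :
    sigma d {θ | inner ℝ v (θ : Space d) = c} = 0 := by
  have h := map_inner_sigma hd (‖v‖⁻¹ • v) (norm_smul_inv_norm hv)
  have h2 := sqLaw_singleton ((d : ℝ) / 2 - 1) (‖v‖⁻¹ * c)
  rw [← h, Measure.map_apply (by fun_prop) (measurableSet_singleton _)] at h2
  refine measure_mono_null (fun θ hθ => ?_) h2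
  simp only [Set.mem_preimage, Set.mem_singleton_iff, inner_smul_left]
  rw [show inner ℝ v (θ : Space d) = c from hθ]
  simp

lemma ae_linearIndependent_sigma {d : ℕ} (hd : 1 ≤ d) :
    ∀ᵐ θ ∂(Measure.pi fun _ : Fin (d + 1) => sigma d),
      LinearIndependent ℝ fun i => (θ i : Space d) := by
  refine ae_linearIndependent (sigma d) (fun θ => (θ : Space d)) measurable_subtype_coe
    (fun S hS => ?_) (d + 1) (by simp)
  have : Sᗮ ≠ ⊥ := fun h => hS (Submodule.orthogonal_eq_bot_iff.1 h)
  obtain ⟨v, hv, hv0⟩ := Submodule.exists_mem_ne_zero_of_ne_bot this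
  refine measure_mono_null (fun θ hθ => ?_) (sigma_inner_eq hd hv0 0)
  exact (Submodule.mem_orthogonal' S v).1 hv _ hθ

/-- The matrix with rows `(1, y i)`. -/
def graphMatrix {k d : ℕ} (y : Fin k → Fin d → ℝ) : Matrix (Fin k) (Fin (d + 1)) ℝ :=
  Matrix.of fun i => Fin.cons 1 (y i)

lemma continuous_graphMatrix {k d : ℕ} :
    Continuous fun y : Fin k → Fin d → ℝ => graphMatrix y := by
  refine continuous_pi fun i => continuous_pi fun j => ?_
  refine Fin.cases ?_ (fun j => ?_) j
  · simp only [graphMatrix, Matrix.of_apply, Fin.cons_zero]; fun_prop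
  · simp only [graphMatrix, Matrix.of_apply, Fin.cons_succ]; fun_prop

/-- If `S` is a proper subspace, the `y` with `(1, y)` in `S` form an affine subspace. It is proper,
hence null: otherwise `S` would contain `(1, 0)` and all differences of the vectors `(1, y)`, that
is, everything. -/
lemma ae_det_graphMatrix_ne_zero (d : ℕ) :
    ∀ᵐ y : Fin (d + 1) → Fin d → ℝ, (graphMatrix y).det ≠ 0 := by
  have h := ae_linearIndependent (volume : Measure (Fin d → ℝ))
    (fun y => (Fin.cons 1 y : Fin (d + 1) → ℝ)) (by
      refine measurable_pi_lambda _ fun j => ?_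
      refine Fin.cases ?_ (fun j => ?_) j
      · simp only [Fin.cons_zero]; fun_prop
      · simp only [Fin.cons_succ]; fun_prop) ?_ (d + 1) (by simp)
  · filter_upwards [h] with y hy
    have := (Matrix.linearIndependent_rows_iff_isUnit (A := graphMatrix y)).1 hy
    exact ((Matrix.isUnit_iff_isUnit_det _).1 this).ne_zero
  · intro S hS
    let L : (Fin d → ℝ) →ₗ[ℝ] (Fin (d + 1) → ℝ) :=
      { toFun := fun y => Fin.cons 0 y
        map_add' := fun x y => by
          funext j; refine Fin.cases ?_ (fun j => ?_) j <;> simp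
        map_smul' := fun c x => by
          funext j; refine Fin.cases ?_ (fun j => ?_) j <;> simp }
    let A : (Fin d → ℝ) →ᵃ[ℝ] (Fin (d + 1) → ℝ) :=
      L.toAffineMap + AffineMap.const ℝ _ (Fin.cons 1 0 : Fin (d + 1) → ℝ)
    have hA : ∀ y, A y = Fin.cons 1 y := by
      intro y
      funext j; refine Fin.cases ?_ (fun j => ?_) j <;> simp [A, L]
    have hne : S.toAffineSubspace.comap A ≠ ⊤ := by
      intro htop
      have hmem : ∀ y, (Fin.cons 1 y : Fin (d + 1) → ℝ) ∈ S := by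
        intro y
        have : y ∈ S.toAffineSubspace.comap A := by rw [htop]; trivial
        rw [AffineSubspace.mem_comap, hA] at this
        exact this
      refine hS (eq_top_iff.2 fun z _ => ?_)
      have : z = (z 0) • (Fin.cons 1 0 : Fin (d + 1) → ℝ) +
          ((Fin.cons 1 (Fin.tail z)) - (Fin.cons 1 0 : Fin (d + 1) → ℝ)) := by
        funext j; refine Fin.cases ?_ (fun j => ?_) j <;> simp [Fin.tail]
      rw [this]
      exact S.add_mem (S.smul_mem _ (hmem _)) (S.sub_mem (hmem _) (hmem _))
    have := Measure.addHaar_affineSubspace volume _ hne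
    refine measure_mono_null (fun y hy => ?_) this
    change y ∈ S.toAffineSubspace.comap A
    rw [AffineSubspace.mem_comap, hA]
    exact hy

/-! ### The hyperplane through `d + 1` points -/

/-- The matrix with rows `x i`. -/
def coordMatrix {d : ℕ} (x : Fin (d + 1) → Space d) : Matrix (Fin (d + 1)) (Fin (d + 1)) ℝ :=
  Matrix.of fun i j => x i j

/-- The vector `v` with `⟪v, x i⟫ = 1` for all `i`, for linearly independent `x`. -/
def normalVec {d : ℕ} (x : Fin (d + 1) → Space d) : Space d :=
  WithLp.toLp 2 ((coordMatrix x)⁻¹.mulVec 1)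

lemma det_coordMatrix_ne_zero {d : ℕ} {x : Fin (d + 1) → Space d}
    (hx : LinearIndependent ℝ x) : (coordMatrix x).det ≠ 0 := by
  have h2 := hx.map' (WithLp.linearEquiv 2 ℝ (Fin (d + 1) → ℝ)).toLinearMap
    (LinearEquiv.ker _)
  have := (Matrix.linearIndependent_rows_iff_isUnit (A := coordMatrix x)).1 h2
  exact ((Matrix.isUnit_iff_isUnit_det _).1 this).ne_zero

lemma coordMatrix_mulVec {d : ℕ} (x : Fin (d + 1) → Space d) (w : Space d) (i : Fin (d + 1)) :
    (coordMatrix x).mulVec w i = inner ℝ w (x i) := by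
  simp [coordMatrix, Matrix.mulVec, dotProduct, PiLp.inner_apply]

lemma eq_smul_normalVec {d : ℕ} {x : Fin (d + 1) → Space d} (hx : (coordMatrix x).det ≠ 0)
    {w : Space d} {m : ℝ} (hw : ∀ i, inner ℝ w (x i) = m) : w = m • normalVec x := by
  have h1 : (coordMatrix x).mulVec w = m • (1 : Fin (d + 1) → ℝ) := by
    funext i; rw [coordMatrix_mulVec, hw]; simp
  have h2 : (coordMatrix x)⁻¹.mulVec ((coordMatrix x).mulVec w) = w := by
    rw [Matrix.mulVec_mulVec, Matrix.nonsing_inv_mul _ hx.isUnit, Matrix.one_mulVec]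
  rw [h1, Matrix.mulVec_smul] at h2
  ext j
  rw [← congrFun h2 j]
  simp [normalVec]

lemma inner_normalVec {d : ℕ} {x : Fin (d + 1) → Space d} (hx : (coordMatrix x).det ≠ 0)
    (i : Fin (d + 1)) : inner ℝ (normalVec x) (x i) = 1 := by
  rw [← coordMatrix_mulVec, normalVec]
  simp only
  rw [Matrix.mulVec_mulVec, Matrix.mul_nonsing_inv _ hx.isUnit, Matrix.one_mulVec]
  rfl

lemma normalVec_ne_zero {d : ℕ} {x : Fin (d + 1) → Space d} (hx : (coordMatrix x).det ≠ 0) :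
    normalVec x ≠ 0 := by
  intro h
  have := inner_normalVec hx 0
  simp [h] at this

lemma continuous_coordMatrix {d : ℕ} :
    Continuous fun x : Fin (d + 1) → Space d => coordMatrix x := by
  refine continuous_pi fun i => continuous_pi fun j => ?_
  simp only [coordMatrix, Matrix.of_apply]
  fun_prop

/-- Cramer's rule has a polynomial numerator and denominator. This gives measurability everywhere
and continuity where the determinant does not vanish. -/
lemma normalVec_eq {d : ℕ} (x : Fin (d + 1) → Space d) : normalVec x =
    ((coordMatrix x).det)⁻¹ • WithLp.toLp 2 ((coordMatrix x).adjugate.mulVec 1) := by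
  rw [normalVec, Matrix.inv_def, Ring.inverse_eq_inv', Matrix.smul_mulVec, WithLp.toLp_smul]

lemma measurable_normalVec {d : ℕ} :
    Measurable fun x : Fin (d + 1) → Space d => normalVec x := by
  simp_rw [normalVec_eq]
  have h1 := continuous_coordMatrix (d := d)
  have h2 := h1.matrix_det
  have h3 : Continuous fun x : Fin (d + 1) → Space d =>
      WithLp.toLp 2 ((coordMatrix x).adjugate.mulVec (1 : Fin (d + 1) → ℝ)) :=
    (PiLp.continuous_toLp 2 _).comp (h1.matrix_adjugate.matrix_mulVec continuous_const)
  exact h2.measurable.inv.smul h3.measurable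

lemma continuousAt_normalVec {d : ℕ} {x : Fin (d + 1) → Space d}
    (hx : (coordMatrix x).det ≠ 0) : ContinuousAt normalVec x := by
  have h0 : (normalVec : (Fin (d + 1) → Space d) → Space d) = fun x =>
      ((coordMatrix x).det)⁻¹ • WithLp.toLp 2 ((coordMatrix x).adjugate.mulVec 1) :=
    funext normalVec_eq
  rw [h0]
  have h1 := continuous_coordMatrix (d := d)
  have h2 := h1.matrix_det
  have h3 : Continuous fun x : Fin (d + 1) → Space d =>
      WithLp.toLp 2 ((coordMatrix x).adjugate.mulVec (1 : Fin (d + 1) → ℝ)) :=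
    (PiLp.continuous_toLp 2 _).comp (h1.matrix_adjugate.matrix_mulVec continuous_const)
  exact (h2.continuousAt.inv₀ hx).smul h3.continuousAt

/-- The distance from the origin of the hyperplane through the points `x i`. -/
def planeDist {d : ℕ} (x : Fin (d + 1) → Space d) : ℝ := ‖normalVec x‖⁻¹

/-! ### Parametrizing points by the hyperplane through them -/

lemma measurePreserving_toLp_cons (d : ℕ) :
    MeasurePreserving fun p : ℝ × (Fin d → ℝ) => (WithLp.toLp 2 (Fin.cons p.1 p.2) : Space d) := by
  have h := (PiLp.volume_preserving_toLp (Fin (d + 1))).comp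
    ((volume_preserving_piFinSuccAbove (fun _ : Fin (d + 1) => ℝ) 0).symm)
  convert h using 1
  funext p
  simp [MeasurableEquiv.piFinSuccAbove_symm_apply, Fin.insertNthEquiv]

lemma lintegral_pi_space {d k : ℕ} (F : (Fin k → Space d) → ℝ≥0∞) (hF : Measurable F) :
    ∫⁻ x, F x = ∫⁻ y : Fin k → Fin d → ℝ, ∫⁻ s : Fin k → ℝ,
      F (fun i => WithLp.toLp 2 (Fin.cons (s i) (y i))) := by
  have mp := (volume_preserving_pi (fun _ : Fin k => measurePreserving_toLp_cons d)).comp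
    (volume_measurePreserving_arrowProdEquivProdArrow ℝ (Fin d → ℝ) (Fin k)).symm
  have hm : Measurable fun p : (Fin k → ℝ) × (Fin k → Fin d → ℝ) =>
      F (fun i => WithLp.toLp 2 (Fin.cons (p.1 i) (p.2 i))) := hF.comp mp.measurable
  rw [← mp.lintegral_comp hF]
  exact lintegral_prod_symm' _ hm

lemma lintegral_mulVec {n : ℕ} {M : Matrix (Fin n) (Fin n) ℝ} (hM : M.det ≠ 0)
    (G : (Fin n → ℝ) → ℝ≥0∞) (hG : Measurable G) :
    ∫⁻ s, G s = ENNReal.ofReal |M.det| * ∫⁻ c, G (M.mulVec c) := by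
  have h := Real.map_matrix_volume_pi_eq_smul_volume_pi hM
  have h2 : ∫⁻ c, G (M.mulVec c) = ENNReal.ofReal |M.det⁻¹| * ∫⁻ s, G s := by
    rw [← smul_eq_mul, ← lintegral_smul_measure, ← h, lintegral_map hG]
    · simp [Matrix.toLin'_apply]
    · exact (LinearMap.continuous_of_finiteDimensional _).measurable
  rw [h2, ← mul_assoc, ← ENNReal.ofReal_mul (abs_nonneg _), ← abs_mul, mul_inv_cancel₀ hM]
  simp

lemma graphMatrix_mulVec_cons {k d : ℕ} (y : Fin k → Fin d → ℝ) (b : ℝ) (a : Fin d → ℝ)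
    (i : Fin k) : (graphMatrix y).mulVec (Fin.cons b a) i = b + ∑ j, a j * y i j := by
  simp [graphMatrix, Matrix.mulVec, dotProduct, Fin.sum_univ_succ, mul_comm]

/-- The point above `y` on the graph of the affine function `y ↦ b + ⟪a, y⟫`. -/
def graphPt {d : ℕ} (b : ℝ) (a y : Fin d → ℝ) : Space d :=
  WithLp.toLp 2 (Fin.cons (b + ∑ j, a j * y j) y)

lemma measurable_toLp_cons {α : Type*} [MeasurableSpace α] {d : ℕ} {f : α → ℝ}
    {g : α → Fin d → ℝ} (hf : Measurable f) (hg : Measurable g) :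
    Measurable fun x => (WithLp.toLp 2 (Fin.cons (f x) (g x)) : Space d) :=
  (measurePreserving_toLp_cons d).measurable.comp (hf.prodMk hg)

/-- Integration over `d + 1` points, by the coefficients `(b, a)` of the hyperplane through them
and the positions `y` of the points above it. -/
lemma lintegral_eq_lintegral_graphPt {d : ℕ} (F : (Fin (d + 1) → Space d) → ℝ≥0∞)
    (hF : Measurable F) :
    ∫⁻ x, F x = ∫⁻ a : Fin d → ℝ, ∫⁻ b : ℝ, ∫⁻ y : Fin (d + 1) → Fin d → ℝ,
      ENNReal.ofReal |(graphMatrix y).det| * F (fun i => graphPt b a (y i)) := by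
  have hdet : Measurable fun y : Fin (d + 1) → Fin d → ℝ => (graphMatrix y).det :=
    continuous_graphMatrix.matrix_det.measurable
  -- For fixed positions `y`, the vector of heights is `graphMatrix y` applied to the coefficients
  -- `c = (b, a)`; the Jacobian is the determinant, nonzero for almost all `y`.
  have e1 : ∫⁻ x, F x = ∫⁻ y : Fin (d + 1) → Fin d → ℝ, ∫⁻ c : Fin (d + 1) → ℝ,
      ENNReal.ofReal |(graphMatrix y).det| *
        F (fun i => WithLp.toLp 2 (Fin.cons ((graphMatrix y).mulVec c i) (y i))) := by
    rw [lintegral_pi_space F hF]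
    refine lintegral_congr_ae ?_
    filter_upwards [ae_det_graphMatrix_ne_zero d] with y hy
    rw [lintegral_const_mul' _ _ ENNReal.ofReal_ne_top]
    refine lintegral_mulVec hy (fun s => F (fun i => WithLp.toLp 2 (Fin.cons (s i) (y i)))) ?_
    exact hF.comp (measurable_pi_lambda _ fun i => measurable_toLp_cons (by fun_prop) (by fun_prop))
  have hW : Measurable fun p : (Fin (d + 1) → Fin d → ℝ) × (Fin (d + 1) → ℝ) =>
      (graphMatrix p.1).mulVec p.2 :=
    ((continuous_graphMatrix.comp continuous_fst).matrix_mulVec continuous_snd).measurable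
  have hm : Measurable fun p : (Fin (d + 1) → Fin d → ℝ) × (Fin (d + 1) → ℝ) =>
      ENNReal.ofReal |(graphMatrix p.1).det| *
        F (fun i => WithLp.toLp 2 (Fin.cons ((graphMatrix p.1).mulVec p.2 i) (p.1 i))) := by
    refine Measurable.mul (measurable_norm.comp (hdet.comp measurable_fst)).ennreal_ofReal
      (hF.comp (measurable_pi_lambda _ fun i => ?_))
    exact measurable_toLp_cons ((measurable_pi_apply i).comp hW) (by fun_prop)
  rw [e1, lintegral_lintegral_swap hm.aemeasurable,
    ← ((volume_preserving_piFinSuccAbove (fun _ : Fin (d + 1) => ℝ) 0).symm).lintegral_comp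
      hm.lintegral_prod_left']
  have hm2 : Measurable fun p : ℝ × (Fin d → ℝ) => ∫⁻ y : Fin (d + 1) → Fin d → ℝ,
      ENNReal.ofReal |(graphMatrix y).det| * F (fun i => graphPt p.1 p.2 (y i)) := by
    refine Measurable.lintegral_prod_left' (f := fun q : (Fin (d + 1) → Fin d → ℝ) ×
      (ℝ × (Fin d → ℝ)) => ENNReal.ofReal |(graphMatrix q.1).det| *
        F (fun i => graphPt q.2.1 q.2.2 (q.1 i))) ?_
    refine Measurable.mul (measurable_norm.comp (hdet.comp measurable_fst)).ennreal_ofReal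
      (hF.comp (measurable_pi_lambda _ fun i => ?_))
    exact measurable_toLp_cons (by fun_prop) (by fun_prop)
  rw [← lintegral_prod_symm' _ hm2]
  refine lintegral_congr fun p => lintegral_congr fun y => ?_
  congr 2
  funext i
  rw [graphPt, ← graphMatrix_mulVec_cons]
  simp [MeasurableEquiv.piFinSuccAbove_symm_apply, Fin.insertNthEquiv]

/-- An affine map on the points is right multiplication by a block triangular matrix, with diagonal
blocks `1` and the transposed matrix of `M`. -/
lemma det_graphMatrix_affine {d : ℕ} (M : (Fin d → ℝ) →ₗ[ℝ] (Fin d → ℝ)) (m : Fin d → ℝ)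
    (z : Fin (d + 1) → Fin d → ℝ) :
    (graphMatrix fun i => m + M (z i)).det =
      (graphMatrix z).det * LinearMap.det M := by
  let P : Matrix (Fin (d + 1)) (Fin (d + 1)) ℝ :=
    Matrix.of (Fin.cons (Fin.cons 1 m) fun j => Fin.cons 0 (M (Pi.single j 1)))
  have h1 : (graphMatrix fun i => m + M (z i)) = graphMatrix z * P := by
    ext i j
    rw [Matrix.mul_apply, Fin.sum_univ_succ]
    refine Fin.cases ?_ (fun j => ?_) j
    · simp [graphMatrix, P]
    · have : M (z i) = ∑ l, z i l • M (Pi.single l 1) := by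
        conv_lhs => rw [pi_eq_sum_univ' (z i)]
        simp [map_sum]
      simp [graphMatrix, P, this]
  have h2 : P.det = LinearMap.det M := by
    rw [Matrix.det_succ_column_zero, Fin.sum_univ_succ]
    simp [P]
    rw [← Matrix.det_transpose]
    rw [← LinearMap.det_toMatrix']
    congr 1
  rw [h1, Matrix.det_mul, h2]

/-- The radius `√(1 + ‖a‖²)`. -/
def slopeNorm {d : ℕ} (a : Fin d → ℝ) : ℝ := √(1 + ∑ j, a j ^ 2)

lemma slopeNorm_pos {d : ℕ} (a : Fin d → ℝ) : 0 < slopeNorm a :=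
  Real.sqrt_pos.2 (by
    have := Finset.sum_nonneg fun (i : Fin d) (_ : i ∈ Finset.univ) => sq_nonneg (a i)
    linarith)

lemma slopeNorm_sq {d : ℕ} (a : Fin d → ℝ) : slopeNorm a ^ 2 = 1 + ∑ j, a j ^ 2 :=
  Real.sq_sqrt (by
    have := Finset.sum_nonneg fun (i : Fin d) (_ : i ∈ Finset.univ) => sq_nonneg (a i)
    linarith)

/-- A linear map `M` for which `z ↦ (⟪a, M z⟫, M z)` is an isometry onto the graph of `⟪a, ·⟫`. -/
def shear {d : ℕ} (a : Fin d → ℝ) : (Fin d → ℝ) →ₗ[ℝ] (Fin d → ℝ) where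
  -- The coefficient is such that `a` is divided by `slopeNorm a` and vectors orthogonal to `a` are
  -- fixed, which undoes the stretching of the graph in the direction `a`.
  toFun z i := z i - (slopeNorm a * (slopeNorm a + 1))⁻¹ * (∑ j, a j * z j) * a i
  map_add' x y := by
    funext i
    simp only [Pi.add_apply, mul_add, Finset.sum_add_distrib]
    ring
  map_smul' c x := by
    funext i
    simp only [Pi.smul_apply, smul_eq_mul, RingHom.id_apply, mul_left_comm _ c,
      ← Finset.mul_sum]
    ring

lemma shear_apply {d : ℕ} (a z : Fin d → ℝ) (i : Fin d) :
    shear a z i = z i - (slopeNorm a * (slopeNorm a + 1))⁻¹ * (∑ j, a j * z j) * a i := by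
  rfl

lemma shear_sq {d : ℕ} (a z : Fin d → ℝ) :
    (∑ j, a j * shear a z j) ^ 2 + ∑ j, shear a z j ^ 2 = ∑ j, z j ^ 2 := by
  have hr := slopeNorm_pos a
  have hsq := slopeNorm_sq a
  set r := slopeNorm a
  set γ := (r * (r + 1))⁻¹ with hγ
  set A := ∑ j, a j * z j with hA
  set s := ∑ j, a j ^ 2 with hs
  have h1 : ∑ j, a j * shear a z j = A - γ * A * s := by
    rw [hs, Finset.mul_sum]
    simp_rw [shear_apply, mul_sub, Finset.sum_sub_distrib]
    rw [← hA, ← hγ]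
    congr 1
    exact Finset.sum_congr rfl fun j _ => by ring
  have h2 : ∑ j, shear a z j ^ 2 = ∑ j, z j ^ 2 - 2 * γ * A * A + γ ^ 2 * A ^ 2 * s := by
    have : ∀ j, shear a z j ^ 2 =
        z j ^ 2 - 2 * γ * A * (a j * z j) + γ ^ 2 * A ^ 2 * a j ^ 2 := by
      intro j; rw [shear_apply]; ring
    simp_rw [this, Finset.sum_add_distrib, Finset.sum_sub_distrib, ← Finset.mul_sum]
    rw [← hA]
  have hs' : s = r ^ 2 - 1 := by linarith
  rw [h1, h2, hs']
  have hγ' : γ * (r * (r + 1)) = 1 := inv_mul_cancel₀ (by positivity)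
  have : γ = 1 / (r * (r + 1)) := by rw [hγ, one_div]
  rw [this]
  field_simp
  ring

lemma shear_injective {d : ℕ} (a : Fin d → ℝ) : Function.Injective (shear a) := by
  rw [← LinearMap.ker_eq_bot, LinearMap.ker_eq_bot']
  intro z hz
  have h := shear_sq a z
  simp only [hz, Pi.zero_apply, mul_zero, Finset.sum_const_zero, ne_eq, OfNat.ofNat_ne_zero,
    not_false_eq_true, zero_pow, add_zero] at h
  funext j
  have := (Finset.sum_eq_zero_iff_of_nonneg fun i _ => sq_nonneg (z i)).1 h.symm j
    (Finset.mem_univ j)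
  simpa using this

/-- Pythagoras: the hyperplane with intercept `slopeNorm a * t` and slope `a` has distance `|t|`
from the origin, and the foot of the perpendicular lies above `-(t / slopeNorm a) • a`. -/
lemma shear_slice {d : ℕ} (a z : Fin d → ℝ) (t : ℝ) :
    (slopeNorm a * t + ∑ j, a j * ((-(t / slopeNorm a)) • a + shear a z) j) ^ 2 +
      ∑ j, ((-(t / slopeNorm a)) • a + shear a z) j ^ 2 = t ^ 2 + ∑ j, z j ^ 2 := by
  have hr := slopeNorm_pos a
  have hsq := slopeNorm_sq a
  rw [← shear_sq a z]
  set r := slopeNorm a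
  set w := shear a z
  set B := ∑ j, a j * w j with hB
  set s := ∑ j, a j ^ 2 with hs
  have h1 : ∑ j, a j * ((-(t / r)) • a + w) j = -(t / r) * s + B := by
    simp only [Pi.add_apply, Pi.smul_apply, smul_eq_mul, mul_add, Finset.sum_add_distrib]
    rw [hs, Finset.mul_sum]
    congr 1
    exact Finset.sum_congr rfl fun j _ => by ring
  have h2 : ∑ j, ((-(t / r)) • a + w) j ^ 2 =
      (t / r) ^ 2 * s - 2 * (t / r) * B + ∑ j, w j ^ 2 := by
    have : ∀ j, ((-(t / r)) • a + w) j ^ 2 =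
        (t / r) ^ 2 * a j ^ 2 - 2 * (t / r) * (a j * w j) + w j ^ 2 := by
      intro j; simp only [Pi.add_apply, Pi.smul_apply, smul_eq_mul]; ring
    simp_rw [this, Finset.sum_add_distrib, Finset.sum_sub_distrib, ← Finset.mul_sum]
    rw [← hB]
  have hs' : s = r ^ 2 - 1 := by linarith
  rw [h1, h2, hs']
  field_simp
  ring

/-! ### The law of the distance of the hyperplane through `d + 1` uniform points -/

/-- With intercept `b = slopeNorm a * t`, the vector `b⁻¹ • (1, -a)` has inner product `1` with
every point of the graph and norm `1 / |t|`. A hyperplane through the origin has no such vector,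
hence `t ≠ 0`. -/
lemma planeDist_graphPt {d : ℕ} (a : Fin d → ℝ) {t : ℝ} (ht : t ≠ 0)
    {y : Fin (d + 1) → Fin d → ℝ} (hy : (graphMatrix y).det ≠ 0) :
    planeDist (fun i => graphPt (slopeNorm a * t) a (y i)) = |t| := by
  have hr := slopeNorm_pos a
  set b := slopeNorm a * t with hb
  have hb0 : b ≠ 0 := mul_ne_zero hr.ne' ht
  have hli : LinearIndependent ℝ fun i => graphPt b a (y i) := by
    have hy' := (Matrix.linearIndependent_rows_iff_isUnit (A := graphMatrix y)).2
      ((Matrix.isUnit_iff_isUnit_det _).2 hy.isUnit)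
    rw [Fintype.linearIndependent_iff] at hy' ⊢
    intro g hg
    have hc : ∀ j, ∑ i, g i * graphPt b a (y i) j = 0 := by
      intro j
      have := congrArg (fun w : Space d => w j) hg
      simpa using this
    have h1 : ∀ j, ∑ i, g i * y i j = 0 := fun j => by simpa [graphPt] using hc j.succ
    have h2 : ∑ i, g i = 0 := by
      have h0 := hc 0
      simp only [graphPt, Fin.cons_zero, mul_add, Finset.sum_add_distrib, Finset.mul_sum] at h0
      rw [Finset.sum_comm] at h0
      simp only [mul_left_comm _ (a _), ← Finset.mul_sum, h1, mul_zero, Finset.sum_const_zero,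
        add_zero, ← Finset.sum_mul] at h0
      exact (mul_eq_zero.1 h0).resolve_right hb0
    refine hy' g ?_
    funext j
    refine Fin.cases ?_ (fun j => ?_) j
    · simpa [graphMatrix, Matrix.row] using h2
    · simpa [graphMatrix, Matrix.row] using h1 j
  have hdet := det_coordMatrix_ne_zero hli
  have hv := eq_smul_normalVec hdet (w := b⁻¹ • WithLp.toLp 2 (Fin.cons 1 (-a))) (m := 1) (by
    intro i
    rw [inner_smul_left]
    simp only [graphPt, PiLp.inner_apply, Fin.sum_univ_succ]
    simp
    have : ∑ j, y i j * a j = ∑ j, a j * y i j := Finset.sum_congr rfl fun j _ => mul_comm _ _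
    rw [this]
    field_simp
    ring)
  rw [planeDist, ← one_smul ℝ (normalVec _), ← hv, norm_smul]
  have hn : ‖(WithLp.toLp 2 (Fin.cons 1 (-a)) : Space d)‖ = slopeNorm a := by
    rw [← sq_eq_sq₀ (norm_nonneg _) hr.le, norm_sq_toLp_cons, slopeNorm_sq]
    simp
  rw [hn, norm_inv, hb, norm_mul, Real.norm_of_nonneg hr.le, Real.norm_eq_abs]
  have := abs_pos.2 ht
  field_simp

lemma measurable_planeDist {d : ℕ} :
    Measurable fun x : Fin (d + 1) → Space d => planeDist x :=
  measurable_normalVec.norm.inv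

/-- The integral of the volume factor over `d + 1` points of a slice of the ball. -/
def sliceIntegral (d : ℕ) (ε t : ℝ) : ℝ≥0∞ :=
  ∫⁻ z : Fin (d + 1) → Fin d → ℝ, ENNReal.ofReal |(graphMatrix z).det| *
    ∏ i, sqNormDens ε (t ^ 2 + ∑ j, z i j ^ 2)

lemma measurable_det_graphMatrix (d : ℕ) :
    Measurable fun y : Fin (d + 1) → Fin d → ℝ => ENNReal.ofReal |(graphMatrix y).det| :=
  (measurable_norm.comp continuous_graphMatrix.matrix_det.measurable).ennreal_ofReal

/-- Translating to the foot of the perpendicular and applying `shear a` to each point makes every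
slice a standard one. The factor `κ` depends on the slope alone; its value is irrelevant after
normalization. -/
lemma exists_lintegral_slice {d : ℕ} (a : Fin d → ℝ) : ∃ κ : ℝ≥0∞, ∀ ε t : ℝ,
    ∫⁻ y : Fin (d + 1) → Fin d → ℝ, ENNReal.ofReal |(graphMatrix y).det| *
      ∏ i, ballDens ε (graphPt (slopeNorm a * t) a (y i)) = κ * sliceIntegral d ε t := by
  let LM : (Fin (d + 1) → Fin d → ℝ) →ₗ[ℝ] (Fin (d + 1) → Fin d → ℝ) :=
    LinearMap.pi fun i => shear a ∘ₗ LinearMap.proj i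
  have hLMi : Function.Injective LM := by
    intro x y hxy
    funext i
    exact shear_injective a (congrFun hxy i)
  have hLM : LinearMap.det LM ≠ 0 := by
    have := (LinearEquiv.ofInjectiveEndo LM hLMi).isUnit_det'
    exact this.ne_zero
  refine ⟨ENNReal.ofReal |LinearMap.det LM| * ENNReal.ofReal |LinearMap.det (shear a)|,
    fun ε t => ?_⟩
  have hsn := measurable_sqNormDens ε
  have hdet := measurable_det_graphMatrix d
  have hG : Measurable fun y : Fin (d + 1) → Fin d → ℝ =>
      ENNReal.ofReal |(graphMatrix y).det| *
        ∏ i, ballDens ε (graphPt (slopeNorm a * t) a (y i)) := by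
    refine hdet.mul (Finset.measurable_prod _ fun i _ => (measurable_ballDens ε).comp ?_)
    exact measurable_toLp_cons (by fun_prop) (by fun_prop)
  have hmap := Measure.map_linearMap_addHaar_eq_smul_addHaar
    (volume : Measure (Fin (d + 1) → Fin d → ℝ)) hLM
  have hvol : (volume : Measure (Fin (d + 1) → Fin d → ℝ)) =
      ENNReal.ofReal |LinearMap.det LM| • Measure.map LM volume := by
    rw [hmap, smul_smul, ← ENNReal.ofReal_mul (abs_nonneg _), ← abs_mul, mul_inv_cancel₀ hLM]
    simp
  have hLMm : Measurable LM := (LinearMap.continuous_of_finiteDimensional LM).measurable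
  rw [← lintegral_add_left_eq_self _ (fun _ => (-(t / slopeNorm a)) • a)]
  conv_lhs => rw [hvol]
  rw [lintegral_smul_measure, lintegral_map _ hLMm, smul_eq_mul, mul_assoc, sliceIntegral]
  · congr 1
    rw [← lintegral_const_mul' _ _ ENNReal.ofReal_ne_top]
    refine lintegral_congr fun z => ?_
    have h1 : ((fun _ => (-(t / slopeNorm a)) • a) + LM z : Fin (d + 1) → Fin d → ℝ) =
        fun i => (-(t / slopeNorm a)) • a + shear a (z i) := rfl
    rw [h1, det_graphMatrix_affine, abs_mul, ENNReal.ofReal_mul (abs_nonneg _), ← mul_assoc,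
      mul_comm (ENNReal.ofReal |LinearMap.det (shear a)|)]
    congr 1
    refine Finset.prod_congr rfl fun i _ => ?_
    rw [ballDens_eq, graphPt, norm_sq_toLp_cons, shear_slice]
  · exact hG.comp (measurable_const_add _)

/-- Scale all `d + 1` points by `√(1 - t²)`. The volume contributes exponent `d(d + 1)/2`, the
determinant `d/2`, and the densities `(d + 1)(ε - 1)`; the sum is `d²/2 - 1 + (d + 1)ε`. -/
lemma sliceIntegral_of_sq_lt_one {d : ℕ} (ε : ℝ) {t : ℝ} (ht : t ^ 2 < 1) :
    sliceIntegral d ε t =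
      ENNReal.ofReal ((1 - t ^ 2) ^ ((d : ℝ) ^ 2 / 2 - 1 + ((d : ℝ) + 1) * ε)) *
        sliceIntegral d ε 0 := by
  have h2 : 0 < 1 - t ^ 2 := by linarith
  have hsn := measurable_sqNormDens ε
  have hdet := measurable_det_graphMatrix d
  have hfin : Module.finrank ℝ (Fin (d + 1) → Fin d → ℝ) = (d + 1) * d := by
    rw [Module.finrank_pi_fintype]; simp
  have hm : ∀ s : ℝ, Measurable fun z : Fin (d + 1) → Fin d → ℝ =>
      ENNReal.ofReal |(graphMatrix z).det| * ∏ i, sqNormDens ε (s ^ 2 + ∑ j, z i j ^ 2) := by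
    intro s
    refine hdet.mul (Finset.measurable_prod _ fun i _ => hsn.comp (by fun_prop))
  rw [sliceIntegral, lintegral_eq_lintegral_smul volume (Real.sqrt_pos.2 h2) _ (hm t), hfin]
  have hpt : ∀ z : Fin (d + 1) → Fin d → ℝ,
      ENNReal.ofReal |(graphMatrix (√(1 - t ^ 2) • z)).det| *
        ∏ i, sqNormDens ε (t ^ 2 + ∑ j, (√(1 - t ^ 2) • z) i j ^ 2) =
      ENNReal.ofReal (√(1 - t ^ 2) ^ d * ((1 - t ^ 2) ^ (ε - 1)) ^ (d + 1)) *
        (ENNReal.ofReal |(graphMatrix z).det| *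
          ∏ i, sqNormDens ε (0 ^ 2 + ∑ j, z i j ^ 2)) := by
    intro z
    have h3 := det_graphMatrix_affine (√(1 - t ^ 2) • LinearMap.id) 0 z
    have h4 : (fun i => (0 : Fin d → ℝ) + (√(1 - t ^ 2) • LinearMap.id :
        (Fin d → ℝ) →ₗ[ℝ] (Fin d → ℝ)) (z i)) = √(1 - t ^ 2) • z := by
      funext i; simp
    rw [h4, LinearMap.det_smul, LinearMap.det_id, mul_one, Module.finrank_fin_fun] at h3
    rw [h3, abs_mul, abs_of_nonneg (pow_nonneg (Real.sqrt_nonneg _) d)]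
    simp only [Pi.smul_apply, smul_eq_mul, mul_pow, ← Finset.mul_sum, Real.sq_sqrt h2.le,
      sqNormDens_slice ht, Finset.prod_mul_distrib, Finset.prod_const, Finset.card_univ,
      Fintype.card_fin, ne_eq, OfNat.ofNat_ne_zero, not_false_eq_true, zero_pow, zero_add]
    rw [ENNReal.ofReal_mul (abs_nonneg _), ENNReal.ofReal_mul (by positivity),
      ENNReal.ofReal_pow (p := (1 - t ^ 2) ^ (ε - 1)) (by positivity)]
    ring
  simp_rw [hpt]
  rw [lintegral_const_mul' _ _ ENNReal.ofReal_ne_top, ← mul_assoc, sliceIntegral,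
    ← ENNReal.ofReal_mul (by positivity)]
  congr 2
  generalize 1 - t ^ 2 = w at h2
  rw [Real.sqrt_eq_rpow, ← Real.rpow_natCast, ← Real.rpow_natCast, ← Real.rpow_natCast,
    ← Real.rpow_mul h2.le, ← Real.rpow_mul h2.le, ← Real.rpow_mul h2.le, ← Real.rpow_add h2,
    ← Real.rpow_add h2]
  congr 1
  push_cast
  ring

lemma sliceIntegral_of_one_le_sq {d : ℕ} (ε : ℝ) {t : ℝ} (ht : 1 ≤ t ^ 2) :
    sliceIntegral d ε t = 0 := by
  rw [sliceIntegral]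
  refine (lintegral_congr fun z => ?_).trans lintegral_zero
  rw [Finset.prod_eq_zero (Finset.mem_univ 0), mul_zero]
  refine sqNormDens_of_one_le ?_
  have := Finset.sum_nonneg fun (j : Fin d) (_ : j ∈ Finset.univ) => sq_nonneg (z 0 j)
  linarith

/-- After the substitution `b = slopeNorm a * t` the slope and the distance separate, and `K`
collects everything that depends on the slope. -/
lemma exists_lintegral_ballDens_planeDist (d : ℕ) : ∃ K : ℝ → ℝ≥0∞, ∀ ε : ℝ,
    ∀ h : ℝ → ℝ≥0∞, Measurable h →
      ∫⁻ t, h |t| ∂sqMeas ((d : ℝ) ^ 2 / 2 - 1 + ((d : ℝ) + 1) * ε) ≠ ∞ →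
      ∫⁻ x : Fin (d + 1) → Space d, (∏ i, ballDens ε (x i)) * h (planeDist x) =
        K ε * ∫⁻ t, h |t| ∂sqMeas ((d : ℝ) ^ 2 / 2 - 1 + ((d : ℝ) + 1) * ε) := by
  choose κ hκ using fun a : Fin d → ℝ => exists_lintegral_slice a
  refine ⟨fun ε => ∫⁻ a, ENNReal.ofReal (slopeNorm a) * (κ a * sliceIntegral d ε 0),
    fun ε h hh hfin => ?_⟩
  have hF : Measurable fun x : Fin (d + 1) → Space d =>
      (∏ i, ballDens ε (x i)) * h (planeDist x) := by
    refine Measurable.mul (Finset.measurable_prod _ fun i _ =>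
      (measurable_ballDens ε).comp (measurable_pi_apply i)) (hh.comp measurable_planeDist)
  have habs : Measurable fun t : ℝ => h |t| := hh.comp measurable_norm
  -- `κ` comes from a choice and is not known to be measurable; the finiteness `hfin` of the other
  -- factor allows moving that factor under the integral all the same.
  rw [lintegral_eq_lintegral_graphPt _ hF, ← lintegral_mul_const' _ _ hfin]
  refine lintegral_congr fun a => ?_
  have hm : Measurable fun b : ℝ => ∫⁻ y : Fin (d + 1) → Fin d → ℝ,
      ENNReal.ofReal |(graphMatrix y).det| * ((∏ i, ballDens ε (graphPt b a (y i))) *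
        h (planeDist fun i => graphPt b a (y i))) := by
    refine Measurable.lintegral_prod_left' (f := fun q : (Fin (d + 1) → Fin d → ℝ) × ℝ =>
      ENNReal.ofReal |(graphMatrix q.1).det| * ((∏ i, ballDens ε (graphPt q.2 a (q.1 i))) *
        h (planeDist fun i => graphPt q.2 a (q.1 i)))) ?_
    refine ((measurable_det_graphMatrix d).comp measurable_fst).mul
      (hF.comp (measurable_pi_lambda _ fun i => ?_))
    exact measurable_toLp_cons (by fun_prop) (by fun_prop)
  rw [lintegral_eq_lintegral_smul volume (slopeNorm_pos a) _ hm, Module.finrank_self, pow_one,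
    mul_assoc]
  congr 1
  rw [lintegral_sqMeas _ _ habs, ← lintegral_const_mul _ (by fun_prop),
    ← lintegral_indicator measurableSet_Ioo]
  refine lintegral_congr_ae ?_
  have hne : ∀ᵐ t : ℝ, t ≠ 0 := by simp [ae_iff]
  filter_upwards [hne] with t ht
  have e1 : ∫⁻ y : Fin (d + 1) → Fin d → ℝ, ENNReal.ofReal |(graphMatrix y).det| *
      ((∏ i, ballDens ε (graphPt (slopeNorm a * t) a (y i))) *
        h (planeDist fun i => graphPt (slopeNorm a * t) a (y i))) =
      κ a * sliceIntegral d ε t * h |t| := by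
    rw [← hκ a ε t, ← lintegral_mul_const]
    · refine lintegral_congr fun y => ?_
      by_cases hy : (graphMatrix y).det = 0
      · simp [hy]
      · rw [planeDist_graphPt a ht hy, mul_assoc]
    · refine (measurable_det_graphMatrix d).mul (Finset.measurable_prod _ fun i _ =>
        (measurable_ballDens ε).comp ?_)
      exact measurable_toLp_cons (by fun_prop) (by fun_prop)
  simp only [smul_eq_mul]
  rw [e1]
  by_cases hs : t ∈ Set.Ioo (-1 : ℝ) 1
  · rw [Set.indicator_of_mem hs, sliceIntegral_of_sq_lt_one ε (by nlinarith [hs.1, hs.2])]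
    ring
  · rw [Set.indicator_of_notMem hs, sliceIntegral_of_one_le_sq ε, mul_zero, zero_mul]
    by_contra hlt
    exact hs (abs_lt.1 (by rw [← sq_lt_one_iff_abs_lt_one]; linarith))

/-- The law of the distance from the origin of the hyperplane through `d + 1` independent uniform
points on `S^d`. -/
theorem map_planeDist_sigma {d : ℕ} (hd : 1 ≤ d) :
    (Measure.pi fun _ : Fin (d + 1) => sigma d).map (fun θ => planeDist fun i => (θ i : Space d)) =
      (sqLaw ((d : ℝ) ^ 2 / 2 - 1)).map fun t => |t| := by
  have hd' : (1 : ℝ) ≤ d := by exact_mod_cast hd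
  obtain ⟨K, hK⟩ := exists_lintegral_ballDens_planeDist d
  refine map_pi_sigma_eq_map_sqLaw hd planeDist measurable_planeDist ?_
    (q := (d : ℝ) ^ 2 / 2 - 1) (c := d + 1) (by nlinarith) (by positivity) _ measurable_norm K
    fun ε _ h hh hfin => hK ε h hh hfin
  filter_upwards [ae_linearIndependent_sigma hd] with θ hθ
  have hdet := det_coordMatrix_ne_zero hθ
  exact (continuousAt_normalVec hdet).norm.inv₀ (norm_ne_zero_iff.2 (normalVec_ne_zero hdet))

/-! ### The facets of a configuration in general position -/

lemma convexHull_image_subset_hull {d N : ℕ} (x : Fin N → Sph d) (J : Set (Fin N)) :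
    convexHull ℝ ((fun i => (x i : Space d)) '' J) ⊆ hull x :=
  convexHull_mono (Set.image_subset_range _ _)

lemma inner_eq_of_mem_convexHull {d N : ℕ} {x : Fin N → Sph d} {J : Set (Fin N)} {u : Space d}
    {t : ℝ} (h : ∀ i ∈ J, inner ℝ u (x i : Space d) = t) {z : Space d}
    (hz : z ∈ convexHull ℝ ((fun i => (x i : Space d)) '' J)) : inner ℝ u z = t := by
  have hc : Convex ℝ {z : Space d | inner ℝ u z = t} :=
    convex_hyperplane (innerₛₗ ℝ u).isLinear t
  refine convexHull_min ?_ hc hz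
  rintro _ ⟨i, hi, rfl⟩
  exact h i hi

/-- The face of the convex hull on which a linear functional is maximal is spanned by the points
at which it is maximal. -/
lemma argmax_hull {d N : ℕ} (x : Fin N → Sph d) (u : Space d) (t : ℝ)
    (h : ∀ i, inner ℝ u (x i : Space d) ≤ t) (h' : ∃ i, inner ℝ u (x i : Space d) = t) :
    {z ∈ hull x | ∀ y ∈ hull x, inner ℝ u y ≤ inner ℝ u z} =
      convexHull ℝ ((fun i => (x i : Space d)) '' {i | inner ℝ u (x i : Space d) = t}) := by
  set J : Set (Fin N) := {i | inner ℝ u (x i : Space d) = t} with hJ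
  have hle : ∀ y ∈ hull x, inner ℝ u y ≤ t := by
    intro y hy
    have hc : Convex ℝ {z : Space d | inner ℝ u z ≤ t} :=
      convex_halfSpace_le (innerₛₗ ℝ u).isLinear t
    exact convexHull_min (by rintro _ ⟨i, rfl⟩; exact h i) hc hy
  obtain ⟨i₀, hi₀⟩ := h'
  have hi₀m : (x i₀ : Space d) ∈ hull x := subset_convexHull _ _ ⟨i₀, rfl⟩
  apply Set.Subset.antisymm
  · rintro z ⟨hz, hmax⟩
    have hzt : inner ℝ u z = t := le_antisymm (hle z hz) (hi₀ ▸ hmax _ hi₀m)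
    by_cases hne : (Jᶜ).Nonempty
    -- A point of the hull is a convex combination of a point over the maximizers and a point over
    -- the rest; positive weight on the latter would push the functional below `t`.
    · have hU : Set.range (fun i => (x i : Space d)) =
          (fun i => (x i : Space d)) '' J ∪ (fun i => (x i : Space d)) '' Jᶜ := by
        rw [← Set.image_union, Set.union_compl_self, Set.image_univ]
      rw [hull, hU, convexHull_union (Set.Nonempty.image _ ⟨i₀, hi₀⟩) (hne.image _),
        mem_convexJoin] at hz
      obtain ⟨p, hp, q, hq, a, b, ha, hb, hab, rfl⟩ := hz
      have hpt := inner_eq_of_mem_convexHull (fun i hi => hi) hp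
      have hqt : inner ℝ u q < t := by
        have hc : Convex ℝ {z : Space d | inner ℝ u z < t} :=
          convex_halfSpace_lt (innerₛₗ ℝ u).isLinear t
        exact convexHull_min (by
          rintro _ ⟨i, hi, rfl⟩
          exact lt_of_le_of_ne (h i) hi) hc hq
      rw [inner_add_right, inner_smul_right, inner_smul_right, hpt] at hzt
      have hb0 : b = 0 := by
        by_contra hb0
        have hbp : 0 < b := lt_of_le_of_ne hb (Ne.symm hb0)
        have h3 : a * t + b * t = t := by rw [← add_mul, hab, one_mul]
        have h4 := mul_lt_mul_of_pos_left hqt hbp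
        linarith
      rw [hb0, add_zero] at hab
      rw [hb0, hab]
      simpa using hp
    · rw [Set.not_nonempty_iff_eq_empty, Set.compl_empty_iff] at hne
      rw [hne, Set.image_univ]
      exact hz
  · intro z hz
    have hzt := inner_eq_of_mem_convexHull (fun i hi => hi) hz
    exact ⟨convexHull_image_subset_hull x _ hz, fun y hy => hzt ▸ hle y hy⟩

/-- The index sets of the simplices spanned by a configuration. -/
abbrev Simplices (d N : ℕ) : Type := {I : Finset (Fin N) // I.card = d + 1}

/-- The vertices of a simplex. -/
def vertices {d N : ℕ} (x : Fin N → Sph d) (I : Simplices d N) : Fin (d + 1) → Space d :=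
  fun k => x (I.1.orderEmbOfFin I.2 k)

/-- The normal vector `v` of the hyperplane `{⟪v, z⟫ = 1}` through the vertices of a simplex. -/
def simplexNormal {d N : ℕ} (x : Fin N → Sph d) (I : Simplices d N) : Space d :=
  normalVec (vertices x I)

/-- General position of a configuration. -/
def Generic {d N : ℕ} (x : Fin N → Sph d) : Prop :=
  ∀ I : Simplices d N, LinearIndependent ℝ (vertices x I) ∧
    ∀ j ∉ I.1, inner ℝ (simplexNormal x I) (x j : Space d) ≠ 1

/-- All further points lie on the same side, as specified by the sign `s`, of the hyperplane
through the vertices of a simplex. -/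
def OneSided {d N : ℕ} (x : Fin N → Sph d) (s : ℝ) (I : Simplices d N) : Prop :=
  ∀ j ∉ I.1, s * inner ℝ (simplexNormal x I) (x j : Space d) < s

/-- The simplex with a given index set. -/
def simplex {d N : ℕ} (x : Fin N → Sph d) (I : Simplices d N) : Set (Space d) :=
  convexHull ℝ ((fun i => (x i : Space d)) '' I.1)

section

variable {d N : ℕ} {x : Fin N → Sph d}

lemma exists_vertices_eq (x : Fin N → Sph d) (I : Simplices d N) {i : Fin N} (hi : i ∈ I.1) :
    ∃ k, vertices x I k = x i := by
  have : i ∈ Set.range (I.1.orderEmbOfFin I.2) := by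
    rw [Finset.range_orderEmbOfFin]; exact hi
  obtain ⟨k, rfl⟩ := this
  exact ⟨k, rfl⟩

lemma range_vertices (x : Fin N → Sph d) (I : Simplices d N) :
    Set.range (vertices x I) = (fun i => (x i : Space d)) '' I.1 := by
  rw [← Finset.range_orderEmbOfFin I.1 I.2, ← Set.range_comp]
  rfl

lemma Generic.det_ne_zero (hx : Generic x) (I : Simplices d N) :
    (coordMatrix (vertices x I)).det ≠ 0 := det_coordMatrix_ne_zero (hx I).1

lemma Generic.simplexNormal_ne_zero (hx : Generic x) (I : Simplices d N) :
    simplexNormal x I ≠ 0 := normalVec_ne_zero (hx.det_ne_zero I)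

lemma Generic.inner_simplexNormal (hx : Generic x) (I : Simplices d N) {i : Fin N}
    (hi : i ∈ I.1) : inner ℝ (simplexNormal x I) (x i : Space d) = 1 := by
  obtain ⟨k, hk⟩ := exists_vertices_eq x I hi
  rw [← hk]
  exact inner_normalVec (hx.det_ne_zero I) k

lemma Generic.inner_simplexNormal_eq_one_iff (hx : Generic x) (I : Simplices d N) {i : Fin N} :
    inner ℝ (simplexNormal x I) (x i : Space d) = 1 ↔ i ∈ I.1 :=
  ⟨fun h => by_contra fun hi => (hx I).2 i hi h, hx.inner_simplexNormal I⟩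

lemma Generic.eq_smul_simplexNormal (hx : Generic x) (I : Simplices d N) {w : Space d} {m : ℝ}
    (hw : ∀ i ∈ I.1, inner ℝ w (x i : Space d) = m) : w = m • simplexNormal x I :=
  eq_smul_normalVec (hx.det_ne_zero I) fun _ => hw _ (Finset.orderEmbOfFin_mem _ _ _)

lemma Generic.finrank_vectorSpan (hx : Generic x) (I : Simplices d N) :
    Module.finrank ℝ (vectorSpan ℝ ((fun i => (x i : Space d)) '' I.1)) = d := by
  rw [← range_vertices]
  exact (hx I).1.affineIndependent.finrank_vectorSpan (by simp)

lemma vectorSpan_convexHull_eq (s : Set (Space d)) :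
    vectorSpan ℝ (convexHull ℝ s) = vectorSpan ℝ s := by
  rw [← direction_affineSpan, affineSpan_convexHull, direction_affineSpan]

lemma inner_eq_zero_of_mem_vectorSpan {v : Space d} {t : ℝ} {s : Set (Space d)}
    (h : ∀ z ∈ s, inner ℝ v z = t) {w : Space d} (hw : w ∈ vectorSpan ℝ s) :
    inner ℝ v w = 0 := by
  have hle : vectorSpan ℝ s ≤ LinearMap.ker (innerₛₗ ℝ v) := by
    rw [vectorSpan_def, Submodule.span_le]
    rintro _ ⟨a, ha, b, hb, rfl⟩
    simp [inner_sub_right, h a ha, h b hb]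
  exact hle hw

lemma exists_notMem_of_card (hN : d + 2 ≤ N) (I : Simplices d N) : ∃ j, j ∉ I.1 := by
  by_contra hcon
  push Not at hcon
  have := Finset.eq_univ_iff_forall.2 hcon
  have h2 := I.2
  rw [this, Finset.card_univ, Fintype.card_fin] at h2
  omega

/-- A facet of a configuration in general position is a simplex, with all further points on one
side. -/
lemma Generic.exists_of_mem_facets (hx : Generic x) (hd : 1 ≤ d) (hN : d + 2 ≤ N)
    {F : Set (Space d)} (hF : F ∈ facets x) :
    ∃ I : Simplices d N, (OneSided x 1 I ∨ OneSided x (-1) I) ∧ F = simplex x I := by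
  obtain ⟨hexp, hdim⟩ := hF
  have hne : F.Nonempty := by
    rw [Set.nonempty_iff_ne_empty]
    rintro rfl
    rw [vectorSpan_empty, finrank_bot] at hdim
    omega
  obtain ⟨l, hl⟩ := hexp hne
  set w := (InnerProductSpace.toDual ℝ (Space d)).symm l with hw
  have hlw : ∀ z, l z = inner ℝ w z := fun z => by
    rw [hw, InnerProductSpace.toDual_symm_apply]
  simp only [hlw] at hl
  have hNne : Nonempty (Fin N) := ⟨⟨0, by omega⟩⟩
  obtain ⟨i₀, hi₀⟩ := Finite.exists_max fun i => inner ℝ w (x i : Space d)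
  set m := inner ℝ w (x i₀ : Space d) with hm
  rw [argmax_hull x w m hi₀ ⟨i₀, rfl⟩] at hl
  classical
  set J : Finset (Fin N) := Finset.univ.filter fun i => inner ℝ w (x i : Space d) = m with hJ
  have hJc : {i | inner ℝ w (x i : Space d) = m} = (J : Set (Fin N)) := by
    ext i; simp [hJ]
  rw [hJc] at hl
  -- Fewer than `d + 1` points span fewer than `d` dimensions.
  have hcard : d + 1 ≤ J.card := by
    by_contra hlt
    have hJne : 0 < J.card := Finset.card_pos.2 ⟨i₀, by simp [hJ, hm]⟩
    have := finrank_vectorSpan_image_finset_le ℝ (fun i => (x i : Space d)) J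
      (n := J.card - 1) (by omega)
    rw [Finset.coe_image, ← vectorSpan_convexHull_eq, ← hl, hdim] at this
    omega
  obtain ⟨I, hIJ, hI⟩ := Finset.exists_subset_card_eq hcard
  set I' : Simplices d N := ⟨I, hI⟩ with hI'
  -- A further maximizer would lie in the hyperplane spanned by `I`, which general position forbids.
  have hJI : J = I := by
    refine Finset.Subset.antisymm (fun j hj => ?_) hIJ
    have hsp : vectorSpan ℝ ((fun i => (x i : Space d)) '' I) =
        vectorSpan ℝ ((fun i => (x i : Space d)) '' J) := by
      refine Submodule.eq_of_le_of_finrank_eq (vectorSpan_mono ℝ (Set.image_mono hIJ)) ?_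
      refine (hx.finrank_vectorSpan I').trans ?_
      rw [← vectorSpan_convexHull_eq, ← hl, hdim]
    obtain ⟨i, hi⟩ : I.Nonempty := Finset.card_pos.1 (by omega)
    have hmem : (x j : Space d) - x i ∈ vectorSpan ℝ ((fun i => (x i : Space d)) '' I) := by
      rw [hsp]
      exact vsub_mem_vectorSpan ℝ ⟨j, hj, rfl⟩ ⟨i, hIJ hi, rfl⟩
    have h0 := inner_eq_zero_of_mem_vectorSpan (v := simplexNormal x I') (t := 1) (by
      rintro _ ⟨k, hk, rfl⟩
      exact hx.inner_simplexNormal I' hk) hmem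
    rw [inner_sub_right, hx.inner_simplexNormal I' hi, sub_eq_zero] at h0
    exact (hx.inner_simplexNormal_eq_one_iff I').1 h0
  have hwm : w = m • simplexNormal x I' := hx.eq_smul_simplexNormal I' fun i hi => by
    have : i ∈ J := hIJ hi
    simpa [hJ] using this
  have hlt : ∀ j ∉ I, m * inner ℝ (simplexNormal x I') (x j : Space d) < m := by
    intro j hj
    have h1 : inner ℝ w (x j : Space d) = m * inner ℝ (simplexNormal x I') (x j : Space d) := by
      rw [hwm, inner_smul_left]; simp
    rw [← h1]
    refine lt_of_le_of_ne (hi₀ j) fun h => hj ?_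
    rw [← hJI]
    simp [hJ, h]
  refine ⟨I', ?_, by rw [hl, hJI]; rfl⟩
  obtain ⟨j₀, hj₀⟩ := exists_notMem_of_card hN I'
  -- The sign of `m` decides the side. If `m = 0`, then `hlt` at the point `j₀` off the simplex
  -- would read `0 < 0`.
  rcases lt_trichotomy m 0 with hm0 | hm0 | hm0
  · right
    intro j hj
    have := hlt j hj
    nlinarith
  · have := hlt j₀ hj₀
    rw [hm0] at this
    simp at this
  · left
    intro j hj
    have := hlt j hj
    nlinarith

/-- The outer unit normal of a facet. -/
def outerNormal (x : Fin N → Sph d) (s : ℝ) (I : Simplices d N) : Space d :=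
  (s * ‖simplexNormal x I‖⁻¹) • simplexNormal x I

lemma inner_outerNormal (s : ℝ) (I : Simplices d N) (z : Space d) :
    inner ℝ (outerNormal x s I) z =
      ‖simplexNormal x I‖⁻¹ * (s * inner ℝ (simplexNormal x I) z) := by
  rw [outerNormal, inner_smul_left]
  simp
  ring

lemma Generic.inner_outerNormal_le (hx : Generic x) {s : ℝ} {I : Simplices d N}
    (hI : OneSided x s I) (i : Fin N) :
    inner ℝ (outerNormal x s I) (x i : Space d) ≤ s * ‖simplexNormal x I‖⁻¹ := by
  have hv := inv_pos.2 (norm_pos_iff.2 (hx.simplexNormal_ne_zero I))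
  rw [inner_outerNormal]
  by_cases hi : i ∈ I.1
  · rw [hx.inner_simplexNormal I hi]; linarith
  · have := hI i hi
    nlinarith

lemma Generic.inner_outerNormal_eq_iff (hx : Generic x) {s : ℝ} {I : Simplices d N}
    (hI : OneSided x s I) (i : Fin N) :
    inner ℝ (outerNormal x s I) (x i : Space d) = s * ‖simplexNormal x I‖⁻¹ ↔ i ∈ I.1 := by
  have hv := inv_pos.2 (norm_pos_iff.2 (hx.simplexNormal_ne_zero I))
  rw [inner_outerNormal]
  constructor
  · intro h
    by_contra hi
    have := hI i hi
    nlinarith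
  · intro hi
    rw [hx.inner_simplexNormal I hi]; ring

lemma Generic.isOuterNormal (hx : Generic x) {s : ℝ} (hs : |s| = 1) {I : Simplices d N}
    (hI : OneSided x s I) : IsOuterNormal (hull x) (simplex x I) (outerNormal x s I) := by
  have hv := norm_pos_iff.2 (hx.simplexNormal_ne_zero I)
  obtain ⟨i₀, hi₀⟩ : I.1.Nonempty := Finset.card_pos.1 (by rw [I.2]; omega)
  constructor
  · rw [outerNormal, norm_smul, norm_mul, norm_inv, norm_norm, Real.norm_eq_abs, hs]
    field_simp
  · rw [argmax_hull x _ _ (hx.inner_outerNormal_le hI)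
      ⟨i₀, (hx.inner_outerNormal_eq_iff hI i₀).2 hi₀⟩]
    simp only [hx.inner_outerNormal_eq_iff hI]
    rfl

lemma Generic.simplex_mem_facets (hx : Generic x) {s : ℝ} (hs : |s| = 1) {I : Simplices d N}
    (hI : OneSided x s I) : simplex x I ∈ facets x := by
  constructor
  · intro _
    refine ⟨innerSL ℝ (outerNormal x s I), ?_⟩
    simpa using (hx.isOuterNormal hs hI).2
  · rw [simplex, vectorSpan_convexHull_eq, hx.finrank_vectorSpan]

lemma Generic.mem_simplex_iff (hx : Generic x) (I : Simplices d N) (i : Fin N) :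
    (x i : Space d) ∈ simplex x I ↔ i ∈ I.1 := by
  constructor
  · intro h
    exact (hx.inner_simplexNormal_eq_one_iff I).1
      (inner_eq_of_mem_convexHull (fun k hk => hx.inner_simplexNormal I hk) h)
  · intro h
    exact subset_convexHull _ _ ⟨i, h, rfl⟩

lemma Generic.simplex_injective (hx : Generic x) : Function.Injective (simplex x) := by
  intro I I' h
  refine Subtype.ext (Finset.ext fun i => ?_)
  rw [← hx.mem_simplex_iff I, h, hx.mem_simplex_iff I']

/-- Any outer normal is constant on the vertices, hence a multiple of `simplexNormal x I`. Unit
length fixes the modulus of the factor, and a point off the simplex fixes its sign, so the arbitrary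
choice in `holeCentre` is forced. -/
lemma Generic.holeCentre_eq (hx : Generic x) (hN : d + 2 ≤ N) {s : ℝ} (hs : |s| = 1)
    {I : Simplices d N} (hI : OneSided x s I) :
    holeCentre x (simplex x I) = outerNormal x s I := by
  have hu : IsOuterNormal (hull x) (simplex x I) (holeCentre x (simplex x I)) :=
    Classical.epsilon_spec (p := IsOuterNormal (hull x) (simplex x I))
      ⟨_, hx.isOuterNormal hs hI⟩
  set u := holeCentre x (simplex x I)
  obtain ⟨hu1, hu2⟩ := hu
  have hmem : ∀ i, (x i : Space d) ∈ hull x := fun i => subset_convexHull _ _ ⟨i, rfl⟩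
  have hF : ∀ i, i ∈ I.1 ↔ ∀ y ∈ hull x, inner ℝ u y ≤ inner ℝ u (x i : Space d) := by
    intro i
    rw [← hx.mem_simplex_iff I, hu2]
    simp [hmem i]
  obtain ⟨i₀, hi₀⟩ : I.1.Nonempty := Finset.card_pos.1 (by rw [I.2]; omega)
  set m := inner ℝ u (x i₀ : Space d) with hm
  have hum : u = m • simplexNormal x I := hx.eq_smul_simplexNormal I fun i hi =>
    le_antisymm ((hF i₀).1 hi₀ _ (hmem i)) ((hF i).1 hi _ (hmem i₀))
  obtain ⟨j, hj⟩ := exists_notMem_of_card hN I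
  have h1 : m * inner ℝ (simplexNormal x I) (x j : Space d) < m := by
    have h2 : inner ℝ u (x j : Space d) = m * inner ℝ (simplexNormal x I) (x j : Space d) := by
      rw [hum, inner_smul_left]; simp
    rw [← h2]
    refine lt_of_le_of_ne ((hF i₀).1 hi₀ _ (hmem j)) fun h => hj ((hF j).2 fun y hy => ?_)
    rw [h]
    exact (hF i₀).1 hi₀ y hy
  have h3 := hI j hj
  have hv := norm_pos_iff.2 (hx.simplexNormal_ne_zero I)
  have h4 : |m| * ‖simplexNormal x I‖ = 1 := by
    rw [← hu1, hum, norm_smul, Real.norm_eq_abs]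
  have h5 : |m| = ‖simplexNormal x I‖⁻¹ := eq_inv_of_mul_eq_one_left h4
  rw [outerNormal, hum]
  congr 1
  rw [← h5]
  rcases (abs_eq (zero_le_one' ℝ)).1 hs with rfl | rfl
  · have : 0 < m := by
      by_contra hcon
      nlinarith
    rw [abs_of_pos this, one_mul]
  · have : m < 0 := by
      by_contra hcon
      nlinarith
    rw [abs_of_neg this]; ring

/-- The centre and each boundary point are unit vectors whose inner product is the signed distance
of the hyperplane. The boundary contains the vertices, so the infimum is not over the empty set. -/
lemma Generic.holeRadius_eq (hx : Generic x) (hN : d + 2 ≤ N) {s : ℝ} (hs : |s| = 1)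
    {I : Simplices d N} (hI : OneSided x s I) :
    holeRadius x (simplex x I) = √(2 - 2 * (s * ‖simplexNormal x I‖⁻¹)) := by
  rw [holeRadius, hx.holeCentre_eq hN hs hI]
  set u := outerNormal x s I with hu
  set t := s * ‖simplexNormal x I‖⁻¹ with ht
  have hu1 : ‖u‖ = 1 := (hx.isOuterNormal hs hI).1
  obtain ⟨i₀, hi₀⟩ : I.1.Nonempty := Finset.card_pos.1 (by rw [I.2]; omega)
  have hF : ∀ z ∈ simplex x I, inner ℝ u z = t := fun z hz =>
    inner_eq_of_mem_convexHull (fun i hi => (hx.inner_outerNormal_eq_iff hI i).2 hi) hz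
  have hi₀F : (x i₀ : Space d) ∈ simplex x I := (hx.mem_simplex_iff I i₀).2 hi₀
  have hdist : ∀ y ∈ holeBoundary (simplex x I), dist u y = √(2 - 2 * t) := by
    rintro y ⟨hy, hy1⟩
    have hy1' : ‖y‖ = 1 := by simpa using hy1
    have h0 : inner ℝ u (y - x i₀) = 0 := by
      refine inner_eq_zero_of_mem_vectorSpan hF ?_
      rw [← direction_affineSpan]
      exact AffineSubspace.vsub_mem_direction hy (subset_affineSpan ℝ _ hi₀F)
    have hyt : inner ℝ u y = t := by
      rw [inner_sub_right, hF _ hi₀F] at h0; linarith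
    rw [dist_eq_norm, ← Real.sqrt_sq (norm_nonneg (u - y)), norm_sub_sq_real, hu1, hy1', hyt]
    congr 1; ring
  have hne : (holeBoundary (simplex x I)).Nonempty :=
    ⟨x i₀, subset_affineSpan ℝ _ hi₀F, (x i₀).2⟩
  apply le_antisymm
  · obtain ⟨y, hy⟩ := hne
    rw [← hdist y hy]
    exact Metric.infDist_le_dist_of_mem hy
  · exact (Metric.le_infDist hne).2 fun y hy => (hdist y hy).ge

open Classical in
/-- The sum over the facets as a sum over simplices. -/
theorem Generic.holeRadiusSum_eq (hx : Generic x) (hd : 1 ≤ d) (hN : d + 2 ≤ N) (p : ℝ) :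
    holeRadiusSum p x = ∑ I : Simplices d N,
      ((if OneSided x 1 I then √(2 - 2 * ‖simplexNormal x I‖⁻¹) ^ p else 0) +
        if OneSided x (-1) I then √(2 - 2 * -‖simplexNormal x I‖⁻¹) ^ p else 0) := by
  have hfac : facets x = simplex x '' {I | OneSided x 1 I ∨ OneSided x (-1) I} := by
    ext F
    constructor
    · intro hF
      obtain ⟨I, hI, rfl⟩ := hx.exists_of_mem_facets hd hN hF
      exact ⟨I, hI, rfl⟩
    · rintro ⟨I, hI | hI, rfl⟩
      · exact hx.simplex_mem_facets (by simp) hI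
      · exact hx.simplex_mem_facets (by simp) hI
  rw [holeRadiusSum, hfac, finsum_mem_image hx.simplex_injective.injOn, finsum_mem_def,
    finsum_eq_sum_of_fintype]
  refine Finset.sum_congr rfl fun I _ => ?_
  obtain ⟨j, hj⟩ := exists_notMem_of_card hN I
  by_cases h1 : OneSided x 1 I
  · have h2 : ¬ OneSided x (-1) I := fun h2 => by
      have := h1 j hj
      have := h2 j hj
      linarith
    rw [Set.indicator_of_mem (show I ∈ {I | OneSided x 1 I ∨ OneSided x (-1) I} from Or.inl h1),
      if_pos h1, if_neg h2,
      hx.holeRadius_eq hN (by simp) h1, one_mul, add_zero]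
  · by_cases h2 : OneSided x (-1) I
    · rw [Set.indicator_of_mem (show I ∈ {I | OneSided x 1 I ∨ OneSided x (-1) I} from Or.inr h2),
        if_neg h1, if_pos h2,
        hx.holeRadius_eq hN (by simp) h2, zero_add, neg_one_mul]
    · rw [Set.indicator_of_notMem (fun h => h.elim h1 h2), if_neg h1, if_neg h2, add_zero]

end

/-! ### The expected sum over the facets -/

/-- The vertices of a simplex and the further points are independent. -/
lemma measurePreserving_split {d N : ℕ} (I : Simplices d N) :
    MeasurePreserving (fun θ : Fin N → Sph d =>
        ((fun k => θ (I.1.orderEmbOfFin I.2 k)), (fun i : {i // ¬ i ∈ I.1} => θ i)))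
      (Measure.pi fun _ => sigma d)
      ((Measure.pi fun _ : Fin (d + 1) => sigma d).prod
        (Measure.pi fun _ : {i // ¬ i ∈ I.1} => sigma d)) := by
  have h1 := measurePreserving_piEquivPiSubtypeProd (fun _ : Fin N => sigma d) (fun i => i ∈ I.1)
  rw [show Subtype.fintype (fun i => i ∈ I.1) = Finset.Subtype.fintype I.1 from
    Subsingleton.elim _ _] at h1
  have h2 := measurePreserving_piCongrLeft (fun _ : Fin (d + 1) => sigma d)
    (I.1.orderIsoOfFin I.2).symm.toEquiv
  have h3 := (h2.prod (MeasurePreserving.id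
    (Measure.pi fun _ : {i // ¬ i ∈ I.1} => sigma d))).comp h1
  convert h3 using 1
  funext θ
  refine Prod.ext (funext fun k => ?_) rfl
  obtain ⟨j, rfl⟩ := (I.1.orderIsoOfFin I.2).symm.surjective k
  have := MeasurableEquiv.piCongrLeft_apply_apply (β := fun _ : Fin (d + 1) => Sph d)
    (I.1.orderIsoOfFin I.2).symm.toEquiv (fun i : I.1 => θ i) j
  refine Eq.trans ?_ this.symm
  simp [← Finset.coe_orderIsoOfFin_apply]

/-- The distribution function of the height of a uniform point. -/
def capMass (d : ℕ) (t : ℝ) : ℝ := (sqLaw ((d : ℝ) / 2 - 1)).real (Set.Iio t)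

lemma sqLaw_Iio {d : ℕ} (hd : 1 ≤ d) (t : ℝ) :
    sqLaw ((d : ℝ) / 2 - 1) (Set.Iio t) = ENNReal.ofReal (capMass d t) := by
  have hd' : (1 : ℝ) ≤ d := by exact_mod_cast hd
  have := isProbabilityMeasure_sqLaw (q := (d : ℝ) / 2 - 1) (by linarith)
  rw [capMass, Measure.real, ENNReal.ofReal_toReal (measure_ne_top _ _)]

lemma capMass_nonneg (d : ℕ) (t : ℝ) : 0 ≤ capMass d t := measureReal_nonneg

lemma capMass_le_one {d : ℕ} (hd : 1 ≤ d) (t : ℝ) : capMass d t ≤ 1 := by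
  have hd' : (1 : ℝ) ≤ d := by exact_mod_cast hd
  have := isProbabilityMeasure_sqLaw (q := (d : ℝ) / 2 - 1) (by linarith)
  exact measureReal_le_one

lemma monotone_capMass {d : ℕ} (hd : 1 ≤ d) : Monotone (capMass d) := by
  have hd' : (1 : ℝ) ≤ d := by exact_mod_cast hd
  have := isProbabilityMeasure_sqLaw (q := (d : ℝ) / 2 - 1) (by linarith)
  intro a b hab
  exact measureReal_mono (Set.Iio_subset_Iio hab)

lemma sigma_oneSided {d : ℕ} (hd : 1 ≤ d) {v : Space d} (hv : v ≠ 0) {s : ℝ} (hs : |s| = 1) :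
    sigma d {z | s * inner ℝ v (z : Space d) < s} =
      ENNReal.ofReal (capMass d (s * ‖v‖⁻¹)) := by
  have hv' := norm_pos_iff.2 hv
  have h := map_inner_sigma hd ((s * ‖v‖⁻¹) • v) (by
    rw [norm_smul, norm_mul, norm_inv, norm_norm, Real.norm_eq_abs, hs]
    field_simp)
  rw [← sqLaw_Iio hd, ← h, Measure.map_apply (by fun_prop) measurableSet_Iio]
  congr 1
  ext z
  simp only [Set.mem_ofPred_eq, Set.mem_preimage, Set.mem_Iio, inner_smul_left]
  simp only [map_mul, conj_trivial]
  rw [mul_right_comm, mul_lt_mul_iff_left₀ (inv_pos.2 hv')]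

lemma measurable_simplexNormal {d N : ℕ} (I : Simplices d N) :
    Measurable fun θ : Fin N → Sph d => simplexNormal θ I := by
  refine measurable_normalVec.comp (measurable_pi_lambda _ fun k => ?_)
  unfold vertices
  fun_prop

/-- There are finitely many simplices. For each, the vertices are almost surely independent vectors,
and given them, every other point avoids a fixed hyperplane. -/
lemma ae_generic {d : ℕ} (hd : 1 ≤ d) (N : ℕ) :
    ∀ᵐ θ ∂(Measure.pi fun _ : Fin N => sigma d), Generic θ := by
  simp only [Generic]
  rw [Filter.eventually_all]
  intro I
  have hmp := measurePreserving_split I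
  have h1 : ∀ᵐ q ∂((Measure.pi fun _ : Fin (d + 1) => sigma d).prod
        (Measure.pi fun _ : {i // ¬ i ∈ I.1} => sigma d)),
      LinearIndependent ℝ fun i => (q.1 i : Space d) :=
    Measure.quasiMeasurePreserving_fst.ae (ae_linearIndependent_sigma hd)
  have h2 : ∀ᵐ q ∂((Measure.pi fun _ : Fin (d + 1) => sigma d).prod
        (Measure.pi fun _ : {i // ¬ i ∈ I.1} => sigma d)),
      ∀ j, inner ℝ (normalVec fun i => (q.1 i : Space d)) (q.2 j : Space d) ≠ 1 := by
    have hm : Measurable fun q : (Fin (d + 1) → Sph d) × ({i // ¬ i ∈ I.1} → Sph d) =>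
        normalVec fun i => (q.1 i : Space d) := measurable_normalVec.comp (by fun_prop)
    rw [ae_all_iff]
    intro j
    rw [Measure.ae_prod_iff_ae_ae]
    · filter_upwards [ae_linearIndependent_sigma hd] with y hy
      have h0 := sigma_inner_eq hd (normalVec_ne_zero (det_coordMatrix_ne_zero hy)) 1
      rw [← compl_compl {θ : Sph d | _}, ← mem_ae_iff] at h0
      exact (Measure.quasiMeasurePreserving_eval
        (fun _ : {i // ¬ i ∈ I.1} => sigma d) j).ae h0
    · exact (measurableSet_eq_fun (hm.inner (by fun_prop)) measurable_const).compl
  filter_upwards [hmp.quasiMeasurePreserving.ae h1, hmp.quasiMeasurePreserving.ae h2] with θ g1 g2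
  exact ⟨g1, fun j hj => g2 ⟨j, hj⟩⟩

-- Condition on the vertices: the other `N - (d + 1)` points are independent, and each is on the
-- side `s` with probability `capMass d (s * planeDist)`. The distance is then integrated by its
-- law.
open Classical in
lemma lintegral_oneSided {d N : ℕ} (hd : 1 ≤ d) (I : Simplices d N) {s : ℝ} (hs : |s| = 1)
    (g : ℝ → ℝ≥0∞) (hg : Measurable g) :
    ∫⁻ θ, (if OneSided θ s I then g (s * ‖simplexNormal θ I‖⁻¹) else 0)
        ∂(Measure.pi fun _ : Fin N => sigma d) =
      ∫⁻ t, g (s * |t|) * ENNReal.ofReal (capMass d (s * |t|)) ^ (N - (d + 1))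
        ∂sqLaw ((d : ℝ) ^ 2 / 2 - 1) := by
  have hmp := measurePreserving_split I
  have hnv : Measurable fun y : Fin (d + 1) → Sph d => normalVec fun i => (y i : Space d) :=
    measurable_normalVec.comp (by fun_prop)
  have hS : MeasurableSet {q : (Fin (d + 1) → Sph d) × ({i // ¬ i ∈ I.1} → Sph d) |
      ∀ j, s * inner ℝ (normalVec fun i => (q.1 i : Space d)) (q.2 j : Space d) < s} := by
    rw [Set.ofPred_forall]
    refine MeasurableSet.iInter fun j => measurableSet_lt ?_ measurable_const
    exact ((hnv.comp measurable_fst).inner (by fun_prop)).const_mul s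
  have hgm : Measurable fun y : Fin (d + 1) → Sph d =>
      g (s * planeDist fun i => (y i : Space d)) :=
    hg.comp (hnv.norm.inv.const_mul s)
  have hcm : Measurable fun t => ENNReal.ofReal (capMass d t) :=
    (monotone_capMass hd).measurable.ennreal_ofReal
  have hm : Measurable fun q : (Fin (d + 1) → Sph d) × ({i // ¬ i ∈ I.1} → Sph d) =>
      if ∀ j, s * inner ℝ (normalVec fun i => (q.1 i : Space d)) (q.2 j : Space d) < s
      then g (s * planeDist fun i => (q.1 i : Space d)) else 0 :=
    Measurable.ite hS (hgm.comp measurable_fst) measurable_const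
  have e1 : ∫⁻ θ, (if OneSided θ s I then g (s * ‖simplexNormal θ I‖⁻¹) else 0)
        ∂(Measure.pi fun _ : Fin N => sigma d) = ∫⁻ q,
      (if ∀ j, s * inner ℝ (normalVec fun i => (q.1 i : Space d)) (q.2 j : Space d) < s
      then g (s * planeDist fun i => (q.1 i : Space d)) else 0)
        ∂((Measure.pi fun _ : Fin (d + 1) => sigma d).prod
        (Measure.pi fun _ : {i // ¬ i ∈ I.1} => sigma d)) := by
    rw [← hmp.lintegral_comp hm]
    refine lintegral_congr fun θ => ?_
    refine if_congr ?_ rfl rfl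
    exact ⟨fun h j => h j.1 j.2, fun h j hj => h ⟨j, hj⟩⟩
  have hcard : Fintype.card {i // ¬ i ∈ I.1} = N - (d + 1) := by
    rw [Fintype.card_subtype_compl, Fintype.card_coe, I.2, Fintype.card_fin]
  rw [e1, lintegral_prod _ hm.aemeasurable]
  have e2 : ∀ᵐ y ∂(Measure.pi fun _ : Fin (d + 1) => sigma d),
      ∫⁻ z, (if ∀ j, s * inner ℝ (normalVec fun i => (y i : Space d)) (z j : Space d) < s
        then g (s * planeDist fun i => (y i : Space d)) else 0)
        ∂(Measure.pi fun _ : {i // ¬ i ∈ I.1} => sigma d) =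
      (fun t => g (s * t) * ENNReal.ofReal (capMass d (s * t)) ^ (N - (d + 1)))
        (planeDist fun i => (y i : Space d)) := by
    filter_upwards [ae_linearIndependent_sigma hd] with y hy
    have hv := normalVec_ne_zero (det_coordMatrix_ne_zero hy)
    set v := normalVec fun i => (y i : Space d) with hvdef
    have hset : MeasurableSet {z : {i // ¬ i ∈ I.1} → Sph d |
        ∀ j, s * inner ℝ v (z j : Space d) < s} := by
      rw [Set.ofPred_forall]
      refine MeasurableSet.iInter fun j => measurableSet_lt ?_ measurable_const
      exact (measurable_const.inner (by fun_prop)).const_mul s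
    have hpi : {z : {i // ¬ i ∈ I.1} → Sph d | ∀ j, s * inner ℝ v (z j : Space d) < s} =
        Set.univ.pi fun _ => {z : Sph d | s * inner ℝ v (z : Space d) < s} := by
      ext z; simp
    have hind : ∀ z : {i // ¬ i ∈ I.1} → Sph d,
        (if ∀ j, s * inner ℝ v (z j : Space d) < s
          then g (s * planeDist fun i => (y i : Space d)) else 0) =
        Set.indicator {z : {i // ¬ i ∈ I.1} → Sph d | ∀ j, s * inner ℝ v (z j : Space d) < s}
          (fun _ => g (s * planeDist fun i => (y i : Space d))) z := by
      intro z
      simp only [Set.indicator, Set.mem_ofPred_eq]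
    simp_rw [hind]
    rw [lintegral_indicator hset, lintegral_const, Measure.restrict_apply_univ, hpi,
      Measure.pi_pi, Finset.prod_const, Finset.card_univ, hcard, sigma_oneSided hd hv hs]
    rfl
  have hm2 : Measurable fun t => g (s * t) *
      ENNReal.ofReal (capMass d (s * t)) ^ (N - (d + 1)) := by
    have h1 := hcm.comp (measurable_const_mul s)
    have h2 := hg.comp (measurable_const_mul s)
    exact h2.mul (h1.pow_const _)
  have hpd : Measurable fun y : Fin (d + 1) → Sph d => planeDist fun i => (y i : Space d) :=
    hnv.norm.inv
  rw [lintegral_congr_ae e2, ← lintegral_map hm2 hpd, map_planeDist_sigma hd,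
    lintegral_map hm2 (show Measurable fun t : ℝ => |t| from measurable_norm)]

lemma lintegral_sqLaw_neg (q : ℝ) (g : ℝ → ℝ≥0∞) (hg : Measurable g) :
    ∫⁻ t, g (-t) ∂sqLaw q = ∫⁻ t, g t ∂sqLaw q := by
  rw [sqLaw, lintegral_smul_measure, lintegral_smul_measure]
  congr 1
  rw [lintegral_sqMeas _ _ hg, lintegral_sqMeas _ (fun t => g (-t)) (hg.comp measurable_neg),
    ← lintegral_indicator measurableSet_Ioo, ← lintegral_indicator measurableSet_Ioo,
    ← lintegral_neg_eq_self]
  refine lintegral_congr fun t => ?_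
  simp only [Set.indicator, Set.mem_Ioo, neg_neg, even_two, Even.neg_pow, neg_lt_neg_iff]
  refine if_congr ?_ rfl rfl
  constructor <;> rintro ⟨h1, h2⟩ <;> constructor <;> linarith

/-- The law is symmetric, so the contributions of the two sides of a hyperplane merge into one
integral over a signed distance. This is the factor `2` in `meanRadius`. -/
lemma lintegral_sqLaw_abs (q : ℝ) (g : ℝ → ℝ≥0∞) (hg : Measurable g) :
    ∫⁻ t, g |t| ∂sqLaw q + ∫⁻ t, g (-|t|) ∂sqLaw q = 2 * ∫⁻ t, g t ∂sqLaw q := by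
  have h : ∀ t : ℝ, g |t| + g (-|t|) = g t + g (-t) := by
    intro t
    rcases abs_choice t with h | h <;> rw [h]
    rw [neg_neg, add_comm]
  rw [← lintegral_add_left (show Measurable fun t : ℝ => g |t| from hg.comp measurable_norm)]
  simp_rw [h]
  rw [lintegral_add_left hg, lintegral_sqLaw_neg _ _ hg, two_mul]

/-- The expected sum of the `p`-th powers of the hole radii, as an integral. -/
def meanRadius (d : ℕ) (p : ℝ) (N : ℕ) : ℝ :=
  2 * (N.choose (d + 1) : ℝ) * ∫ t, √(2 - 2 * t) ^ p * capMass d t ^ (N - (d + 1))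
    ∂sqLaw ((d : ℝ) ^ 2 / 2 - 1)

lemma ae_sqLaw_mem (q : ℝ) : ∀ᵐ t ∂sqLaw q, t ∈ Set.Ioo (-1 : ℝ) 1 := by
  refine Measure.ae_smul_measure ?_ _
  exact (withDensity_absolutelyContinuous _ _).ae_le (ae_restrict_mem measurableSet_Ioo)

lemma integrable_meanRadius {d : ℕ} (hd : 1 ≤ d) {p : ℝ} (hp : 0 ≤ p) (k : ℕ) :
    Integrable (fun t => √(2 - 2 * t) ^ p * capMass d t ^ k) (sqLaw ((d : ℝ) ^ 2 / 2 - 1)) := by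
  have hd' : (1 : ℝ) ≤ d := by exact_mod_cast hd
  have := isProbabilityMeasure_sqLaw (q := (d : ℝ) ^ 2 / 2 - 1) (by nlinarith)
  have hm := (monotone_capMass hd).measurable
  refine Integrable.of_bound (by fun_prop) (2 ^ p) ?_
  filter_upwards [ae_sqLaw_mem _] with t ht
  rw [Real.norm_of_nonneg (mul_nonneg (Real.rpow_nonneg (Real.sqrt_nonneg _) _)
    (pow_nonneg (capMass_nonneg _ _) _)), ← mul_one ((2 : ℝ) ^ p)]
  refine mul_le_mul ?_ (pow_le_one₀ (capMass_nonneg _ _) (capMass_le_one hd t))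
    (pow_nonneg (capMass_nonneg _ _) _) (by positivity)
  refine Real.rpow_le_rpow (Real.sqrt_nonneg _) ?_ hp
  rw [Real.sqrt_le_left (by norm_num)]
  linarith [ht.1]

theorem hasUniformMean_holeRadiusSum {d N : ℕ} (hd : 1 ≤ d) (hN : d + 2 ≤ N) {p : ℝ}
    (hp : 0 ≤ p) :
    HasUniformMean.{u} (fun x : Fin N → Sph d => holeRadiusSum p x) (meanRadius d p N) := by
  classical
  intro Ω _ P _ X hX hind
  have hlaw : P.map (fun ω i => X i ω) = Measure.pi fun _ => sigma d := by
    rw [(iIndepFun_iff_map_fun_eq_pi_map fun i => (hX i).aemeasurable).1 hind]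
    congr 1
    funext i
    exact (hX i).map_eq
  have hXm : AEMeasurable (fun ω i => X i ω) P := aemeasurable_pi_lambda _ fun i =>
    (hX i).aemeasurable
  set g : ℝ → ℝ := fun t => √(2 - 2 * t) ^ p with hg
  have hg0 : ∀ t, 0 ≤ g t := fun t => Real.rpow_nonneg (Real.sqrt_nonneg _) _
  have hgm : Measurable g := by fun_prop
  set F : (Fin N → Sph d) → ℝ := fun θ => ∑ I : Simplices d N,
    ((if OneSided θ 1 I then g (1 * ‖simplexNormal θ I‖⁻¹) else 0) +
      if OneSided θ (-1) I then g (-1 * ‖simplexNormal θ I‖⁻¹) else 0) with hF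
  -- The measurability of `holeRadiusSum`, which involves an arbitrary choice of centres, is
  -- obtained only through this almost everywhere equality.
  have hae : (fun θ => holeRadiusSum p θ) =ᵐ[Measure.pi fun _ => sigma d] F := by
    filter_upwards [ae_generic hd N] with θ hθ
    rw [hθ.holeRadiusSum_eq hd hN p]
    simp only [hF, hg, one_mul, neg_one_mul]
  have hS : ∀ (s : ℝ) (I : Simplices d N), MeasurableSet {θ : Fin N → Sph d | OneSided θ s I} := by
    intro s I
    simp only [OneSided, Set.ofPred_forall]
    refine MeasurableSet.iInter fun j => MeasurableSet.iInter fun _ =>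
      measurableSet_lt ?_ measurable_const
    exact ((measurable_simplexNormal I).inner (by fun_prop)).const_mul s
  have hterm : ∀ (s : ℝ) (I : Simplices d N), Measurable fun θ : Fin N → Sph d =>
      if OneSided θ s I then g (s * ‖simplexNormal θ I‖⁻¹) else 0 := fun s I =>
    Measurable.ite (hS s I) (hgm.comp ((measurable_simplexNormal I).norm.inv.const_mul s))
      measurable_const
  have hFm : Measurable F := Finset.measurable_sum _ fun I _ => (hterm 1 I).add (hterm (-1) I)
  have hterm0 : ∀ (s : ℝ) (I : Simplices d N) (θ : Fin N → Sph d),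
      0 ≤ if OneSided θ s I then g (s * ‖simplexNormal θ I‖⁻¹) else 0 := by
    intro s I θ
    split_ifs
    exacts [hg0 _, le_rfl]
  have hF0 : ∀ θ, 0 ≤ F θ := fun θ => Finset.sum_nonneg fun I _ =>
    add_nonneg (hterm0 _ _ _) (hterm0 _ _ _)
  have hmono := monotone_capMass hd
  have hterml : ∀ (s : ℝ), |s| = 1 → ∀ I : Simplices d N,
      ∫⁻ θ, ENNReal.ofReal (if OneSided θ s I then g (s * ‖simplexNormal θ I‖⁻¹) else 0)
        ∂(Measure.pi fun _ : Fin N => sigma d) =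
      ∫⁻ t, (fun t => ENNReal.ofReal (g t * capMass d t ^ (N - (d + 1)))) (s * |t|)
        ∂sqLaw ((d : ℝ) ^ 2 / 2 - 1) := by
    intro s hs I
    have := lintegral_oneSided hd I hs (fun t => ENNReal.ofReal (g t)) (by fun_prop)
    convert this using 2
    · funext θ
      split_ifs <;> simp
    · funext t
      simp only
      rw [ENNReal.ofReal_mul (hg0 _), ENNReal.ofReal_pow (capMass_nonneg _ _)]
  have hFl : ∫⁻ θ, ENNReal.ofReal (F θ) ∂(Measure.pi fun _ : Fin N => sigma d) =
      ENNReal.ofReal (meanRadius d p N) := by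
    have hcm := hmono.measurable
    have h1 : ∀ θ, ENNReal.ofReal (F θ) = ∑ I : Simplices d N,
        (ENNReal.ofReal (if OneSided θ 1 I then g (1 * ‖simplexNormal θ I‖⁻¹) else 0) +
          ENNReal.ofReal
            (if OneSided θ (-1) I then g (-1 * ‖simplexNormal θ I‖⁻¹) else 0)) := by
      intro θ
      rw [hF, ENNReal.ofReal_sum_of_nonneg fun I _ => add_nonneg (hterm0 _ _ _) (hterm0 _ _ _)]
      exact Finset.sum_congr rfl fun I _ => ENNReal.ofReal_add (hterm0 _ _ _) (hterm0 _ _ _)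
    simp_rw [h1]
    refine (lintegral_finsetSum _ fun I _ => (hterm 1 I).ennreal_ofReal.add
      (hterm (-1) I).ennreal_ofReal).trans ?_
    have h2 : ∀ I : Simplices d N, ∫⁻ θ,
        (ENNReal.ofReal (if OneSided θ 1 I then g (1 * ‖simplexNormal θ I‖⁻¹) else 0) +
          ENNReal.ofReal (if OneSided θ (-1) I then g (-1 * ‖simplexNormal θ I‖⁻¹) else 0))
          ∂(Measure.pi fun _ : Fin N => sigma d) =
        2 * ∫⁻ t, ENNReal.ofReal (g t * capMass d t ^ (N - (d + 1)))
          ∂sqLaw ((d : ℝ) ^ 2 / 2 - 1) := by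
      intro I
      rw [lintegral_add_left (hterm 1 I).ennreal_ofReal, hterml 1 (by simp) I,
        hterml (-1) (by simp) I]
      simp only [one_mul, neg_one_mul]
      exact lintegral_sqLaw_abs _
        (fun t => ENNReal.ofReal (g t * capMass d t ^ (N - (d + 1)))) (by fun_prop)
    refine (Finset.sum_congr rfl fun I _ => h2 I).trans ?_
    rw [Finset.sum_const, Finset.card_univ,
      Fintype.card_finset_len, Fintype.card_fin, nsmul_eq_mul,
      ← ofReal_integral_eq_lintegral_ofReal (integrable_meanRadius hd hp _)
        (Eventually.of_forall fun t => mul_nonneg (hg0 _) (pow_nonneg (capMass_nonneg _ _) _)),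
      meanRadius, ENNReal.ofReal_mul (by positivity), ENNReal.ofReal_mul (by norm_num)]
    simp
    ring
  have hFint : Integrable F (Measure.pi fun _ : Fin N => sigma d) := by
    refine ⟨hFm.aestronglyMeasurable, ?_⟩
    rw [hasFiniteIntegral_iff_ofReal (Eventually.of_forall hF0), hFl]
    exact ENNReal.ofReal_lt_top
  have hmean0 : 0 ≤ meanRadius d p N := by
    refine mul_nonneg (by positivity) (integral_nonneg fun t => ?_)
    exact mul_nonneg (hg0 _) (pow_nonneg (capMass_nonneg _ _) _)
  have hint : Integrable (fun θ => holeRadiusSum p θ) (P.map fun ω i => X i ω) := by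
    rw [hlaw]
    exact hFint.congr hae.symm
  refine ⟨hint.comp_aemeasurable hXm, ?_⟩
  rw [← integral_map hXm hint.aestronglyMeasurable, hlaw, integral_congr_ae hae,
    integral_eq_lintegral_of_nonneg_ae (Eventually.of_forall hF0) hFm.aestronglyMeasurable, hFl,
    ENNReal.toReal_ofReal hmean0]

/-- Every summand is `1`, even for radius zero, because `0 ^ 0 = 1`. The count thus becomes the case
`p = 0`. -/
lemma facetCount_eq {d N : ℕ} (x : Fin N → Sph d) : facetCount x = holeRadiusSum 0 x := by
  simp only [facetCount, holeRadiusSum, Real.rpow_zero]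
  rw [finsum_mem_eq_finite_toFinset_sum _ (facets_finite x), Finset.sum_const, nsmul_eq_mul,
    mul_one, Set.ncard_eq_toFinset_card _ (facets_finite x)]

/-! ### The distribution function of `sqLaw` -/

lemma integrableOn_one_sub_sq_rpow {q : ℝ} (hq : -1 < q) :
    IntegrableOn (fun s : ℝ => (1 - s ^ 2) ^ q) (Set.Ioo (-1) 1) := by
  have h := sqMeas_univ hq
  rw [sqMeas, withDensity_apply _ MeasurableSet.univ, Measure.restrict_univ] at h
  refine ⟨(by fun_prop : Measurable fun s : ℝ => (1 - s ^ 2) ^ q).aestronglyMeasurable, ?_⟩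
  rw [hasFiniteIntegral_iff_ofReal, h]
  · exact ENNReal.ofReal_lt_top
  · filter_upwards [ae_restrict_mem measurableSet_Ioo] with s hs
    exact Real.rpow_nonneg (by nlinarith [hs.1, hs.2]) _

lemma integral_sqLaw {q : ℝ} (hq : -1 < q) (f : ℝ → ℝ) :
    ∫ t, f t ∂sqLaw q = (sqMass q)⁻¹ * ∫ t in Set.Ioo (-1 : ℝ) 1, (1 - t ^ 2) ^ q * f t := by
  rw [sqLaw, integral_smul_measure, ENNReal.toReal_inv, ENNReal.toReal_ofReal (sqMass_pos hq).le,
    smul_eq_mul, sqMeas, integral_withDensity_eq_integral_toReal_smul (by fun_prop)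
      (Eventually.of_forall fun _ => ENNReal.ofReal_lt_top)]
  congr 1
  refine setIntegral_congr_fun measurableSet_Ioo fun t ht => ?_
  rw [ENNReal.toReal_ofReal (Real.rpow_nonneg (by nlinarith [ht.1, ht.2]) _), smul_eq_mul]

lemma intervalIntegrable_one_sub_sq_rpow {q : ℝ} (hq : -1 < q) {a b : ℝ}
    (ha : a ∈ Set.Icc (-1 : ℝ) 1) (hb : b ∈ Set.Icc (-1 : ℝ) 1) :
    IntervalIntegrable (fun s : ℝ => (1 - s ^ 2) ^ q) volume a b := by
  have h : IntervalIntegrable (fun s : ℝ => (1 - s ^ 2) ^ q) volume (-1) 1 := by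
    rw [intervalIntegrable_iff_integrableOn_Ioo_of_le (by norm_num)]
    exact integrableOn_one_sub_sq_rpow hq
  refine h.mono_set ?_
  rw [Set.uIcc_of_le (by norm_num : (-1 : ℝ) ≤ 1)]
  exact Set.uIcc_subset_Icc ha hb

lemma sqLaw_real_Iio {q : ℝ} (hq : -1 < q) {t : ℝ} (ht : t ∈ Set.Icc (-1 : ℝ) 1) :
    (sqLaw q).real (Set.Iio t) = (sqMass q)⁻¹ * ∫ s in (-1)..t, (1 - s ^ 2) ^ q := by
  have h := integral_sqLaw hq (Set.indicator (Set.Iio t) 1)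
  rw [integral_indicator_one measurableSet_Iio] at h
  rw [h, intervalIntegral.integral_of_le ht.1, integral_Ioc_eq_integral_Ioo]
  congr 1
  have : (fun s : ℝ => (1 - s ^ 2) ^ q * Set.indicator (Set.Iio t) 1 s) =
      Set.indicator (Set.Iio t) fun s : ℝ => (1 - s ^ 2) ^ q := by
    funext s
    by_cases hs : s ∈ Set.Iio t <;> simp [hs]
  rw [this, setIntegral_indicator measurableSet_Iio]
  congr 2
  ext s
  simp only [Set.mem_inter_iff, Set.mem_Ioo, Set.mem_Iio]
  constructor
  · rintro ⟨⟨h1, _⟩, h3⟩; exact ⟨h1, h3⟩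
  · rintro ⟨h1, h3⟩; exact ⟨⟨h1, h3.trans_le ht.2⟩, h3⟩

lemma integral_one_sub_sq_rpow {q : ℝ} (hq : -1 < q) :
    ∫ s in (-1 : ℝ)..1, (1 - s ^ 2) ^ q = sqMass q := by
  have := isProbabilityMeasure_sqLaw hq
  have h := integral_sqLaw hq (fun _ => 1)
  simp only [integral_const, probReal_univ, smul_eq_mul, mul_one] at h
  rw [intervalIntegral.integral_of_le (by norm_num), integral_Ioc_eq_integral_Ioo]
  have := sqMass_pos hq
  field_simp at h
  linarith

/-- The probability integral transform. -/
lemma integral_comp_sqLaw {q : ℝ} (hq : -1 < q) {g : ℝ → ℝ} (hg : Continuous g) :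
    ∫ t, g ((sqLaw q).real (Set.Iio t)) ∂sqLaw q = ∫ u in (0 : ℝ)..1, g u := by
  have hZ := sqMass_pos hq
  set G : ℝ → ℝ := fun t => (sqMass q)⁻¹ * ∫ s in (-1)..t, (1 - s ^ 2) ^ q with hG
  have hint := intervalIntegrable_one_sub_sq_rpow hq (a := -1) (b := 1) (by simp) (by simp)
  have hle : (-1 : ℝ) ≤ 1 := by norm_num
  have hGc : ContinuousOn G (Set.uIcc (-1) 1) :=
    (intervalIntegral.continuousOn_primitive_interval' hint (by simp)).const_mul _ |>.congr
      fun t _ => rfl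
  have hG0 : G (-1) = 0 := by simp [hG]
  have hG1 : G 1 = 1 := by
    simp only [hG]
    rw [integral_one_sub_sq_rpow hq]
    field_simp
  have hderiv : ∀ t ∈ Set.Ioo (-1 : ℝ) 1,
      HasDerivAt G ((sqMass q)⁻¹ * (1 - t ^ 2) ^ q) t := by
    intro t ht
    have h1 : 0 < 1 - t ^ 2 := by nlinarith [ht.1, ht.2]
    have hc : ContinuousAt (fun s : ℝ => (1 - s ^ 2) ^ q) t := by
      refine ContinuousAt.rpow_const (by fun_prop) (Or.inl h1.ne')
    refine (intervalIntegral.integral_hasDerivAt_right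
      (intervalIntegrable_one_sub_sq_rpow hq (by simp) ⟨ht.1.le, ht.2.le⟩) ?_ hc).const_mul _
    exact (by fun_prop : Measurable fun s : ℝ => (1 - s ^ 2) ^ q).stronglyMeasurable
      |>.stronglyMeasurableAtFilter
  have hIcc : IsCompact (G '' Set.uIcc (-1) 1) := isCompact_uIcc.image_of_continuousOn hGc
  have hcont : ContinuousOn (g ∘ G) (Set.uIcc (-1) 1) := hg.comp_continuousOn hGc
  have hG2 : IntegrableOn (fun t => (g ∘ G) t * ((sqMass q)⁻¹ * (1 - t ^ 2) ^ q))
      (Set.uIcc (-1) 1) := by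
    have h2 : IntegrableOn (fun t : ℝ => (sqMass q)⁻¹ * (1 - t ^ 2) ^ q) (Set.uIcc (-1) 1) := by
      rw [Set.uIcc_of_le hle, integrableOn_Icc_iff_integrableOn_Ioo]
      exact (integrableOn_one_sub_sq_rpow hq).const_mul _
    exact h2.continuousOn_mul hcont isCompact_uIcc
  have key := intervalIntegral.integral_comp_mul_deriv''' (f := G) (g := g)
    (f' := fun t => (sqMass q)⁻¹ * (1 - t ^ 2) ^ q) hGc
    (fun t ht => by
      rw [min_eq_left hle, max_eq_right hle] at ht
      exact (hderiv t ht).hasDerivWithinAt) hg.continuousOn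
    (hg.continuousOn.integrableOn_compact hIcc) hG2
  rw [hG0, hG1] at key
  rw [← key, integral_sqLaw hq, ← integral_const_mul, intervalIntegral.integral_of_le hle,
    integral_Ioc_eq_integral_Ioo]
  refine setIntegral_congr_fun measurableSet_Ioo fun t ht => ?_
  simp only [Function.comp_apply, hG]
  rw [sqLaw_real_Iio hq ⟨ht.1.le, ht.2.le⟩]
  ring

/-- Passing from one exponent to another. -/
lemma integral_sqLaw_add {q b : ℝ} (hq : -1 < q) (hb : 0 ≤ b) (f : ℝ → ℝ) :
    ∫ t, f t ∂sqLaw (q + b) =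
      sqMass q / sqMass (q + b) * ∫ t, (1 - t ^ 2) ^ b * f t ∂sqLaw q := by
  have := sqMass_pos hq
  have := sqMass_pos (q := q + b) (by linarith)
  rw [integral_sqLaw hq, integral_sqLaw (by linarith), ← mul_assoc]
  congr 1
  · field_simp
  · refine setIntegral_congr_fun measurableSet_Ioo fun t ht => ?_
    have : 0 < 1 - t ^ 2 := by nlinarith [ht.1, ht.2]
    rw [Real.rpow_add this, mul_assoc]

lemma integral_beta {a b : ℝ} (ha : 0 < a) (hb : 0 < b) :
    ∫ u in (0 : ℝ)..1, u ^ (a - 1) * (1 - u) ^ (b - 1) = beta a b := by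
  have h := lintegral_betaPDF_eq_one ha hb
  have hB := beta_pos ha hb
  rw [lintegral_betaPDF] at h
  rw [intervalIntegral.integral_of_le zero_le_one, integral_Ioc_eq_integral_Ioo]
  have h2 : ∫ u in Set.Ioo (0 : ℝ) 1, 1 / beta a b * u ^ (a - 1) * (1 - u) ^ (b - 1) = 1 := by
    rw [integral_eq_lintegral_of_nonneg_ae, h, ENNReal.toReal_one]
    · filter_upwards [ae_restrict_mem measurableSet_Ioo] with u hu
      have : 0 < 1 - u := by linarith [hu.2]
      have := hu.1
      positivity
    · fun_prop
  simp_rw [mul_assoc] at h2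
  rw [integral_const_mul] at h2
  field_simp at h2
  linarith

/-! ### The normalizing constants -/

/-- Legendre's duplication formula. -/
lemma sqMass_eq {q : ℝ} (hq : -1 < q) :
    sqMass q = √Real.pi * Real.Gamma (q + 1) / Real.Gamma (q + 3 / 2) := by
  have h1 := Real.Gamma_pos_of_pos (s := q + 1) (by linarith)
  have h2 := Real.Gamma_pos_of_pos (s := q + 3 / 2) (by linarith)
  have h3 := Real.Gamma_pos_of_pos (s := 2 * (q + 1)) (by linarith)
  have hd := Real.Gamma_mul_Gamma_add_half (q + 1)
  have e1 : q + 1 + 1 / 2 = q + 3 / 2 := by ring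
  rw [e1] at hd
  have e2 : (2 : ℝ) ^ (1 - 2 * (q + 1)) * (2 * 4 ^ q) = 1 := by
    have : (4 : ℝ) ^ q = 2 ^ (2 * q) := by
      rw [Real.rpow_mul (by norm_num)]; norm_num
    rw [this, show 1 - 2 * (q + 1) = -(1 + 2 * q) by ring, Real.rpow_neg (by norm_num),
      Real.rpow_add (by norm_num), Real.rpow_one]
    exact inv_mul_cancel₀ (by positivity)
  rw [sqMass, beta, ← two_mul, eq_div_iff h2.ne']
  have : 2 * (4 ^ q * (Real.Gamma (q + 1) * Real.Gamma (q + 1) / Real.Gamma (2 * (q + 1)))) *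
      Real.Gamma (q + 3 / 2) = (2 * 4 ^ q) * Real.Gamma (q + 1) / Real.Gamma (2 * (q + 1)) *
      (Real.Gamma (q + 1) * Real.Gamma (q + 3 / 2)) := by ring
  rw [this, hd]
  field_simp
  linear_combination e2

/-- The quotient of consecutive sphere areas is the normalizing constant of the height density. The
cases `m = d` and `m = d ^ 2` translate the two laws into the constants of the theorem. -/
lemma kappa_eq {m : ℕ} (hm : 1 ≤ m) : kappa m = 1 / (m * sqMass ((m : ℝ) / 2 - 1)) := by
  have hm' : (1 : ℝ) ≤ m := by exact_mod_cast hm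
  rw [kappa, omega, omega, sqMass_eq (by linarith), Nat.cast_sub hm]
  have e1 : ((m : ℝ) - (1 : ℕ) + 1) / 2 = m / 2 := by push_cast; ring
  have e2 : (m : ℝ) / 2 - 1 + 1 = m / 2 := by ring
  have e3 : (m : ℝ) / 2 - 1 + 3 / 2 = (m + 1) / 2 := by ring
  have e4 : ((m : ℝ) + 1) / 2 = m / 2 + 1 / 2 := by ring
  rw [e1, e2, e3]
  have h1 := Real.Gamma_pos_of_pos (s := (m : ℝ) / 2) (by linarith)
  have h2 := Real.Gamma_pos_of_pos (s := ((m : ℝ) + 1) / 2) (by linarith)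
  have h3 : Real.pi ^ (((m : ℝ) + 1) / 2) = Real.pi ^ ((m : ℝ) / 2) * √Real.pi := by
    rw [e4, Real.rpow_add Real.pi_pos, Real.sqrt_eq_rpow]
  rw [h3]
  have h4 := Real.rpow_pos_of_pos Real.pi_pos ((m : ℝ) / 2)
  have h5 := Real.sqrt_pos.2 Real.pi_pos
  field_simp

/-! ### Comparison of the integrand with a power of the cap measure -/

lemma exists_abs_rpow_sub_one_le (a : ℝ) {c C : ℝ} (hc : 0 < c) (hc1 : c ≤ 1) (hC : 1 ≤ C) :
    ∃ L, 0 ≤ L ∧ ∀ x ∈ Set.Icc c C, |x ^ a - 1| ≤ L * |x - 1| := by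
  have hcont : ContinuousOn (fun x : ℝ => a * x ^ (a - 1)) (Set.Icc c C) :=
    ContinuousOn.mul continuousOn_const fun x hx =>
      (Real.continuousAt_rpow_const x _ (Or.inl (hc.trans_le hx.1).ne')).continuousWithinAt
  obtain ⟨L, hL⟩ := isCompact_Icc.exists_bound_of_continuousOn hcont
  have h1 : (1 : ℝ) ∈ Set.Icc c C := ⟨hc1, hC⟩
  refine ⟨L, (norm_nonneg _).trans (hL 1 h1), fun x hx => ?_⟩
  have := (convex_Icc c C).norm_image_sub_le_of_norm_hasDerivWithin_le
    (f := fun x : ℝ => x ^ a) (fun y hy =>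
      (Real.hasDerivAt_rpow_const (Or.inl (hc.trans_le hy.1).ne')).hasDerivWithinAt) hL h1 hx
  simpa using this

/-- Near `1`, the distribution function of `sqLaw q` is close to `1` minus a power. -/
lemma exists_one_sub_sqLaw_real_Iio {q : ℝ} (hq : -1 < q) :
    ∃ c C L : ℝ, 0 < c ∧ c ≤ 1 ∧ 1 ≤ C ∧ 0 ≤ L ∧ ∀ t ∈ Set.Ico (0 : ℝ) 1, ∃ R ∈ Set.Icc c C,
      |R - 1| ≤ L * (1 - t) ∧ 1 - (sqLaw q).real (Set.Iio t) =
        (sqMass q)⁻¹ * (2 ^ q * ((1 - t) ^ (q + 1) / (q + 1))) * R := by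
  obtain ⟨L, hL0, hL⟩ := exists_abs_rpow_sub_one_le q (c := 1 / 2) (C := 1) (by norm_num)
    (by norm_num) le_rfl
  -- The sign of `q` is not fixed, so the bounds `c` and `C` are extreme values on a compact
  -- interval rather than values at its ends.
  have hcont : ContinuousOn (fun x : ℝ => x ^ q) (Set.Icc (1 / 2) 1) := fun x hx =>
    (Real.continuousAt_rpow_const x _ (Or.inl (by linarith [hx.1]))).continuousWithinAt
  obtain ⟨C, hC⟩ := isCompact_Icc.exists_bound_of_continuousOn hcont
  have h1 : (1 : ℝ) ∈ Set.Icc (1 / 2 : ℝ) 1 := by norm_num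
  have hC1 : 1 ≤ C := by simpa using hC 1 h1
  obtain ⟨x₀, hx₀, hmin⟩ := isCompact_Icc.exists_isMinOn ⟨1, h1⟩ hcont
  have hc0 : 0 < x₀ ^ q := Real.rpow_pos_of_pos (by linarith [hx₀.1]) _
  refine ⟨x₀ ^ q, C, L / 2, hc0, ?_, hC1, by positivity, fun t ht => ?_⟩
  · simpa using hmin h1
  have hZ := sqMass_pos hq
  have hz : 0 < 1 - t := by linarith [ht.2]
  set J := 2 ^ q * ((1 - t) ^ (q + 1) / (q + 1)) with hJ
  have hJ0 : 0 < J := by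
    have : 0 < q + 1 := by linarith
    positivity
  have hpow : IntervalIntegrable (fun s : ℝ => (1 - s) ^ q) volume t 1 := by
    have := (intervalIntegral.intervalIntegrable_rpow' (a := 1 - t) (b := 0) hq).comp_sub_left 1
    simpa using this
  have hJint : ∫ s in t..1, 2 ^ q * (1 - s) ^ q = J := by
    rw [intervalIntegral.integral_const_mul, hJ,
      intervalIntegral.integral_comp_sub_left (fun x : ℝ => x ^ q) 1, sub_self,
      integral_rpow (Or.inl hq), Real.zero_rpow (by linarith), sub_zero]
  have hint := intervalIntegrable_one_sub_sq_rpow hq (a := t) (b := 1)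
    ⟨by linarith [ht.1], ht.2.le⟩ (by simp)
  have hW : 1 - (sqLaw q).real (Set.Iio t) = (sqMass q)⁻¹ * ∫ s in t..1, (1 - s ^ 2) ^ q := by
    rw [sqLaw_real_Iio hq ⟨by linarith [ht.1], ht.2.le⟩]
    have h := intervalIntegral.integral_add_adjacent_intervals
      (intervalIntegrable_one_sub_sq_rpow hq (a := -1) (b := t) (by simp)
        ⟨by linarith [ht.1], ht.2.le⟩) hint
    rw [integral_one_sub_sq_rpow hq] at h
    field_simp
    linarith
  -- The first two factors integrate explicitly to `J`; the last is within `O(1 - t)` of `1`. The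
  -- witness `R` is its weighted mean and inherits its bounds.
  have hfac : ∀ s ∈ Set.Ioo t 1, (1 - s ^ 2) ^ q = 2 ^ q * (1 - s) ^ q * ((1 + s) / 2) ^ q := by
    intro s hs
    have h1 : 0 < 1 - s := by linarith [hs.2]
    have h2 : 0 < 1 + s := by linarith [hs.1, ht.1]
    rw [← Real.mul_rpow (by norm_num) h1.le, ← Real.mul_rpow (by positivity) (by positivity)]
    congr 1
    ring
  have hmem : ∀ s ∈ Set.Ioo t 1, (1 + s) / 2 ∈ Set.Icc (1 / 2 : ℝ) 1 := fun s hs =>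
    ⟨by linarith [hs.1, ht.1], by linarith [hs.2]⟩
  have hup : ∀ B, (∀ s ∈ Set.Ioo t 1, ((1 + s) / 2) ^ q ≤ B) →
      ∫ s in t..1, (1 - s ^ 2) ^ q ≤ B * J := by
    intro B hB
    rw [← hJint, ← intervalIntegral.integral_const_mul]
    refine intervalIntegral.integral_mono_on_of_le_Ioo ht.2.le hint
      ((hpow.const_mul _).const_mul _) fun s hs => ?_
    rw [hfac s hs, mul_comm B]
    have h1 : 0 < 1 - s := by linarith [hs.2]
    exact mul_le_mul_of_nonneg_left (hB s hs) (by positivity)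
  have hlow : ∀ A, (∀ s ∈ Set.Ioo t 1, A ≤ ((1 + s) / 2) ^ q) →
      A * J ≤ ∫ s in t..1, (1 - s ^ 2) ^ q := by
    intro A hA
    rw [← hJint, ← intervalIntegral.integral_const_mul]
    refine intervalIntegral.integral_mono_on_of_le_Ioo ht.2.le
      ((hpow.const_mul _).const_mul _) hint fun s hs => ?_
    rw [hfac s hs, mul_comm A]
    have h1 : 0 < 1 - s := by linarith [hs.2]
    exact mul_le_mul_of_nonneg_left (hA s hs) (by positivity)
  have hdist : ∀ s ∈ Set.Ioo t 1, |((1 + s) / 2) ^ q - 1| ≤ L / 2 * (1 - t) := by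
    intro s hs
    refine (hL _ (hmem s hs)).trans ?_
    have : |(1 + s) / 2 - 1| = (1 - s) / 2 := by
      rw [abs_of_nonpos (by linarith [hs.2])]; ring
    rw [this]
    nlinarith [hs.1]
  refine ⟨(∫ s in t..1, (1 - s ^ 2) ^ q) / J, ⟨?_, ?_⟩, ?_, ?_⟩
  · rw [le_div_iff₀ hJ0]
    exact hlow _ fun s hs => hmin (hmem s hs)
  · rw [div_le_iff₀ hJ0]
    exact hup _ fun s hs => (le_abs_self _).trans (hC _ (hmem s hs))
  · have h2 := hup (1 + L / 2 * (1 - t)) fun s hs => by linarith [(abs_le.1 (hdist s hs)).2]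
    have h3 := hlow (1 - L / 2 * (1 - t)) fun s hs => by linarith [(abs_le.1 (hdist s hs)).1]
    rw [← div_le_iff₀ hJ0] at h2
    rw [← le_div_iff₀ hJ0] at h3
    rw [abs_le]
    constructor <;> linarith
  · rw [hW]
    field_simp

/-- Here `2 - 2t = ρ²` is the squared hole radius, so this says that the empty cap has mass `κ ρ^d`
up to a relative error `O(ρ²)`. -/
lemma exists_one_sub_capMass {d : ℕ} (hd : 1 ≤ d) :
    ∃ c C L : ℝ, 0 < c ∧ c ≤ 1 ∧ 1 ≤ C ∧ 0 ≤ L ∧ ∀ t ∈ Set.Ico (0 : ℝ) 1, ∃ R ∈ Set.Icc c C,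
      |R - 1| ≤ L * (2 - 2 * t) ∧
        1 - capMass d t = kappa d * (2 - 2 * t) ^ ((d : ℝ) / 2) * R := by
  have hd' : (1 : ℝ) ≤ d := by exact_mod_cast hd
  obtain ⟨c, C, L, hc, hc1, hC, hL, h⟩ :=
    exists_one_sub_sqLaw_real_Iio (q := (d : ℝ) / 2 - 1) (by linarith)
  refine ⟨c, C, L, hc, hc1, hC, hL, fun t ht => ?_⟩
  obtain ⟨R, hR, hR1, hR2⟩ := h t ht
  refine ⟨R, hR, hR1.trans (by nlinarith [ht.2]), ?_⟩
  have hz : 0 < 1 - t := by linarith [ht.2]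
  have hZ := sqMass_pos (q := (d : ℝ) / 2 - 1) (by linarith)
  rw [capMass, hR2, kappa_eq hd, show 2 - 2 * t = 2 * (1 - t) by ring,
    Real.mul_rpow (by norm_num) hz.le, show (d : ℝ) / 2 - 1 + 1 = d / 2 by ring,
    Real.rpow_sub_one (by norm_num)]
  field_simp

lemma kappa_pos {m : ℕ} (hm : 1 ≤ m) : 0 < kappa m := by
  have hm' : (1 : ℝ) ≤ m := by exact_mod_cast hm
  have := sqMass_pos (q := (m : ℝ) / 2 - 1) (by linarith)
  rw [kappa_eq hm]
  positivity

/-- Put `y = 2 - 2t`, so `1 - t² = y(1 - y/4)`, and `b = (d² - d)/2`. For `t ≥ 0` the first term is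
`y^(b + p/2) (1 - y/4)^b`. The exponent `a = d - 1 + p/d` is chosen so that `(d/2)a = b + p/2`,
whence the second term is `y^(b + p/2) R^a`. Both last factors are `1 + O(y)`, and one more power of
`y` corresponds to `2/d` more powers of the cap mass. For `t < 0` the cap mass is bounded below and
boundedness suffices. -/
lemma exists_abs_integrand_sub_le {d : ℕ} (hd : 1 ≤ d) {p : ℝ} (hp : 0 ≤ p) :
    ∃ M, 0 ≤ M ∧ ∀ t ∈ Set.Ioo (-1 : ℝ) 1,
      |(1 - t ^ 2) ^ (((d : ℝ) ^ 2 - d) / 2) * √(2 - 2 * t) ^ p -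
          kappa d ^ (-((d : ℝ) - 1 + p / d)) * (1 - capMass d t) ^ ((d : ℝ) - 1 + p / d)| ≤
        M * (1 - capMass d t) ^ ((d : ℝ) - 1 + p / d + 2 / d) := by
  have hd' : (1 : ℝ) ≤ d := by exact_mod_cast hd
  have hd0 : (0 : ℝ) < d := by linarith
  obtain ⟨c, C, L, hc, hc1, hC, hL, h⟩ := exists_one_sub_capMass hd
  set b := ((d : ℝ) ^ 2 - d) / 2 with hb
  set a := (d : ℝ) - 1 + p / d with ha
  have ha0 : 0 ≤ a := by
    have : 0 ≤ p / d := by positivity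
    rw [ha]; linarith
  have hb0 : 0 ≤ b := by rw [hb]; nlinarith
  have hab : (d : ℝ) / 2 * a = b + p / 2 := by rw [ha, hb]; field_simp
  have hab2 : (d : ℝ) / 2 * (a + 2 / d) = b + p / 2 + 1 := by rw [mul_add, hab]; field_simp
  have hκ := kappa_pos hd
  obtain ⟨L₁, hL₁, h₁⟩ := exists_abs_rpow_sub_one_le b (c := 1 / 2) (C := 1) (by norm_num)
    (by norm_num) le_rfl
  obtain ⟨L₂, hL₂, h₂⟩ := exists_abs_rpow_sub_one_le a hc hc1 hC
  have he0 : 0 ≤ a + 2 / d := by positivity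
  -- the constant on `[0, 1)`
  set M₁ := (L₁ + L₂ * L) / (kappa d ^ (a + 2 / d) * c ^ (a + 2 / d)) with hM₁
  have hM₁0 : 0 ≤ M₁ := by positivity
  -- the constant on `(-1, 0)`
  obtain ⟨R₀, hR₀, -, hW₀⟩ := h 0 (by simp)
  have hw : 0 < 1 - capMass d 0 := by
    rw [hW₀]
    have : 0 < R₀ := hc.trans_le hR₀.1
    positivity
  set M₂ := (2 ^ p + kappa d ^ (-a)) / (1 - capMass d 0) ^ (a + 2 / d) with hM₂
  have hM₂0 : 0 ≤ M₂ := by positivity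
  refine ⟨M₁ + M₂, by positivity, fun t ht => ?_⟩
  rcases le_or_gt 0 t with h0 | h0
  · obtain ⟨R, hR, hR1, hW⟩ := h t ⟨h0, ht.2⟩
    rw [hW]
    set y := 2 - 2 * t with hy
    have hy0 : 0 < y := by linarith [ht.2]
    have hRp : 0 < R := hc.trans_le hR.1
    have e1 : (1 - t ^ 2) ^ b * √y ^ p = y ^ (b + p / 2) * (1 - y / 4) ^ b := by
      have : 1 - t ^ 2 = y * (1 - y / 4) := by rw [hy]; ring
      rw [this, Real.mul_rpow hy0.le (by linarith), Real.rpow_add hy0, Real.sqrt_eq_rpow,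
        ← Real.rpow_mul hy0.le]
      ring_nf
    have e2 : kappa d ^ (-a) * (kappa d * y ^ ((d : ℝ) / 2) * R) ^ a =
        y ^ (b + p / 2) * R ^ a := by
      rw [Real.mul_rpow (by positivity) hRp.le, Real.mul_rpow hκ.le (by positivity),
        ← Real.rpow_mul hy0.le, hab, Real.rpow_neg hκ.le]
      have := Real.rpow_pos_of_pos hκ a
      field_simp
    have e3 : (kappa d * y ^ ((d : ℝ) / 2) * R) ^ (a + 2 / d) =
        kappa d ^ (a + 2 / d) * (y ^ (b + p / 2) * y) * R ^ (a + 2 / d) := by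
      rw [Real.mul_rpow (by positivity) hRp.le, Real.mul_rpow hκ.le (by positivity),
        ← Real.rpow_mul hy0.le, hab2, Real.rpow_add_one hy0.ne']
    rw [e1, e2, e3, ← mul_sub, abs_mul, abs_of_pos (by positivity : 0 < y ^ (b + p / 2))]
    have hd1 : |(1 - y / 4) ^ b - R ^ a| ≤ (L₁ + L₂ * L) * y := by
      have h3 := h₁ (1 - y / 4) ⟨by linarith, by linarith⟩
      have h4 := h₂ R hR
      have h5 : |1 - y / 4 - 1| ≤ y := by
        rw [abs_of_nonpos (by linarith)]; linarith
      have h6 : |(1 - y / 4) ^ b - R ^ a| ≤ |(1 - y / 4) ^ b - 1| + |R ^ a - 1| := by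
        have := abs_sub_le ((1 - y / 4) ^ b) 1 (R ^ a)
        rwa [abs_sub_comm 1] at this
      calc _ ≤ _ := h6
        _ ≤ L₁ * y + L₂ * (L * y) := add_le_add
            (h3.trans (mul_le_mul_of_nonneg_left h5 hL₁))
            (h4.trans (mul_le_mul_of_nonneg_left hR1 hL₂))
        _ = _ := by ring
    have hRe : c ^ (a + 2 / d) ≤ R ^ (a + 2 / d) := Real.rpow_le_rpow hc.le hR.1 he0
    calc y ^ (b + p / 2) * |(1 - y / 4) ^ b - R ^ a|
        ≤ y ^ (b + p / 2) * ((L₁ + L₂ * L) * y) :=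
          mul_le_mul_of_nonneg_left hd1 (by positivity)
      _ = M₁ * (kappa d ^ (a + 2 / d) * (y ^ (b + p / 2) * y) * c ^ (a + 2 / d)) := by
          rw [hM₁]; field_simp
      _ ≤ (M₁ + M₂) * (kappa d ^ (a + 2 / d) * (y ^ (b + p / 2) * y) * R ^ (a + 2 / d)) := by
          gcongr
          linarith
  · have hmono : 1 - capMass d 0 ≤ 1 - capMass d t := by
      have := monotone_capMass hd h0.le
      linarith
    have hW1 : 1 - capMass d t ≤ 1 := by linarith [capMass_nonneg d t]
    have hW0 : 0 ≤ 1 - capMass d t := by linarith [capMass_le_one hd t]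
    have h3 : |(1 - t ^ 2) ^ b * √(2 - 2 * t) ^ p| ≤ 2 ^ p := by
      have h4 : 0 ≤ 1 - t ^ 2 := by nlinarith [ht.1, ht.2]
      have h5 : √(2 - 2 * t) ≤ 2 := by
        rw [Real.sqrt_le_left (by norm_num)]; linarith [ht.1]
      rw [abs_of_nonneg (by positivity)]
      calc _ ≤ 1 * (2 : ℝ) ^ p := mul_le_mul (Real.rpow_le_one h4 (by nlinarith) hb0)
            (Real.rpow_le_rpow (by positivity) h5 hp) (by positivity) zero_le_one
        _ = _ := one_mul _
    have h6 : |kappa d ^ (-a) * (1 - capMass d t) ^ a| ≤ kappa d ^ (-a) := by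
      rw [abs_of_nonneg (by positivity)]
      exact mul_le_of_le_one_right (by positivity) (Real.rpow_le_one hW0 hW1 ha0)
    calc _ ≤ 2 ^ p + kappa d ^ (-a) := (abs_sub _ _).trans (add_le_add h3 h6)
      _ = M₂ * (1 - capMass d 0) ^ (a + 2 / d) := by rw [hM₂]; field_simp
      _ ≤ (M₁ + M₂) * (1 - capMass d t) ^ (a + 2 / d) := by
          gcongr
          linarith

/-! ### The leading term of the expected sum -/

/-- `capMass d` is the distribution function of this very law, hence uniform on `[0, 1]` under it.
-/
lemma integral_rpow_one_sub_capMass {d : ℕ} (hd : 1 ≤ d) {e : ℝ} (he : 0 ≤ e) (k : ℕ) :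
    ∫ t, (1 - capMass d t) ^ e * capMass d t ^ k ∂sqLaw ((d : ℝ) / 2 - 1) =
      beta ((k : ℝ) + 1) (e + 1) := by
  have hd' : (1 : ℝ) ≤ d := by exact_mod_cast hd
  have hc : Continuous fun u : ℝ => (1 - u) ^ e * u ^ k :=
    ((Real.continuous_rpow_const he).comp (by fun_prop)).mul (by fun_prop)
  have h := integral_comp_sqLaw (q := (d : ℝ) / 2 - 1) (by linarith) hc
  simp only [capMass]
  rw [h, ← integral_beta (by positivity) (by positivity)]
  refine intervalIntegral.integral_congr fun u _ => ?_
  simp only [add_sub_cancel_right, Real.rpow_natCast]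
  ring

lemma integrable_rpow_one_sub_capMass {d : ℕ} (hd : 1 ≤ d) {e : ℝ} (he : 0 ≤ e) (k : ℕ) :
    Integrable (fun t => (1 - capMass d t) ^ e * capMass d t ^ k) (sqLaw ((d : ℝ) / 2 - 1)) := by
  have hd' : (1 : ℝ) ≤ d := by exact_mod_cast hd
  have := isProbabilityMeasure_sqLaw (q := (d : ℝ) / 2 - 1) (by linarith)
  have hm := (monotone_capMass hd).measurable
  refine Integrable.of_bound (by fun_prop) 1 (Eventually.of_forall fun t => ?_)
  have h0 := capMass_nonneg d t
  have h1 := capMass_le_one hd t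
  have h2 : 0 ≤ 1 - capMass d t := by linarith
  rw [Real.norm_of_nonneg (by positivity)]
  exact mul_le_one₀ (Real.rpow_le_one h2 (by linarith) he) (by positivity) (pow_le_one₀ h0 h1)

lemma integrable_integrand {d : ℕ} (hd : 1 ≤ d) {p : ℝ} (hp : 0 ≤ p) (k : ℕ) :
    Integrable (fun t => (1 - t ^ 2) ^ (((d : ℝ) ^ 2 - d) / 2) *
      (√(2 - 2 * t) ^ p * capMass d t ^ k)) (sqLaw ((d : ℝ) / 2 - 1)) := by
  have hd' : (1 : ℝ) ≤ d := by exact_mod_cast hd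
  have := isProbabilityMeasure_sqLaw (q := (d : ℝ) / 2 - 1) (by linarith)
  have hm := (monotone_capMass hd).measurable
  refine Integrable.of_bound (by fun_prop) (1 * (2 ^ p * 1)) ?_
  filter_upwards [ae_sqLaw_mem _] with t ht
  have h0 := capMass_nonneg d t
  have h1 := capMass_le_one hd t
  have h2 : 0 ≤ 1 - t ^ 2 := by nlinarith [ht.1, ht.2]
  have h5 : √(2 - 2 * t) ≤ 2 := by
    rw [Real.sqrt_le_left (by norm_num)]; linarith [ht.1]
  rw [Real.norm_of_nonneg (by positivity)]
  exact mul_le_mul (Real.rpow_le_one h2 (by nlinarith) (by nlinarith))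
    (mul_le_mul (Real.rpow_le_rpow (by positivity) h5 hp) (pow_le_one₀ h0 h1) (by positivity)
      (by positivity)) (by positivity) zero_le_one

/-- Changes the law of the hyperplane distance into the law of one height, for which `capMass d` is
uniform; the weight is the quotient of the densities. -/
lemma meanRadius_eq {d : ℕ} (hd : 1 ≤ d) (p : ℝ) (N : ℕ) :
    meanRadius d p N = 2 * (N.choose (d + 1) : ℝ) *
      (d * kappa (d ^ 2) / kappa d * ∫ t, (1 - t ^ 2) ^ (((d : ℝ) ^ 2 - d) / 2) *
        (√(2 - 2 * t) ^ p * capMass d t ^ (N - (d + 1))) ∂sqLaw ((d : ℝ) / 2 - 1)) := by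
  have hd' : (1 : ℝ) ≤ d := by exact_mod_cast hd
  have hq : -1 < (d : ℝ) / 2 - 1 := by linarith
  have hq2 : -1 < (d : ℝ) ^ 2 / 2 - 1 := by nlinarith
  have h1 := sqMass_pos hq
  have h2 := sqMass_pos hq2
  have e : (d : ℝ) ^ 2 / 2 - 1 = d / 2 - 1 + ((d : ℝ) ^ 2 - d) / 2 := by ring
  have e2 : (d : ℝ) * kappa (d ^ 2) / kappa d =
      sqMass ((d : ℝ) / 2 - 1) / sqMass ((d : ℝ) ^ 2 / 2 - 1) := by
    rw [kappa_eq hd, kappa_eq (Nat.one_le_pow _ _ hd)]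
    push_cast
    field_simp
  rw [meanRadius, e2]
  congr 1
  rw [e]
  exact integral_sqLaw_add hq (by nlinarith) _

/-- The main term of the expected sum of the `p`-th powers of the hole radii. -/
def meanMain (d : ℕ) (p : ℝ) (N : ℕ) : ℝ :=
  facetConst d * kappa d ^ (-(p / d)) *
    (Real.Gamma (d + p / d) * Real.Gamma (N + 1) / (Real.Gamma d * Real.Gamma (N + p / d)))

lemma facetConst_pos {d : ℕ} (hd : 1 ≤ d) : 0 < facetConst d := by
  have := kappa_pos hd
  have := kappa_pos (Nat.one_le_pow 2 _ hd)
  rw [facetConst]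
  positivity

lemma meanMain_pos {d : ℕ} (hd : 1 ≤ d) {p : ℝ} (hp : 0 ≤ p) {N : ℕ} (hN : 1 ≤ N) :
    0 < meanMain d p N := by
  have hd' : (1 : ℝ) ≤ d := by exact_mod_cast hd
  have hN' : (1 : ℝ) ≤ N := by exact_mod_cast hN
  have := kappa_pos hd
  have := facetConst_pos hd
  have hpd : 0 ≤ p / d := by positivity
  have h1 := Real.Gamma_pos_of_pos (s := d + p / d) (by linarith)
  have h2 := Real.Gamma_pos_of_pos (s := N + 1) (by linarith)
  have h3 := Real.Gamma_pos_of_pos (s := (d : ℝ)) (by linarith)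
  have h4 := Real.Gamma_pos_of_pos (s := N + p / d) (by linarith)
  rw [meanMain]
  positivity

/-- The main term is exactly what the integral gives when its integrand is replaced by the
comparison power of the cap mass. -/
lemma meanMain_eq {d : ℕ} (hd : 1 ≤ d) {p : ℝ} (hp : 0 ≤ p) {N : ℕ} (hN : d + 2 ≤ N) :
    meanMain d p N = 2 * (N.choose (d + 1) : ℝ) * (d * kappa (d ^ 2) / kappa d *
      (kappa d ^ (-((d : ℝ) - 1 + p / d)) *
        beta (((N - (d + 1) : ℕ) : ℝ) + 1) ((d : ℝ) - 1 + p / d + 1))) := by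
  have hd' : (1 : ℝ) ≤ d := by exact_mod_cast hd
  have hκ := kappa_pos hd
  have hN1 : d + 1 ≤ N := by omega
  have hN' : (d : ℝ) + 2 ≤ N := by exact_mod_cast hN
  have hpd : 0 ≤ p / d := by positivity
  have e1 : ((N - (d + 1) : ℕ) : ℝ) + 1 = N - d := by rw [Nat.cast_sub hN1]; push_cast; ring
  have e2 : (d : ℝ) - 1 + p / d + 1 = d + p / d := by ring
  have e3 : (N : ℝ) - d + (d + p / d) = N + p / d := by ring
  have e4 : kappa d ^ (-((d : ℝ) - 1 + p / d)) = kappa d ^ (-(p / d)) * kappa d / kappa d ^ d := by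
    rw [show -((d : ℝ) - 1 + p / d) = -(p / d) + 1 - d by ring, Real.rpow_sub hκ,
      Real.rpow_add_one hκ.ne', Real.rpow_natCast]
  have e5 : (N.choose (d + 1) : ℝ) =
      Real.Gamma (N + 1) / (((d : ℝ) + 1) * d * Real.Gamma d * Real.Gamma (N - d)) := by
    have h6 : Real.Gamma ((N : ℝ) - d) = ((N - (d + 1)).factorial : ℝ) := by
      rw [← e1, Real.Gamma_nat_eq_factorial]
    have h7 : ((d : ℝ) + 1) * d * Real.Gamma d = ((d + 1).factorial : ℝ) := by
      rw [mul_assoc, ← Real.Gamma_add_one (by linarith), Real.Gamma_nat_eq_factorial,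
        Nat.factorial_succ]
      push_cast; ring
    rw [h6, h7, Real.Gamma_nat_eq_factorial, Nat.cast_choose ℝ hN1]
  have h1 := Real.Gamma_pos_of_pos (s := d + p / d) (by linarith)
  have h3 := Real.Gamma_pos_of_pos (s := (d : ℝ)) (by linarith)
  have h4 := Real.Gamma_pos_of_pos (s := N + p / d) (by linarith)
  have h5 := Real.Gamma_pos_of_pos (s := (N : ℝ) - d) (by linarith)
  rw [meanMain, facetConst, beta, e1, e2, e3, e4, e5]
  field_simp

/-- The error is also a Beta integral, with one parameter raised by `2/d`; dividing by the main Beta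
value leaves the stated ratio of Gamma functions. -/
lemma exists_abs_meanRadius_sub_le {d : ℕ} (hd : 1 ≤ d) {p : ℝ} (hp : 0 ≤ p) :
    ∃ M, 0 ≤ M ∧ ∀ N : ℕ, d + 2 ≤ N → |meanRadius d p N - meanMain d p N| ≤
      M * (meanMain d p N * (Real.Gamma (N + p / d) / Real.Gamma (N + p / d + 2 / d))) := by
  have hd' : (1 : ℝ) ≤ d := by exact_mod_cast hd
  have hκ := kappa_pos hd
  have hκ2 := kappa_pos (Nat.one_le_pow 2 _ hd)
  obtain ⟨M, hM0, hM⟩ := exists_abs_integrand_sub_le hd hp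
  have hpd : 0 ≤ p / d := by positivity
  have h2d : 0 < 2 / (d : ℝ) := by positivity
  set a := (d : ℝ) - 1 + p / d with ha
  have ha0 : 0 ≤ a := by linarith
  have hG := Real.Gamma_pos_of_pos (s := a + 1) (by linarith)
  have hG' := Real.Gamma_pos_of_pos (s := a + 2 / d + 1) (by linarith)
  refine ⟨M * kappa d ^ a * (Real.Gamma (a + 2 / d + 1) / Real.Gamma (a + 1)), by positivity,
    fun N hN => ?_⟩
  have hN' : (d : ℝ) + 2 ≤ N := by exact_mod_cast hN
  have hN1 : d + 1 ≤ N := by omega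
  have hGN := Real.Gamma_pos_of_pos (s := (N : ℝ) + p / d) (by linarith)
  have hGN' := Real.Gamma_pos_of_pos (s := (N : ℝ) + p / d + 2 / d) (by linarith)
  set k := N - (d + 1) with hk
  have hk' : (k : ℝ) = N - d - 1 := by rw [hk, Nat.cast_sub hN1]; push_cast; ring
  have hI := integrable_integrand hd hp k
  have hI1 := (integrable_rpow_one_sub_capMass hd ha0 k).const_mul (kappa d ^ (-a))
  have hI2 := (integrable_rpow_one_sub_capMass hd
    (ha0.trans (by linarith : a ≤ a + 2 / d)) k).const_mul M
  have hdiff : |(∫ t, (1 - t ^ 2) ^ (((d : ℝ) ^ 2 - d) / 2) *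
        (√(2 - 2 * t) ^ p * capMass d t ^ k) ∂sqLaw ((d : ℝ) / 2 - 1)) -
        kappa d ^ (-a) * beta ((k : ℝ) + 1) (a + 1)| ≤
      M * beta ((k : ℝ) + 1) (a + 2 / d + 1) := by
    rw [← integral_rpow_one_sub_capMass hd ha0, ← integral_const_mul, ← integral_sub hI hI1,
      ← integral_rpow_one_sub_capMass hd (ha0.trans (by linarith : a ≤ a + 2 / d)),
      ← integral_const_mul, ← Real.norm_eq_abs]
    refine norm_integral_le_of_norm_le hI2 ?_
    filter_upwards [ae_sqLaw_mem _] with t ht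
    have h0 := capMass_nonneg d t
    rw [Real.norm_eq_abs, ← mul_assoc, ← mul_assoc, ← sub_mul, ← mul_assoc, abs_mul,
      abs_of_nonneg (pow_nonneg h0 k)]
    exact mul_le_mul_of_nonneg_right (hM t ht) (pow_nonneg h0 k)
  rw [meanMain_eq hd hp hN, meanRadius_eq hd, ← ha, ← hk, ← mul_sub, ← mul_sub, abs_mul,
    abs_mul (d * kappa (d ^ 2) / kappa d), abs_of_nonneg (a := 2 * (N.choose (d + 1) : ℝ))
      (by positivity), abs_of_pos (a := d * kappa (d ^ 2) / kappa d) (by positivity)]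
  have hb : beta ((k : ℝ) + 1) (a + 2 / d + 1) = kappa d ^ a *
      (Real.Gamma (a + 2 / d + 1) / Real.Gamma (a + 1)) * ((kappa d ^ (-a) *
        beta ((k : ℝ) + 1) (a + 1)) *
          (Real.Gamma (N + p / d) / Real.Gamma (N + p / d + 2 / d))) := by
    have e1 : (k : ℝ) + 1 + (a + 1) = N + p / d := by rw [hk', ha]; ring
    have e2 : (k : ℝ) + 1 + (a + 2 / d + 1) = N + p / d + 2 / d := by rw [hk', ha]; ring
    have := Real.rpow_pos_of_pos hκ a
    rw [beta, beta, e1, e2, Real.rpow_neg hκ.le]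
    generalize Real.Gamma ((N : ℝ) + p / d) = G at hGN
    field_simp
  calc _ ≤ 2 * (N.choose (d + 1) : ℝ) * (d * kappa (d ^ 2) / kappa d *
        (M * beta ((k : ℝ) + 1) (a + 2 / d + 1))) := by gcongr
    _ = _ := by rw [hb]; ring

/-! ### The generating function of the generalized Bernoulli polynomials -/

/-- The function whose Taylor coefficients define `genBernoulli · a x`. -/
def bernoulliGen (a x t : ℝ) : ℝ :=
  (if t = 0 then 1 else t / (Real.exp t - 1)) ^ a * Real.exp (x * t)

lemma genBernoulli_eq (n : ℕ) (a x : ℝ) :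
    genBernoulli n a x = iteratedDeriv n (bernoulliGen a x) 0 := rfl

/-- `dslope` removes the singularity of `(e^t - 1)/t` at `0`. It is smooth and positive, so real
powers of its inverse cause no trouble. -/
lemma dslope_exp_eq (t : ℝ) :
    (if t = 0 then 1 else t / (Real.exp t - 1)) = (dslope Real.exp 0 t)⁻¹ := by
  by_cases h : t = 0
  · subst h; simp
  · rw [if_neg h, dslope_of_ne _ h, slope_def_field]
    simp

lemma dslope_exp_pos (t : ℝ) : 0 < dslope Real.exp 0 t := by
  by_cases h : t = 0
  · subst h; simp
  · rw [dslope_of_ne _ h, slope_def_field, Real.exp_zero, sub_zero]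
    rcases lt_or_gt_of_ne h with h | h
    · exact div_pos_of_neg_of_neg (by linarith [Real.exp_lt_one_iff.2 h]) h
    · exact div_pos (by linarith [Real.one_lt_exp_iff.2 h]) h

lemma contDiff_dslope_exp {n : ℕ} : ContDiff ℝ n (dslope Real.exp 0) := by
  rw [contDiff_iff_contDiffAt]
  intro t
  by_cases h : t = 0
  · subst h
    obtain ⟨P, hP⟩ := (analyticAt_rexp (x := (0 : ℝ)))
    have : AnalyticAt ℝ (dslope Real.exp 0) 0 := ⟨_, hP.has_fpower_series_dslope_fslope⟩
    exact this.contDiffAt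
  · have : dslope Real.exp 0 =ᶠ[𝓝 t] slope Real.exp 0 := dslope_eventuallyEq_slope_of_ne _ h
    refine ContDiffAt.congr_of_eventuallyEq ?_ this
    have e : slope Real.exp 0 = fun s : ℝ => (Real.exp s - Real.exp 0) / (s - 0) := by
      funext s; exact slope_def_field _ _ _
    rw [e]
    exact ContDiffAt.div (Real.contDiff_exp.contDiffAt.sub contDiffAt_const)
      (contDiffAt_id.sub contDiffAt_const) (by simpa using h)

lemma contDiff_bernoulliGen {n : ℕ} (a x : ℝ) : ContDiff ℝ n (bernoulliGen a x) := by
  have e : bernoulliGen a x = fun t => ((dslope Real.exp 0 t)⁻¹) ^ a * Real.exp (x * t) := by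
    funext t; rw [bernoulliGen, dslope_exp_eq]
  rw [e]
  refine ContDiff.mul (ContDiff.rpow_const_of_ne (contDiff_dslope_exp.inv fun t =>
    (dslope_exp_pos t).ne') fun t => (inv_pos.2 (dslope_exp_pos t)).ne') ?_
  exact Real.contDiff_exp.comp (contDiff_const.mul contDiff_id)

lemma bernoulliGen_zero (a x : ℝ) : bernoulliGen a x 0 = 1 := by simp [bernoulliGen]

lemma bernoulliGen_neg {q t : ℝ} (ht : 0 < t) :
    bernoulliGen (1 - q) 1 (-t) = t ^ (1 - q) * (1 - Real.exp (-t)) ^ (q - 1) * Real.exp (-t) := by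
  have h : 0 < 1 - Real.exp (-t) := by
    have := Real.exp_lt_one_iff.2 (by linarith : -t < 0)
    linarith
  rw [bernoulliGen, if_neg (by linarith), one_mul,
    show -t / (Real.exp (-t) - 1) = t / (1 - Real.exp (-t)) by rw [← neg_sub 1, neg_div_neg_eq],
    Real.div_rpow ht.le h.le, show q - 1 = -(1 - q) by ring, Real.rpow_neg h.le, div_eq_mul_inv]

/-- For `t ≥ 1` the factor `1 - e^(-t)` stays in a compact interval away from `0`, and `t^(1 - q) ≤
t` is absorbed by `e^(-t)`. -/
lemma abs_bernoulliGen_neg_le {q : ℝ} (hq : 0 < q) :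
    ∃ C, 0 ≤ C ∧ ∀ t, 1 ≤ t → |bernoulliGen (1 - q) 1 (-t)| ≤ C := by
  have hc : ContinuousOn (fun x : ℝ => x ^ (q - 1)) (Set.Icc (1 - Real.exp (-1)) 1) :=
    fun x hx => (Real.continuousAt_rpow_const x _ (Or.inl (by
      have := Real.exp_lt_one_iff.2 (by norm_num : (-1 : ℝ) < 0)
      linarith [hx.1]))).continuousWithinAt
  obtain ⟨C, hC⟩ := isCompact_Icc.exists_bound_of_continuousOn hc
  have hC0 : 0 ≤ C := (norm_nonneg _).trans (hC 1 ⟨by linarith [Real.exp_pos (-1)], le_rfl⟩)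
  refine ⟨C, hC0, fun t ht => ?_⟩
  have h1 : 0 < 1 - Real.exp (-t) := by
    have := Real.exp_lt_one_iff.2 (by linarith : -t < 0)
    linarith
  rw [bernoulliGen_neg (by linarith), abs_mul, abs_mul, abs_of_pos (Real.exp_pos _),
    abs_of_nonneg (by positivity)]
  have h2 : |(1 - Real.exp (-t)) ^ (q - 1)| ≤ C := by
    refine hC _ ⟨?_, by linarith [Real.exp_pos (-t)]⟩
    have := Real.exp_le_exp.2 (neg_le_neg ht)
    linarith
  have h3 : t ^ (1 - q) ≤ t := by
    calc t ^ (1 - q) ≤ t ^ (1 : ℝ) := Real.rpow_le_rpow_of_exponent_le ht (by linarith)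
      _ = t := Real.rpow_one t
  have h4 : t * Real.exp (-t) ≤ 1 := by
    rw [Real.exp_neg, ← div_eq_mul_inv, div_le_one (Real.exp_pos _)]
    linarith [Real.add_one_le_exp t]
  calc _ ≤ t * C * Real.exp (-t) := by gcongr
    _ = t * Real.exp (-t) * C := by ring
    _ ≤ 1 * C := by gcongr
    _ = C := one_mul C

/-- Taylor's formula on the whole half-line. -/
lemma exists_bernoulliGen_remainder {q : ℝ} (hq : 0 < q) {L : ℕ} (hL : 1 ≤ L) :
    ∃ M, 0 ≤ M ∧ ∀ t, 0 < t → |bernoulliGen (1 - q) 1 (-t) -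
      ∑ l ∈ Finset.range L, (-1) ^ l * genBernoulli l (1 - q) 1 / (l.factorial : ℝ) * t ^ l| ≤
        M * t ^ L := by
  obtain ⟨n, rfl⟩ : ∃ n, L = n + 1 := ⟨L - 1, by omega⟩
  set g : ℝ → ℝ := fun t => bernoulliGen (1 - q) 1 (-t) with hg
  have hgc : ∀ m : ℕ, ContDiff ℝ m g := fun m => (contDiff_bernoulliGen _ _).comp contDiff_neg
  obtain ⟨C₁, hC₁⟩ := exists_taylor_mean_remainder_bound (f := g) (n := n) zero_le_one
    (hgc (n + 1)).contDiffOn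
  have hT : ∀ t, taylorWithinEval g n (Set.Icc 0 1) 0 t = ∑ l ∈ Finset.range (n + 1),
      (-1) ^ l * genBernoulli l (1 - q) 1 / (l.factorial : ℝ) * t ^ l := by
    intro t
    rw [taylor_within_apply]
    refine Finset.sum_congr rfl fun l _ => ?_
    rw [iteratedDerivWithin_eq_iteratedDeriv (uniqueDiffOn_Icc zero_lt_one)
      (hgc l).contDiffAt (by simp), hg, iteratedDeriv_comp_neg, neg_zero, ← genBernoulli_eq]
    simp only [smul_eq_mul, sub_zero]
    ring
  simp_rw [hT, sub_zero] at hC₁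
  obtain ⟨C₂, hC₂0, hC₂⟩ := abs_bernoulliGen_neg_le hq
  set C₃ := ∑ l ∈ Finset.range (n + 1), |(-1) ^ l * genBernoulli l (1 - q) 1 / (l.factorial : ℝ)|
    with hC₃
  have hC₃0 : 0 ≤ C₃ := Finset.sum_nonneg fun _ _ => abs_nonneg _
  refine ⟨|C₁| + C₂ + C₃, by positivity, fun t ht => ?_⟩
  -- Taylor's theorem handles `t ≤ 1`. For `t ≥ 1` the function is bounded and each monomial of
  -- degree below `L` is at most `t ^ L`, so no cancellation is needed.
  rcases le_total t 1 with h1 | h1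
  · refine (hC₁ t ⟨ht.le, h1⟩).trans ?_
    have : 0 ≤ t ^ (n + 1) := by positivity
    gcongr
    linarith [le_abs_self C₁]
  · have ht1 : 1 ≤ t ^ (n + 1) := one_le_pow₀ h1
    have h2 : |∑ l ∈ Finset.range (n + 1),
        (-1) ^ l * genBernoulli l (1 - q) 1 / (l.factorial : ℝ) * t ^ l| ≤ C₃ * t ^ (n + 1) := by
      refine (Finset.abs_sum_le_sum_abs _ _).trans ?_
      rw [hC₃, Finset.sum_mul]
      refine Finset.sum_le_sum fun l hl => ?_
      rw [abs_mul, abs_of_pos (by positivity : 0 < t ^ l)]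
      exact mul_le_mul_of_nonneg_left
        (pow_le_pow_right₀ h1 (Finset.mem_range.1 hl).le) (abs_nonneg _)
    calc _ ≤ |g t| + |∑ l ∈ Finset.range (n + 1),
          (-1) ^ l * genBernoulli l (1 - q) 1 / (l.factorial : ℝ) * t ^ l| := abs_sub _ _
      _ ≤ C₂ * t ^ (n + 1) + C₃ * t ^ (n + 1) := by
          refine add_le_add ((hC₂ t h1).trans ?_) h2
          nlinarith
      _ ≤ (|C₁| + C₂ + C₃) * t ^ (n + 1) := by
          have : 0 ≤ |C₁| * t ^ (n + 1) := by positivity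
          linarith

/-! ### The asymptotic expansion of a ratio of Gamma functions -/

lemma integrableOn_rpow_mul_exp {a r : ℝ} (ha : 0 < a) (hr : 0 < r) :
    IntegrableOn (fun t : ℝ => t ^ (a - 1) * Real.exp (-(r * t))) (Set.Ioi 0) := by
  have := integrableOn_rpow_mul_exp_neg_mul_rpow (s := a - 1) (p := 1) (b := r) (by linarith)
    one_pos hr
  simpa using this

/-- Substitution `u = e^(-t)`: the factor `(1 - e^(-t))^(q - 1) e^(-t)` equals `t^(q - 1)` times the
generating function at `-t`. -/
lemma beta_eq_integral_Ioi {q : ℝ} (hq : 0 < q) (N : ℕ) :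
    IntegrableOn (fun t : ℝ => t ^ (q - 1) * Real.exp (-(N * t)) *
        bernoulliGen (1 - q) 1 (-t)) (Set.Ioi 0) ∧
      ∫ t in Set.Ioi (0 : ℝ), t ^ (q - 1) * Real.exp (-(N * t)) * bernoulliGen (1 - q) 1 (-t) =
        beta (N + 1) q := by
  set F : ℝ → ℝ := fun u => u ^ ((N : ℝ) + 1 - 1) * (1 - u) ^ (q - 1) with hF
  have himg : (fun t : ℝ => Real.exp (-t)) '' Set.Ioi 0 = Set.Ioo 0 1 := by
    ext u
    simp only [Set.mem_image, Set.mem_Ioi, Set.mem_Ioo]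
    constructor
    · rintro ⟨t, ht, rfl⟩
      exact ⟨Real.exp_pos _, Real.exp_lt_one_iff.2 (by simpa using ht)⟩
    · rintro ⟨h0, h1⟩
      exact ⟨-Real.log u, by linarith [Real.log_neg h0 h1], by rw [neg_neg, Real.exp_log h0]⟩
  have hinj : Set.InjOn (fun t : ℝ => Real.exp (-t)) (Set.Ioi 0) := fun a _ b _ h => by
    simpa using h
  have hderiv : ∀ t ∈ Set.Ioi (0 : ℝ), HasDerivWithinAt (fun t : ℝ => Real.exp (-t))
      (-Real.exp (-t)) (Set.Ioi 0) t := fun t _ => by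
    simpa using ((hasDerivAt_neg t).exp).hasDerivWithinAt
  have heq : ∀ t ∈ Set.Ioi (0 : ℝ), |-Real.exp (-t)| • F (Real.exp (-t)) =
      t ^ (q - 1) * Real.exp (-(N * t)) * bernoulliGen (1 - q) 1 (-t) := by
    intro t ht
    have ht' : (0 : ℝ) < t := ht
    have h1 : t ^ (q - 1) * t ^ (1 - q) = 1 := by
      rw [← Real.rpow_add ht']; simp
    rw [abs_neg, abs_of_pos (Real.exp_pos _), smul_eq_mul, hF, bernoulliGen_neg ht']
    simp only [add_sub_cancel_right]
    rw [← Real.exp_mul, show -t * (N : ℝ) = -(N * t) by ring]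
    linear_combination (-(Real.exp (-(N * t)) * (1 - Real.exp (-t)) ^ (q - 1) *
      Real.exp (-t))) * h1
  have hB : ∫ u in Set.Ioo (0 : ℝ) 1, F u = beta (N + 1) q := by
    rw [← integral_beta (by positivity) hq, intervalIntegral.integral_of_le zero_le_one,
      integral_Ioc_eq_integral_Ioo]
  have hFi : IntegrableOn F (Set.Ioo 0 1) := by
    -- A non-integrable function has integral `0` by convention, but this integral is a positive
    -- Beta value.
    by_contra h
    have h1 := beta_pos (α := (N : ℝ) + 1) (by positivity) hq
    rw [← hB, integral_undef h] at h1
    exact lt_irrefl _ h1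
  constructor
  · rw [← himg, integrableOn_image_iff_integrableOn_abs_deriv_smul measurableSet_Ioi hderiv hinj]
      at hFi
    exact hFi.congr_fun heq measurableSet_Ioi
  · rw [← hB, ← himg, integral_image_eq_integral_abs_deriv_smul measurableSet_Ioi hderiv hinj]
    exact (setIntegral_congr_fun measurableSet_Ioi heq).symm

/-- Both sides unfold `Γ(q + l) = q(q + 1)⋯(q + l - 1) Γ(q)`; the sign turns the rising product into
a falling one at `-q`. -/
lemma choose_neg_mul {q : ℝ} (hq : 0 < q) (l : ℕ) :
    (-1) ^ l / (l.factorial : ℝ) * Real.Gamma (q + l) = Ring.choose (-q) l * Real.Gamma q := by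
  rw [Ring.choose_eq_smul, smul_eq_mul]
  have h : (-1) ^ l * Real.Gamma (q + l) =
      (descPochhammer ℤ l).smeval (-q) * Real.Gamma q := by
    induction l with
    | zero => simp
    | succ n ih =>
      rw [descPochhammer_succ_right, Polynomial.smeval_mul, Polynomial.smeval_sub,
        Polynomial.smeval_X, Polynomial.smeval_natCast, Nat.cast_succ, ← add_assoc,
        Real.Gamma_add_one (by positivity), pow_succ]
      simp only [pow_one, pow_zero, nsmul_eq_mul, mul_one]
      linear_combination (-q - n) * ih
  rw [div_mul_eq_mul_div, h]
  ring

/-- The full asymptotic expansion of `Γ(N + 1) / Γ(N + 1 + q)`. -/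
lemma exists_gamma_ratio_expansion {q : ℝ} (hq : 0 ≤ q) {L : ℕ} (hL : 1 ≤ L) :
    ∃ M, 0 ≤ M ∧ ∀ N : ℕ, 1 ≤ N → |Real.Gamma (N + 1) / Real.Gamma (N + 1 + q) * (N : ℝ) ^ q -
      (1 + ∑ l ∈ Finset.Ico 1 L, Ring.choose (-q) l * genBernoulli l (1 - q) 1 / (N : ℝ) ^ l)| ≤
        M * ((N : ℝ) ^ L)⁻¹ := by
  -- The Beta integral diverges for `q = 0`, but then the ratio is `1` and all coefficients with `l
  -- ≥ 1` vanish.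
  rcases hq.eq_or_lt with rfl | hq
  · refine ⟨0, le_rfl, fun N hN => ?_⟩
    have h1 := Real.Gamma_pos_of_pos (s := (N : ℝ) + 1) (by positivity)
    rw [Finset.sum_eq_zero fun l hl => by
      rw [neg_zero, Ring.choose_zero_pos _ (Finset.mem_Ico.1 hl).1]; simp]
    simp [h1.ne']
  obtain ⟨M, hM0, hM⟩ := exists_bernoulliGen_remainder hq hL
  have hG := Real.Gamma_pos_of_pos hq
  have hGL := Real.Gamma_pos_of_pos (s := q + L) (by positivity)
  refine ⟨M * Real.Gamma (q + L) / Real.Gamma q, by positivity, fun N hN => ?_⟩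
  have hN' : (0 : ℝ) < N := by exact_mod_cast hN
  obtain ⟨hI, hB⟩ := beta_eq_integral_Ioi hq N
  set c : ℕ → ℝ := fun l => (-1) ^ l * genBernoulli l (1 - q) 1 / (l.factorial : ℝ) with hc
  have hterm : ∀ l : ℕ, IntegrableOn (fun t : ℝ => t ^ (q - 1) * Real.exp (-(N * t)) * t ^ l)
      (Set.Ioi 0) ∧ ∫ t in Set.Ioi (0 : ℝ), t ^ (q - 1) * Real.exp (-(N * t)) * t ^ l =
        (N : ℝ) ^ (-q) / (N : ℝ) ^ l * Real.Gamma (q + l) := by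
    intro l
    have hql : 0 < q + l := by positivity
    have e : ∀ t ∈ Set.Ioi (0 : ℝ), t ^ (q + l - 1) * Real.exp (-(N * t)) =
        t ^ (q - 1) * Real.exp (-(N * t)) * t ^ l := by
      intro t ht
      rw [show q + l - 1 = q - 1 + l by ring, Real.rpow_add_natCast (ne_of_gt ht)]
      ring
    refine ⟨(integrableOn_rpow_mul_exp hql hN').congr_fun e measurableSet_Ioi, ?_⟩
    rw [← setIntegral_congr_fun measurableSet_Ioi e, Real.integral_rpow_mul_exp_neg_mul_Ioi hql hN',
      one_div, Real.inv_rpow hN'.le, ← Real.rpow_neg hN'.le, neg_add, ← sub_eq_add_neg,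
      Real.rpow_sub_natCast hN'.ne']
  have hsumI : IntegrableOn (fun t : ℝ => t ^ (q - 1) * Real.exp (-(N * t)) *
      ∑ l ∈ Finset.range L, c l * t ^ l) (Set.Ioi 0) := by
    simp_rw [Finset.mul_sum]
    refine integrable_finsetSum _ fun l _ => ?_
    refine ((hterm l).1.const_mul (c l)).congr (Eventually.of_forall fun t => ?_)
    simp only
    ring
  have hsum : ∫ t in Set.Ioi (0 : ℝ), t ^ (q - 1) * Real.exp (-(N * t)) *
      ∑ l ∈ Finset.range L, c l * t ^ l = ∑ l ∈ Finset.range L,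
        c l * ((N : ℝ) ^ (-q) / (N : ℝ) ^ l * Real.Gamma (q + l)) := by
    simp_rw [← (hterm _).2, ← integral_const_mul, Finset.mul_sum]
    rw [integral_finsetSum _ fun l _ => ?_]
    · refine Finset.sum_congr rfl fun l _ => integral_congr_ae (Eventually.of_forall fun t => ?_)
      simp only
      ring
    · refine ((hterm l).1.const_mul (c l)).congr (Eventually.of_forall fun t => ?_)
      simp only
      ring
  -- Watson's lemma. The Taylor bound holds on the whole half-line, so there is no tail to split
  -- off.
  have hdiff : |beta (N + 1) q - ∑ l ∈ Finset.range L,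
      c l * ((N : ℝ) ^ (-q) / (N : ℝ) ^ l * Real.Gamma (q + l))| ≤
        M * ((N : ℝ) ^ (-q) / (N : ℝ) ^ L * Real.Gamma (q + L)) := by
    rw [← hB, ← hsum, ← integral_sub hI hsumI, ← (hterm L).2, ← integral_const_mul,
      ← Real.norm_eq_abs]
    refine norm_integral_le_of_norm_le ((hterm L).1.const_mul M) ?_
    filter_upwards [ae_restrict_mem measurableSet_Ioi] with t ht
    have ht' : (0 : ℝ) < t := ht
    rw [← mul_sub, Real.norm_eq_abs, abs_mul, abs_of_pos (by positivity)]
    calc _ ≤ t ^ (q - 1) * Real.exp (-(N * t)) * (M * t ^ L) :=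
          mul_le_mul_of_nonneg_left (hM t ht') (by positivity)
      _ = _ := by ring
  have hNq := Real.rpow_pos_of_pos hN' q
  have hGN := Real.Gamma_pos_of_pos (s := (N : ℝ) + 1 + q) (by positivity)
  have e1 : Real.Gamma (N + 1) / Real.Gamma (N + 1 + q) * (N : ℝ) ^ q =
      beta (N + 1) q * ((N : ℝ) ^ q / Real.Gamma q) := by
    rw [beta]; field_simp
  have e2 : 1 + ∑ l ∈ Finset.Ico 1 L, Ring.choose (-q) l * genBernoulli l (1 - q) 1 / (N : ℝ) ^ l =
      (∑ l ∈ Finset.range L, c l * ((N : ℝ) ^ (-q) / (N : ℝ) ^ l * Real.Gamma (q + l))) *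
        ((N : ℝ) ^ q / Real.Gamma q) := by
    have h3 : ∀ l, c l * ((N : ℝ) ^ (-q) / (N : ℝ) ^ l * Real.Gamma (q + l)) *
        ((N : ℝ) ^ q / Real.Gamma q) =
          Ring.choose (-q) l * genBernoulli l (1 - q) 1 / (N : ℝ) ^ l := by
      intro l
      have h4 := choose_neg_mul hq l
      calc _ = (-1) ^ l / (l.factorial : ℝ) * Real.Gamma (q + l) *
            (genBernoulli l (1 - q) 1 / (N : ℝ) ^ l * ((N : ℝ) ^ (-q) * (N : ℝ) ^ q) /
              Real.Gamma q) := by rw [hc]; ring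
        _ = _ := by
          rw [h4, ← Real.rpow_add hN', neg_add_cancel, Real.rpow_zero]
          field_simp
    rw [Finset.sum_mul, Finset.sum_congr rfl fun l _ => h3 l, Finset.range_eq_Ico,
      Finset.sum_eq_sum_Ico_succ_bot (a := 0) (b := L) (by omega)]
    simp [genBernoulli_eq, bernoulliGen_zero]
  rw [e1, e2, ← sub_mul, abs_mul, abs_of_pos (a := (N : ℝ) ^ q / Real.Gamma q) (by positivity)]
  calc _ ≤ M * ((N : ℝ) ^ (-q) / (N : ℝ) ^ L * Real.Gamma (q + L)) *
        ((N : ℝ) ^ q / Real.Gamma q) := mul_le_mul_of_nonneg_right hdiff (by positivity)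
    _ = _ := by
      rw [Real.rpow_neg hN'.le]
      field_simp

/-! ### Consequences for ratios of Gamma functions -/

lemma isBigO_gamma_ratio {q : ℝ} (hq : 0 ≤ q) :
    (fun N : ℕ => Real.Gamma (N + 1) / Real.Gamma (N + 1 + q) * (N : ℝ) ^ q - 1) =O[atTop]
      fun N : ℕ => (N : ℝ)⁻¹ := by
  obtain ⟨M, -, hM⟩ := exists_gamma_ratio_expansion hq le_rfl
  refine IsBigO.of_bound M ?_
  filter_upwards [eventually_ge_atTop 1] with N hN
  have := hM N hN
  simp only [Finset.Ico_self, Finset.sum_empty, add_zero, pow_one] at this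
  rwa [Real.norm_eq_abs, Real.norm_of_nonneg (by positivity)]

lemma tendsto_gamma_ratio {q : ℝ} (hq : 0 ≤ q) :
    Tendsto (fun N : ℕ => Real.Gamma (N + 1) / Real.Gamma (N + 1 + q) * (N : ℝ) ^ q) atTop
      (𝓝 1) := by
  have h := ((isBigO_gamma_ratio hq).trans_tendsto tendsto_inv_atTop_nhds_zero_nat).add_const 1
  simpa using h

lemma tendsto_add_div_natCast (s : ℝ) :
    Tendsto (fun N : ℕ => ((N : ℝ) + s) / N) atTop (𝓝 1) := by
  have h := (tendsto_const_div_atTop_nhds_zero_nat s).const_add 1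
  rw [add_zero] at h
  refine h.congr' ?_
  filter_upwards [eventually_ge_atTop 1] with N hN
  have : (0 : ℝ) < N := by exact_mod_cast hN
  field_simp

/-- Quotient of the limits of `tendsto_gamma_ratio` for `s + r` and `s`; the functional equation
shifts `N + 1` to `N` at the cost of a factor tending to `1`. -/
lemma isBigO_gamma_div_gamma_add {s r : ℝ} (hs : 0 ≤ s) (hr : 0 ≤ r) :
    (fun N : ℕ => Real.Gamma (N + s) / Real.Gamma (N + s + r)) =O[atTop]
      fun N : ℕ => (N : ℝ) ^ (-r) := by
  have hlim := ((tendsto_gamma_ratio (add_nonneg hs hr)).div (tendsto_gamma_ratio hs)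
    one_ne_zero).mul ((tendsto_add_div_natCast (s + r)).div (tendsto_add_div_natCast s) one_ne_zero)
  refine isBigO_of_div_tendsto_nhds ?_ _ (hlim.congr' ?_)
  · filter_upwards [eventually_ge_atTop 1] with N hN h
    have : (0 : ℝ) < N := by exact_mod_cast hN
    exact absurd h (by positivity)
  · filter_upwards [eventually_ge_atTop 1] with N hN
    have hN' : (0 : ℝ) < N := by exact_mod_cast hN
    have hG := Real.Gamma_pos_of_pos (s := (N : ℝ) + 1) (by positivity)
    have hG1 := Real.Gamma_pos_of_pos (s := (N : ℝ) + s) (by positivity)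
    have hG2 := Real.Gamma_pos_of_pos (s := (N : ℝ) + s + r) (by positivity)
    have e1 : Real.Gamma (N + 1 + s) = (N + s) * Real.Gamma (N + s) := by
      rw [← Real.Gamma_add_one (by positivity)]; ring_nf
    have e2 : Real.Gamma (N + 1 + (s + r)) = (N + s + r) * Real.Gamma (N + s + r) := by
      rw [← Real.Gamma_add_one (by positivity)]; ring_nf
    simp only [Pi.div_apply]
    rw [e1, e2, Real.rpow_add hN', Real.rpow_neg hN'.le, ← add_assoc]
    have h1 := Real.rpow_pos_of_pos hN' s
    have h2 := Real.rpow_pos_of_pos hN' r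
    field_simp

/-! ### The expansions of the expected sum -/

lemma exists_meanRadius_eq_meanMain_mul {d : ℕ} (hd : 1 ≤ d) {p : ℝ} (hp : 0 ≤ p) :
    ∃ δ : ℕ → ℝ, δ =O[atTop] (fun N : ℕ => (N : ℝ) ^ (-(2 / d : ℝ))) ∧
      ∀ᶠ N : ℕ in atTop, meanRadius d p N = meanMain d p N * (1 + δ N) := by
  obtain ⟨M, hM0, hM⟩ := exists_abs_meanRadius_sub_le hd hp
  refine ⟨fun N => meanRadius d p N / meanMain d p N - 1, ?_, ?_⟩
  · refine IsBigO.trans (IsBigO.of_bound M ?_) (isBigO_gamma_div_gamma_add (s := p / d)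
      (by positivity) (by positivity))
    filter_upwards [eventually_ge_atTop (d + 2)] with N hN
    have h1 := meanMain_pos hd hp (by omega : 1 ≤ N)
    have h2 : 0 ≤ Real.Gamma (N + p / d) / Real.Gamma (N + p / d + 2 / d) :=
      div_nonneg (Real.Gamma_nonneg_of_nonneg (by positivity))
        (Real.Gamma_nonneg_of_nonneg (by positivity))
    rw [Real.norm_eq_abs, Real.norm_of_nonneg h2, div_sub_one h1.ne', abs_div, abs_of_pos h1,
      div_le_iff₀ h1]
    exact (hM N hN).trans (le_of_eq (by ring))
  · filter_upwards [eventually_ge_atTop (d + 2)] with N hN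
    have h1 := meanMain_pos hd hp (by omega : 1 ≤ N)
    field_simp
    ring

lemma exists_meanMain_eq_momentConst_mul {d : ℕ} (hd : 1 ≤ d) {p : ℝ} (hp : 0 ≤ p) :
    ∃ η : ℕ → ℝ, η =O[atTop] (fun N : ℕ => (N : ℝ)⁻¹) ∧ ∀ᶠ N : ℕ in atTop,
      meanMain d p N = momentConst d p * (N : ℝ) ^ (1 - p / d) * (1 + η N) := by
  have hs : 0 ≤ p / d := by positivity
  set s := p / (d : ℝ) with hsdef
  set g : ℕ → ℝ := fun N => Real.Gamma (N + 1) / Real.Gamma (N + 1 + s) * (N : ℝ) ^ s with hg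
  -- Since `Γ(N + 1 + s) = (N + s) Γ(N + s)`, the full correction factor is `g N * (1 + s / N)`.
  refine ⟨fun N => (g N - 1) + s * (g N * (N : ℝ)⁻¹), ?_, ?_⟩
  · refine (isBigO_gamma_ratio hs).add (IsBigO.const_mul_left ?_ s)
    simpa using (tendsto_gamma_ratio hs).isBigO_one ℝ |>.mul
      (isBigO_refl (fun N : ℕ => (N : ℝ)⁻¹) atTop)
  · filter_upwards [eventually_ge_atTop 1] with N hN
    have hN' : (0 : ℝ) < N := by exact_mod_cast hN
    have e1 : Real.Gamma (N + 1 + s) = (N + s) * Real.Gamma (N + s) := by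
      rw [← Real.Gamma_add_one (by positivity)]; ring_nf
    have hG1 := Real.Gamma_pos_of_pos (s := (N : ℝ) + s) (by positivity)
    have hGd := Real.Gamma_pos_of_pos (s := (d : ℝ)) (by exact_mod_cast hd)
    have h1 := Real.rpow_pos_of_pos hN' s
    rw [meanMain, momentConst, ← hsdef]
    simp only [hg]
    rw [e1, Real.rpow_sub hN', Real.rpow_one]
    field_simp
    ring

/-- The geometric error `N^(-2/d)` and the error `N⁻¹` of the Gamma ratio compete; `u` stands for
the larger one, which depends on `d`. -/
lemma exists_meanRadius_eq_momentConst_mul {d : ℕ} (hd : 1 ≤ d) {p : ℝ} (hp : 0 ≤ p)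
    {u : ℕ → ℝ} (h1 : (fun N : ℕ => (N : ℝ)⁻¹) =O[atTop] u)
    (h2 : (fun N : ℕ => (N : ℝ) ^ (-(2 / d : ℝ))) =O[atTop] u) :
    ∃ δ : ℕ → ℝ, δ =O[atTop] u ∧ ∀ᶠ N : ℕ in atTop,
      meanRadius d p N = momentConst d p * (N : ℝ) ^ (1 - p / d) * (1 + δ N) := by
  obtain ⟨δ, hδ, hδe⟩ := exists_meanRadius_eq_meanMain_mul hd hp
  obtain ⟨η, hη, hηe⟩ := exists_meanMain_eq_momentConst_mul hd hp
  refine ⟨fun N => η N + δ N + η N * δ N, ((hη.trans h1).add (hδ.trans h2)).add ?_, ?_⟩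
  · have h3 : η =O[atTop] fun _ => (1 : ℝ) :=
      (hη.trans_tendsto tendsto_inv_atTop_nhds_zero_nat).isBigO_one ℝ
    simpa using h3.mul (hδ.trans h2)
  · filter_upwards [hδe, hηe] with N h3 h4
    rw [h3, h4]
    ring

lemma isBigO_rpow_neg {a b : ℝ} (h : b ≤ a) :
    (fun N : ℕ => (N : ℝ) ^ (-a)) =O[atTop] fun N : ℕ => (N : ℝ) ^ (-b) := by
  refine IsBigO.of_bound 1 ?_
  filter_upwards [eventually_ge_atTop 1] with N hN
  have hN' : (1 : ℝ) ≤ N := by exact_mod_cast hN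
  rw [one_mul, Real.norm_of_nonneg (by positivity), Real.norm_of_nonneg (by positivity)]
  exact Real.rpow_le_rpow_of_exponent_le hN' (by linarith)

/-! ### The exact mean on the two-dimensional sphere. -/

/-- Archimedes: on the two-dimensional sphere the density exponent is `0` and heights are uniform.
-/
lemma capMass_two {t : ℝ} (ht : t ∈ Set.Icc (-1 : ℝ) 1) : capMass 2 t = (1 + t) / 2 := by
  have hq : ((2 : ℕ) : ℝ) / 2 - 1 = 0 := by norm_num
  have h := integral_one_sub_sq_rpow (q := 0) (by norm_num)
  rw [capMass, hq, sqLaw_real_Iio (by norm_num) ht, ← h]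
  simp only [Real.rpow_zero, intervalIntegral.integral_const, smul_eq_mul]
  ring

lemma kappa_two : kappa 2 = 1 / 4 := by
  have h := integral_one_sub_sq_rpow (q := 0) (by norm_num)
  simp only [Real.rpow_zero, intervalIntegral.integral_const, smul_eq_mul] at h
  rw [kappa_eq (by norm_num), show ((2 : ℕ) : ℝ) / 2 - 1 = 0 by norm_num, ← h]
  norm_num

lemma kappa_four : kappa 4 = 3 / 16 := by
  have h := integral_one_sub_sq_rpow (q := 1) (by norm_num)
  have h2 : ∫ s in (-1 : ℝ)..1, (1 - s ^ 2) ^ (1 : ℝ) = 4 / 3 := by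
    simp only [Real.rpow_one]
    rw [intervalIntegral.integral_sub (by simp) (by simp)]
    simp only [intervalIntegral.integral_const, integral_pow, smul_eq_mul]
    norm_num
  rw [kappa_eq (by norm_num), show ((4 : ℕ) : ℝ) / 2 - 1 = 1 by norm_num, ← h, h2]
  norm_num

/-- On the two-dimensional sphere the expected sum is known exactly. -/
lemma meanRadius_two {p : ℝ} (hp : 0 ≤ p) {N : ℕ} (hN : 4 ≤ N) :
    meanRadius 2 p N = (2 * (N : ℝ) - 4) * 2 ^ p * Real.Gamma (2 + p / 2) *
      (Real.Gamma (N + 1) / Real.Gamma (N + 1 + p / 2)) := by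
  have hN' : (4 : ℝ) ≤ N := by exact_mod_cast hN
  -- With `u = (1 + t)/2` one has `1 - t² = 4u(1 - u)` and `2 - 2t = 4(1 - u)`, so the integrand is
  -- a Beta integrand without error term.
  have hint : ∫ t, (1 - t ^ 2) ^ ((((2 : ℕ) : ℝ) ^ 2 - (2 : ℕ)) / 2) *
      (√(2 - 2 * t) ^ p * capMass 2 t ^ (N - (2 + 1))) ∂sqLaw (((2 : ℕ) : ℝ) / 2 - 1) =
        4 * 2 ^ p * beta (((N - 3 + 1 : ℕ) : ℝ) + 1) (1 + p / 2 + 1) := by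
    rw [← integral_rpow_one_sub_capMass one_le_two (by positivity), ← integral_const_mul]
    refine integral_congr_ae ?_
    filter_upwards [ae_sqLaw_mem _] with t ht
    have h1 : 0 < 1 - t := by linarith [ht.2]
    have h2 : 0 < 1 + t := by linarith [ht.1]
    rw [capMass_two ⟨ht.1.le, ht.2.le⟩, show 1 - (1 + t) / 2 = (1 - t) / 2 by ring,
      show 2 - 2 * t = 2 ^ 2 * ((1 - t) / 2) by ring, Real.sqrt_mul (by norm_num),
      Real.sqrt_sq (by norm_num), Real.mul_rpow (by norm_num) (by positivity), Real.sqrt_eq_rpow,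
      ← Real.rpow_mul (by positivity), Real.rpow_add (by positivity), Real.rpow_one,
      show (((2 : ℕ) : ℝ) ^ 2 - (2 : ℕ)) / 2 = 1 by norm_num, Real.rpow_one,
      show 1 / 2 * p = p / 2 by ring, pow_succ]
    ring
  rw [meanRadius_eq one_le_two, hint]
  norm_num only [kappa_two, kappa_four]
  have hN3 : 3 ≤ N := by omega
  have h3 : ((N - 3 : ℕ) : ℝ) = N - 3 := by rw [Nat.cast_sub hN3]; norm_num
  have e1 : Real.Gamma (((N - 3 + 1 : ℕ) : ℝ) + 1) = (N - 2) * ((N - 3).factorial : ℝ) := by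
    rw [Real.Gamma_nat_eq_factorial, Nat.factorial_succ]
    push_cast
    rw [h3]
    ring
  have e2 : ((N - 3 + 1 : ℕ) : ℝ) + 1 + (1 + p / 2 + 1) = N + 1 + p / 2 := by
    push_cast
    rw [h3]
    ring
  have hG := Real.Gamma_pos_of_pos (s := (N : ℝ) + 1 + p / 2) (by positivity)
  rw [beta, e1, e2, Nat.cast_choose ℝ hN3, Real.Gamma_nat_eq_factorial,
    show 1 + p / 2 + 1 = 2 + p / 2 by ring, show Nat.factorial 3 = 6 from rfl]
  have hf : ((N - 3).factorial : ℝ) ≠ 0 := by positivity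
  push_cast
  field_simp
  ring

end HoleRadii

end

/-! ### Assembly of the expansions. -/

theorem theorem2p2 (d : ℕ) (hd : 1 ≤ d) :
    (∀ p : ℝ, 0 ≤ p → ∃ e : ℕ → ℝ,
      -- `e N` is the expected sum of the `p`-th powers of the hole radii of `N` random points
      (∀ N : ℕ, d + 2 ≤ N →
        HasUniformMean.{u} (fun x : Fin N → Sph d => holeRadiusSum p x) (e N)) ∧
      (∃ δ : ℕ → ℝ, δ =O[atTop] (fun N : ℕ => (N : ℝ) ^ (-(2 / d : ℝ))) ∧
        ∀ᶠ N : ℕ in atTop,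
          e N = facetConst d * kappa d ^ (-(p / d)) *
            (Real.Gamma (d + p / d) * Real.Gamma (N + 1) /
              (Real.Gamma d * Real.Gamma (N + p / d))) * (1 + δ N)) ∧
      (2 ≤ d → ∃ δ : ℕ → ℝ, δ =O[atTop] (fun N : ℕ => (N : ℝ) ^ (-(2 / d : ℝ))) ∧
        ∀ᶠ N : ℕ in atTop, e N = momentConst d p * (N : ℝ) ^ (1 - p / d) * (1 + δ N)) ∧
      (d = 1 → ∃ δ : ℕ → ℝ, δ =O[atTop] (fun N : ℕ => (N : ℝ)⁻¹) ∧
        ∀ᶠ N : ℕ in atTop, e N = momentConst d p * (N : ℝ) ^ (1 - p / d) * (1 + δ N)) ∧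
      (d = 2 → ∀ L : ℕ, 1 ≤ L →
        ∃ δ : ℕ → ℝ, δ =O[atTop] (fun N : ℕ => ((N : ℝ) ^ L)⁻¹) ∧
          ∀ᶠ N : ℕ in atTop,
            e N = (2 * (N : ℝ) - 4) * (2 : ℝ) ^ p * Real.Gamma (2 + p / 2) *
              (N : ℝ) ^ (-(p / 2)) *
              (1 + ∑ l ∈ Finset.Ico 1 L,
                Ring.choose (-(p / 2)) l * genBernoulli l (1 - p / 2) 1 / (N : ℝ) ^ l + δ N))) ∧
    (∃ f : ℕ → ℝ,
      -- `f N` is the expected number of facets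
      (∀ N : ℕ, d + 2 ≤ N →
        HasUniformMean.{u} (fun x : Fin N → Sph d => facetCount x) (f N)) ∧
      ∃ δ : ℕ → ℝ, δ =O[atTop] (fun N : ℕ => (N : ℝ) ^ (-(2 / d : ℝ))) ∧
        ∀ᶠ N : ℕ in atTop, f N = facetConst d * N * (1 + δ N)) := by
  have hd' : (1 : ℝ) ≤ d := by exact_mod_cast hd
  refine ⟨fun p hp => ⟨meanRadius d p, fun N hN => hasUniformMean_holeRadiusSum hd hN hp,
    exists_meanRadius_eq_meanMain_mul hd hp, fun hd2 => ?_, fun hd1 => ?_, fun hd2 L hL => ?_⟩,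
    meanRadius d 0, fun N hN => ?_, ?_⟩
  -- For `d ≥ 2` one has `2/d ≤ 1`, so the geometric error is the larger one; for `d = 1` it is
  -- `N^(-2)` and `N⁻¹` prevails.
  · refine exists_meanRadius_eq_momentConst_mul hd hp ?_ (isBigO_refl _ _)
    have hd2' : (2 : ℝ) ≤ d := by exact_mod_cast hd2
    have := isBigO_rpow_neg (a := 1) (b := 2 / d) (by rw [div_le_one (by linarith)]; exact hd2')
    simpa only [Real.rpow_neg_one] using this
  · refine exists_meanRadius_eq_momentConst_mul hd hp (isBigO_refl _ _) ?_
    subst hd1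
    have := isBigO_rpow_neg (a := 2 / ((1 : ℕ) : ℝ)) (b := 1) (by norm_num)
    simpa only [Real.rpow_neg_one] using this
  · subst hd2
    obtain ⟨M, -, hM⟩ := exists_gamma_ratio_expansion (q := p / 2) (by positivity) hL
    -- The mean is exact for `d = 2`, so `δ` is just the remainder in the expansion of the Gamma
    -- ratio.
    refine ⟨fun N => Real.Gamma (N + 1) / Real.Gamma (N + 1 + p / 2) * (N : ℝ) ^ (p / 2) -
      (1 + ∑ l ∈ Finset.Ico 1 L,
        Ring.choose (-(p / 2)) l * genBernoulli l (1 - p / 2) 1 / (N : ℝ) ^ l), ?_, ?_⟩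
    · refine IsBigO.of_bound M ?_
      filter_upwards [eventually_ge_atTop 1] with N hN
      rw [Real.norm_eq_abs, Real.norm_of_nonneg (by positivity)]
      exact hM N hN
    · filter_upwards [eventually_ge_atTop 4] with N hN
      have hN' : (0 : ℝ) < N := by exact_mod_cast (by omega : 0 < N)
      have h1 := Real.rpow_pos_of_pos hN' (p / 2)
      rw [meanRadius_two hp hN, add_sub_cancel, Real.rpow_neg hN'.le]
      field_simp
  · simpa only [facetCount_eq] using hasUniformMean_holeRadiusSum hd hN le_rfl
  · obtain ⟨δ, hδ, h⟩ := exists_meanRadius_eq_meanMain_mul hd le_rfl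
    refine ⟨δ, hδ, ?_⟩
    filter_upwards [h, eventually_ge_atTop 1] with N hN hN1
    have hN' : (0 : ℝ) < N := by exact_mod_cast hN1
    have h1 := Real.Gamma_pos_of_pos hN'
    have h2 := Real.Gamma_pos_of_pos (s := (d : ℝ)) (by linarith)
    -- For `p = 0` the Gamma quotient is exactly `Γ(N + 1)/Γ(N) = N`, so no `N⁻¹` error arises, not
    -- even for `d = 1`.
    rw [hN, meanMain, zero_div, neg_zero, Real.rpow_zero, mul_one, add_zero, add_zero,
      Real.Gamma_add_one hN'.ne']
    field_simp
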